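/- Notation. Use cylindrical coordinates $(r,\theta,z)$ in $\mathbb R^3$ and let $G(\boldsymbol x,\boldsymbol x_0)=1/|\boldsymbol x-\boldsymbol x_0|$. For $m<1$ let $K(m)=\int_0^{\pi/2}(1-m\sin^2\theta)^{-1/2}d\theta$ and $E(m)=\int_0^{\pi/2}(1-m\sin^2\theta)^{1/2}d\theta$. For points $(r_0,z_0)\ne(r,z)$ of the half-plane $r\ge 0$ and a vector $(n_r,n_z)$ put $\bar R=\sqrt{(r+r_0)^2+(z-z_0)^2}$, $m=4rr_0/\bar R^2$ and $$\mathcal E=\frac{r\,E(m)}{(1-m)\bar R^3}\Big[(r-r_0)n_r+(z-z_0)n_z-\frac{2r_0n_r(1-m)}{m}\Big],\qquad \mathcal K=\frac{2\,r\,r_0\,n_r\,K(m)}{m\bar R^3},\qquad \mathcal S=\frac{r\,K(m)}{\bar R},$$ where $r r_0/m$ is read as its limiting value $\bar R^2/4$ if $m=0$. Setting. Let $\Omega\subset\mathbb R^3$ be a bounded axisymmetric open set whose boundary $S$ is the surface of revolution of a piecewise $C^2$ meridian curve $\Gamma$ (finitely many regular $C^2$ arcs in $r\ge0$, with $r>0$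 in their interiors, meeting at most at end points, with $\Omega$ on exactly one side), with outward unit normal $\boldsymbol n=(n_r\cos\theta,n_r\sin\theta,n_z)$. Let $\phi$ be axisymmetric, continuous on $\overline\Omega$ and harmonic in $\Omega$, with $\nabla\phi$ extending continuously to $\overline\Omega$. Let $\boldsymbol x_0=(r_0,0,z_0)\in S$, $r_0\ge 0$, be either an interior point of one of the arcs, or an end point of an arc on the axis at which the arc meets the axis orthogonally and through which no other part of $\Gamma$ passes; its outward normal is $\boldsymbol n_0=(n_{r0},0,n_{z0})$. Let $\boldsymbol x_D=(0,0,z_D)\notin\overline\Omega$ with $\boldsymbol n_0\cdot(\boldsymbol x_0-\boldsymbol x_D)\ne0$. Put $\phi_0=\phi(\boldsymbol x_0)$, $(\partial\phi/\partial n)_0=\nabla\phi(\boldsymbol x_0)\cdot\boldsymbol n_0$, $$\psi(\boldsymbol x)=\phi_0+\Big(\frac{\partial\phi}{\partial n}\Big)_0\frac{|\boldsymbol x_0-\boldsymbol x_D|^2}{\boldsymbol n_0\cdot(\boldsymbol x_0-\boldsymbol x_D)}\Big(1-\frac{|\boldsymbol x_0-\boldsymbol x_D|}{|\boldsymbol x-\boldsymbol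 x_D|}\Big),\qquad \chi=\phi-\psi .$$ Claims. (1) With $\rho=\sqrt{r^2+(z-z_D)^2}$, $s=rn_r+(z-z_D)n_z$, and $\rho_0,s_0$ their values at $\boldsymbol x_0$, for every $\boldsymbol x\neq\boldsymbol x_D$ and every direction $(n_r\cos\theta,n_r\sin\theta,n_z)$, $$\psi=\phi_0+\Big(\frac{\partial\phi}{\partial n}\Big)_0\frac{\rho-\rho_0}{\rho}\,\frac{\rho_0^2}{s_0},\qquad \frac{\partial\psi}{\partial n}=\Big(\frac{\partial\phi}{\partial n}\Big)_0\Big(\frac{\rho_0}{\rho}\Big)^3\frac{s}{s_0}.$$ (2) For $(r,z)\neq(r_0,z_0)$ with $r,r_0\ge0$ (arbitrary points and normals) one has $0\le m<1$, and $$r\int_0^{2\pi}G\,d\theta=4\mathcal S,\qquad r\int_0^{2\pi}\frac{\partial G}{\partial n}\,d\theta=-4(\mathcal E+\mathcal K).$$ (3) All integrals below converge absolutely, and $$\int_S\chi\frac{\partial G}{\partial n}\,dS=-4\int_\Gamma\chi\,(\mathcal E+\mathcal K)\,d\Gamma,\qquad \int_S\frac{\partial\chi}{\partial n}G\,dS=4\int_\Gamma\frac{\partial\chi}{\partial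 n}\,\mathcal S\,d\Gamma .$$ (4) The non-singular equation $\int_S\chi\,\partial G/\partial n\,dS=\int_S(\partial\chi/\partial n)\,G\,dS$ holds; equivalently, as a line integral, $$\int_\Gamma\frac{\chi\,r\,E(m)}{(1-m)\bar R^3}\Big[(r-r_0)n_r+(z-z_0)n_z-\frac{2r_0n_r(1-m)}{m}\Big]d\Gamma=-\int_\Gamma\frac{2rr_0n_r\,\chi\,K(m)}{m\bar R^3}\,d\Gamma-\int_\Gamma\frac{\partial\chi}{\partial n}\,\frac{r\,K(m)}{\bar R}\,d\Gamma .$$ (5) $K(m)/\log\frac1{1-m}\to\frac12$ as $m\to1^-$, and this singularity is cancelled: $\chi\mathcal E$ and $\chi\mathcal K$, given the value $0$ at $\boldsymbol x_0$, are continuous along every arc of $\Gamma$, and if $r_0>0$ then $\chi=O(\sqrt{1-m})$ and $K(m)\chi\to0$ as $\boldsymbol x\to\boldsymbol x_0$ along $\Gamma$. If moreover $\nabla\phi(\boldsymbol x)-\nabla\phi(\boldsymbol x_0)=O(|\boldsymbol x-\boldsymbol x_0|)$ as $\boldsymbol x\to\boldsymbol x_0$ in $\overline\Omega$, the same holds for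 $(\partial\chi/\partial n)\,\mathcal S$ and $\partial\chi/\partial n$ in place of $\chi\mathcal K$ and $\chi$. (6) Nodes on the axis need no special treatment: (1)–(5) include $r_0=0$ (apart from the statements made for $r_0>0$), and $\mathcal E,\mathcal K,\mathcal S$ are jointly continuous functions of $(r_0,z_0,r,z,n_r,n_z)$ on the set $r_0\ge0$, $r\ge0$, $(r,z)\ne(r_0,z_0)$. -/

import Mathlib

open Set Filter Topology MeasureTheory
open scoped RealInnerProductSpace Gradient

noncomputable section

namespace NSBIM

/-- Three-dimensional Euclidean space. -/
abbrev E3 : Type := EuclideanSpace ℝ (Fin 3)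

/-- The point with cylindrical coordinates `(r, θ, z)`, i.e. `(r cos θ, r sin θ, z)`.
The vector with radial component `nr`, no azimuthal component and axial component `nz`, at
azimuth `θ`, is `(nr cos θ, nr sin θ, nz) = cyl nr θ nz`. -/
def cyl (r θ z : ℝ) : E3 := !₂[r * Real.cos θ, r * Real.sin θ, z]

/-! ### Special functions and kernels -/

/-- Complete elliptic integral of the first kind, as a function of the parameter `m`. -/
def ellipticK (m : ℝ) : ℝ :=
  ∫ θ in (0 : ℝ)..(Real.pi / 2), 1 / Real.sqrt (1 - m * Real.sin θ ^ 2)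

/-- Complete elliptic integral of the second kind, as a function of the parameter `m`. -/
def ellipticE (m : ℝ) : ℝ :=
  ∫ θ in (0 : ℝ)..(Real.pi / 2), Real.sqrt (1 - m * Real.sin θ ^ 2)

/-- The free-space Green function `G(x, x₀) = 1 / |x - x₀|`. -/
def green (x₀ x : E3) : ℝ := 1 / ‖x - x₀‖

/-- `R̄ = √((r + r₀)² + (z - z₀)²)`. -/
def Rbar (r₀ z₀ r z : ℝ) : ℝ := Real.sqrt ((r + r₀) ^ 2 + (z - z₀) ^ 2)

/-- The parameter `m = 4 r r₀ / R̄²`. -/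
def param (r₀ z₀ r z : ℝ) : ℝ := 4 * r * r₀ / Rbar r₀ z₀ r z ^ 2

/-- The kernel
`r E(m) / ((1 - m) R̄³) * [(r - r₀) n_r + (z - z₀) n_z - 2 r₀ n_r (1 - m) / m]`.
Where `m = 0` (one of the two points is on the axis) the quotient `r r₀ / m` has the form `0 / 0`;
since `r r₀ / m = R̄² / 4` whenever `m ≠ 0`, it is given its limiting value `R̄² / 4`, and
`E(0) = π / 2`. -/
def kernelE (r₀ z₀ r z nr nz : ℝ) : ℝ :=
  let m := param r₀ z₀ r z
  let R := Rbar r₀ z₀ r z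
  if m = 0 then
    r * (Real.pi / 2) / R ^ 3 * ((r - r₀) * nr + (z - z₀) * nz) - Real.pi / 4 * nr / R
  else
    r * ellipticE m / ((1 - m) * R ^ 3) *
      ((r - r₀) * nr + (z - z₀) * nz - 2 * r₀ * nr * (1 - m) / m)

/-- The kernel `2 r r₀ n_r K(m) / (m R̄³)`, with its limiting value `(π / 4) n_r / R̄` where
`m = 0`. -/
def kernelK (r₀ z₀ r z nr : ℝ) : ℝ :=
  let m := param r₀ z₀ r z
  let R := Rbar r₀ z₀ r z
  if m = 0 then Real.pi / 4 * nr / R else 2 * r * r₀ * nr * ellipticK m / (m * R ^ 3)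

/-- The kernel `r K(m) / R̄`. -/
def kernelS (r₀ z₀ r z : ℝ) : ℝ :=
  r * ellipticK (param r₀ z₀ r z) / Rbar r₀ z₀ r z

/-! ### The auxiliary function -/

/-- `ψ(x) = φ₀ + q₀ |x₀ - x_D|² / (n₀ · (x₀ - x_D)) * (1 - |x₀ - x_D| / |x - x_D|)`, where
`φ₀ = φ(x₀)`, `q₀ = (∂φ/∂n)₀` and `n₀` is the outward unit normal at `x₀`. -/
def auxPsi (φ₀ q₀ : ℝ) (x₀ n₀ xD x : E3) : ℝ :=
  φ₀ + q₀ * (‖x₀ - xD‖ ^ 2 / ⟪n₀, x₀ - xD⟫) * (1 - ‖x₀ - xD‖ / ‖x - xD‖)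

/-- `ρ = √(r² + (z - z_D)²)`. -/
def rho (zD r z : ℝ) : ℝ := Real.sqrt (r ^ 2 + (z - zD) ^ 2)

/-- `s = r n_r + (z - z_D) n_z`. -/
def sVal (zD r z nr nz : ℝ) : ℝ := r * nr + (z - zD) * nz

/-! ### Axisymmetric surfaces and domains -/

/-- A regular `C²` arc `t ↦ (r t, z t)`, `t ∈ [0, 1]`, in the meridian half-plane `r ≥ 0`, meeting
the axis `r = 0` at most at its end points. (Values outside `[0, 1]` are never used; every `C²`
function on `[0, 1]` extends to a `C²` function on the line.) -/
structure MeridianArc where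
  r : ℝ → ℝ
  z : ℝ → ℝ
  contDiff_r : ContDiff ℝ 2 r
  contDiff_z : ContDiff ℝ 2 z
  r_nonneg : ∀ t ∈ Icc (0 : ℝ) 1, 0 ≤ r t
  r_pos : ∀ t ∈ Ioo (0 : ℝ) 1, 0 < r t
  regular : ∀ t ∈ Icc (0 : ℝ) 1, 0 < deriv r t ^ 2 + deriv z t ^ 2

namespace MeridianArc

variable (γ : MeridianArc)

/-- The speed `|γ'(t)|`, so that `dΓ = |γ'(t)| dt`. -/
def speed (t : ℝ) : ℝ := Real.sqrt (deriv γ.r t ^ 2 + deriv γ.z t ^ 2)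

/-- Radial component of the unit normal on the right-hand side of the arc. -/
def nr (t : ℝ) : ℝ := deriv γ.z t / γ.speed t

/-- Axial component of the unit normal on the right-hand side of the arc. -/
def nz (t : ℝ) : ℝ := -deriv γ.r t / γ.speed t

/-- Parametrization `(t, θ) ↦ (r t cos θ, r t sin θ, z t)` of the surface of revolution. -/
def surf (p : ℝ × ℝ) : E3 := cyl (γ.r p.1) p.2 (γ.z p.1)

/-- Unit normal of the surface of revolution at the point with parameters `(t, θ)`. -/
def normal (p : ℝ × ℝ) : E3 := cyl (γ.nr p.1) p.2 (γ.nz p.1)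

end MeridianArc

/-- The area element `|∂_t X × ∂_θ X|` of a parametrized surface in space, written as the square
root of the Gram determinant of the two partial derivatives. -/
def areaElement (X : ℝ × ℝ → E3) (p : ℝ × ℝ) : ℝ :=
  let u := deriv (fun t => X (t, p.2)) p.1
  let v := deriv (fun θ => X (p.1, θ)) p.2
  Real.sqrt (‖u‖ ^ 2 * ‖v‖ ^ 2 - ⟪u, v⟫ ^ 2)

/-- A bounded axisymmetric domain with piecewise `C²` boundary. The boundary is the union of the
surfaces of revolution of finitely many meridian arcs that meet at most at end points, and the
arcs are traversed so that the exterior of the domain is on their right-hand side. (The boundary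
may have several components, some of which may be toroidal; edges and conical tips are allowed
at end points of the arcs.) -/
structure AxisymDomain where
  Ω : Set E3
  isOpen : IsOpen Ω
  bounded : Bornology.IsBounded Ω
  rotation : ∀ r θ θ' z, cyl r θ z ∈ Ω → cyl r θ' z ∈ Ω
  N : ℕ
  arc : Fin N → MeridianArc
  frontier_eq : frontier Ω = {x | ∃ i, ∃ t ∈ Icc (0 : ℝ) 1, ∃ θ, x = (arc i).surf (t, θ)}
  simple : ∀ i j, ∀ t ∈ Ioo (0 : ℝ) 1, ∀ s ∈ Icc (0 : ℝ) 1,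
    (arc i).r t = (arc j).r s → (arc i).z t = (arc j).z s → i = j ∧ t = s
  outward : ∀ i, ∀ t ∈ Ioo (0 : ℝ) 1, ∀ᶠ ε in 𝓝[>] (0 : ℝ),
    (arc i).surf (t, 0) - ε • (arc i).normal (t, 0) ∈ Ω ∧
    (arc i).surf (t, 0) + ε • (arc i).normal (t, 0) ∉ closure Ω

namespace AxisymDomain

variable (D : AxisymDomain)

/-- The parameter `t₀` of the `i₀`-th arc gives a boundary point at which the outward unit normal
is uniquely defined: an interior point of the arc, or an end point on the axis at which the arc
meets the axis orthogonally and through which no other part of the boundary passes. -/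
def IsNode (i₀ : Fin D.N) (t₀ : ℝ) : Prop :=
  t₀ ∈ Ioo (0 : ℝ) 1 ∨
    (t₀ ∈ Icc (0 : ℝ) 1 ∧ (D.arc i₀).r t₀ = 0 ∧ deriv (D.arc i₀).z t₀ = 0 ∧
      ∀ j, ∀ s ∈ Icc (0 : ℝ) 1, (D.arc j).r s = 0 → (D.arc j).z s = (D.arc i₀).z t₀ →
        j = i₀ ∧ s = t₀)

/-- `F(x, n)` is integrable over the boundary surface; `n` stands for the outward normal. -/
def SurfaceIntegrable (F : E3 → E3 → ℝ) : Prop :=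
  ∀ i, IntegrableOn
    (fun p => F ((D.arc i).surf p) ((D.arc i).normal p) * areaElement (D.arc i).surf p)
    (Icc (0 : ℝ) 1 ×ˢ Icc (0 : ℝ) (2 * Real.pi))

/-- The surface integral of `F(x, n(x))` over the boundary, `n` being the outward normal. -/
def surfaceIntegral (F : E3 → E3 → ℝ) : ℝ :=
  ∑ i, ∫ p in Icc (0 : ℝ) 1 ×ˢ Icc (0 : ℝ) (2 * Real.pi),
    F ((D.arc i).surf p) ((D.arc i).normal p) * areaElement (D.arc i).surf p

/-- The value at `t` on the `i`-th arc of a function `f(r, z, n_r, n_z)` on the meridian curve. -/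
def onArc (f : ℝ → ℝ → ℝ → ℝ → ℝ) (i : Fin D.N) (t : ℝ) : ℝ :=
  f ((D.arc i).r t) ((D.arc i).z t) ((D.arc i).nr t) ((D.arc i).nz t)

/-- `f(r, z, n_r, n_z)` is integrable with respect to arc length on the meridian curve. -/
def LineIntegrable (f : ℝ → ℝ → ℝ → ℝ → ℝ) : Prop :=
  ∀ i, IntervalIntegrable (fun t => D.onArc f i t * (D.arc i).speed t) volume 0 1

/-- The line integral `∫ f dΓ` along the meridian curve. -/
def lineIntegral (f : ℝ → ℝ → ℝ → ℝ → ℝ) : ℝ :=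
  ∑ i, ∫ t in (0 : ℝ)..1, D.onArc f i t * (D.arc i).speed t

/-- The function `f(r, z, n_r, n_z)`, given the value `0` at the point `(r₀, z₀)`, is continuous
along every arc of the meridian curve. -/
def RegularAlong (r₀ z₀ : ℝ) (f : ℝ → ℝ → ℝ → ℝ → ℝ) : Prop :=
  ∀ i, ContinuousOn
    (fun t => if (D.arc i).r t = r₀ ∧ (D.arc i).z t = z₀ then 0 else D.onArc f i t)
    (Icc (0 : ℝ) 1)

end AxisymDomain

end NSBIM

end

open NSBIM

/-! The function ψ is a constant plus a multiple of the potential of a point charge at x_D, which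
lies outside the closure of Ω. So χ = φ - ψ is axisymmetric, harmonic in Ω and C¹ up to the
boundary; ψ is normalized so that χ and ∂χ/∂n both vanish at x₀. Since χ(x₀) = 0, Green's second
identity for χ and G produces no jump term at x₀, and that is the non-singular equation.

The proof takes place in the meridian half-plane. With the ring potential W = ∫ G dθ, the azimuthal
integrals say S = rW/4 and E + K = -(r/4) ∂W/∂n (`integral_green`, `integral_normal_deriv_green`).
The sum of the three line integrals is therefore the flux through Γ of the plane field V =
-(r/4)(χ∇W - W∇χ), called `bieField`. Both χ and W solve ∂ᵣ(r ∂ᵣu) + ∂_z(r ∂_z u) = 0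
(`IsAxisymC1.isAxisymHarmonicAt`, `isAxisymHarmonicAt_ring`), so V has no divergence, and its radial
component vanishes on the axis.

It remains to apply the divergence theorem to a field that is singular at x₀, in a section with
corners (`IsSolenoidal.sum_flux_eq_zero`). Integration by parts against a test function holds near
every point other than an end point of an arc or x₀: on a rectangle inside, in tubular coordinates
on the curve. Finitely many bumps globalize it. The exceptional points are cut out at scale ε;
because |V| ≤ C d^(-1/2), d being the distance to x₀, this costs area times gradient times field, ε²
· ε⁻¹ · ε^(-1/2), which tends to 0.

The bound on V rests on χ = O(d) up to the boundary. The segment from a point to x₀ may leave Ω, so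
the mean value inequality is used in the tubular coordinates of `IsNode.exists_tube`, where each
side of the curve is a convex box. It also uses that K(m) grows only logarithmically, hence K(m) ≤ C
d^(-1/2).

Along the arc of the node more is true. A C² arc leaves its tangent only to second order, and n_r/R̄
stays bounded, for r₀ = 0 because the arc meets the axis orthogonally. Hence the kernel E is bounded
there and χE, χK tend to 0. The surface integrands are dominated by a multiple of G, and Fubini
reduces them to line integrals. -/

namespace NSBIM

/-! ### Complete elliptic integrals and the logarithmic singularity of `K` -/

lemma one_sub_mul_sin_sq_pos {m : ℝ} (hm : m < 1) (θ : ℝ) : 0 < 1 - m * Real.sin θ ^ 2 := by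
  have h1 := Real.sin_sq_le_one θ
  have h2 := sq_nonneg (Real.sin θ)
  rcases le_or_gt m 0 with h | h
  · nlinarith
  · nlinarith

lemma continuous_of_one_div_sqrt {m : ℝ} (hm : m < 1) :
    Continuous fun θ : ℝ => 1 / Real.sqrt (1 - m * Real.sin θ ^ 2) :=
  continuous_const.div (by fun_prop)
    fun θ => (Real.sqrt_pos.2 (one_sub_mul_sin_sq_pos hm θ)).ne'

/-- No restriction on `m` is needed: the square root of a negative number is read as `0`, which
keeps the integrand continuous. -/
lemma continuous_ellipticE : Continuous ellipticE := by
  unfold ellipticE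
  exact intervalIntegral.continuous_parametric_intervalIntegral_of_continuous'
    (by unfold Function.uncurry; fun_prop) _ _

lemma continuousOn_ellipticK : ContinuousOn ellipticK (Iio 1) := by
  intro m hm
  obtain ⟨c, hmc, hc⟩ := exists_between (mem_Iio.1 hm)
  -- Capping the parameter at `c < 1` makes the integrand jointly continuous for all real `m`
  -- without changing it near the given point.
  have hcont : Continuous fun m : ℝ => ellipticK (min m c) := by
    unfold ellipticK
    refine intervalIntegral.continuous_parametric_intervalIntegral_of_continuous' ?_ _ _
    unfold Function.uncurry
    refine continuous_const.div (by fun_prop) fun p => ?_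
    exact (Real.sqrt_pos.2 (one_sub_mul_sin_sq_pos ((min_le_right _ _).trans_lt hc) _)).ne'
  refine (hcont.continuousAt.congr ?_).continuousWithinAt
  filter_upwards [Iio_mem_nhds hmc] with x hx
  rw [min_eq_left (le_of_lt hx)]

lemma ellipticK_zero : ellipticK 0 = Real.pi / 2 := by simp [ellipticK]

lemma ellipticE_zero : ellipticE 0 = Real.pi / 2 := by simp [ellipticE]

lemma ellipticK_nonneg (m : ℝ) : 0 ≤ ellipticK m :=
  intervalIntegral.integral_nonneg (by positivity) fun _ _ => by positivity

lemma ellipticE_nonneg (m : ℝ) : 0 ≤ ellipticE m :=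
  intervalIntegral.integral_nonneg (by positivity) fun _ _ => by positivity

lemma ellipticE_le {m : ℝ} (h0 : 0 ≤ m) : ellipticE m ≤ Real.pi / 2 := by
  rw [← ellipticE_zero]
  refine intervalIntegral.integral_mono_on (by positivity)
    (Continuous.intervalIntegrable (by fun_prop) _ _)
    (Continuous.intervalIntegrable (by fun_prop) _ _) fun θ _ => Real.sqrt_le_sqrt ?_
  nlinarith [sq_nonneg (Real.sin θ)]

/-- The third-order complete integral `∫ Δ⁻³` reduces to `E`. -/
lemma integral_one_div_sqrt_pow_three {m : ℝ} (hm : m < 1) :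
    ∫ θ in (0 : ℝ)..(Real.pi / 2), 1 / Real.sqrt (1 - m * Real.sin θ ^ 2) ^ 3
      = ellipticE m / (1 - m) := by
  have hpos := one_sub_mul_sin_sq_pos hm
  have hs : ∀ θ : ℝ, 0 < Real.sqrt (1 - m * Real.sin θ ^ 2) := fun θ => Real.sqrt_pos.2 (hpos θ)
  -- With Δ = √(1 - m sin²θ), the derivative of m sin θ cos θ / Δ is Δ - (1 - m)Δ⁻³. The function
  -- vanishes at both ends of the interval, which gives ∫ Δ = (1 - m) ∫ Δ⁻³.
  have hd : ∀ θ : ℝ, HasDerivAt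
      (fun θ => m * (Real.sin θ * Real.cos θ) / Real.sqrt (1 - m * Real.sin θ ^ 2))
      (Real.sqrt (1 - m * Real.sin θ ^ 2)
        - (1 - m) * (1 / Real.sqrt (1 - m * Real.sin θ ^ 2) ^ 3)) θ := by
    intro θ
    have h1 : HasDerivAt (fun θ => 1 - m * Real.sin θ ^ 2)
        (-(m * (2 * Real.sin θ * Real.cos θ))) θ := by
      have := (((Real.hasDerivAt_sin θ).pow 2).const_mul m).const_sub 1
      simpa using this
    have h2 := h1.sqrt (hpos θ).ne'
    have h3 := (((Real.hasDerivAt_sin θ).mul (Real.hasDerivAt_cos θ)).const_mul m).div h2 (hs θ).ne'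
    refine h3.congr_deriv ?_
    have hsq := Real.sq_sqrt (hpos θ).le
    have hD := (hs θ).ne'
    simp only [Pi.mul_apply]
    generalize Real.sqrt (1 - m * Real.sin θ ^ 2) = D at hsq hD ⊢
    have hcos : Real.cos θ ^ 2 = 1 - Real.sin θ ^ 2 := Real.cos_sq' θ
    have h4 : D ^ 4 = (1 - m * Real.sin θ ^ 2) ^ 2 := by rw [← hsq]; ring
    field_simp
    simp only [h4, hsq]
    linear_combination (m ^ 2 * Real.sin θ ^ 2 + m * (1 - m * Real.sin θ ^ 2)) * hcos
  have hc1 : Continuous fun θ : ℝ => Real.sqrt (1 - m * Real.sin θ ^ 2) := by fun_prop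
  have hc3 : Continuous fun θ : ℝ => 1 / Real.sqrt (1 - m * Real.sin θ ^ 2) ^ 3 :=
    continuous_const.div (by fun_prop) fun θ => (pow_pos (hs θ) 3).ne'
  have hF := intervalIntegral.integral_eq_sub_of_hasDerivAt (a := 0) (b := Real.pi / 2)
    (fun θ _ => hd θ) ((hc1.sub (continuous_const.mul hc3)).intervalIntegrable _ _)
  rw [intervalIntegral.integral_sub (hc1.intervalIntegrable _ _)
    ((hc3.intervalIntegrable _ _).const_mul _), intervalIntegral.integral_const_mul] at hF
  simp only [Real.sin_zero, Real.cos_pi_div_two] at hF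
  have h1m : (1 - m) ≠ 0 := by linarith
  rw [eq_div_iff h1m]
  unfold ellipticE
  simp at hF ⊢
  linarith

/-- The comparison integral for `K`: with numerator sin θ the integrand has the elementary primitive
-arsinh((k/q) cos θ)/k, where k = √m and q = √(1 - m), and arsinh(k/q) = log((1 + k)/q). -/
lemma integral_sin_div_sqrt {m : ℝ} (h0 : 0 < m) (hm : m < 1) :
    ∫ θ in (0 : ℝ)..(Real.pi / 2), Real.sin θ / Real.sqrt (1 - m * Real.sin θ ^ 2)
      = (Real.log (1 + Real.sqrt m) + 1 / 2 * Real.log (1 / (1 - m))) / Real.sqrt m := by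
  have hpos := one_sub_mul_sin_sq_pos hm
  have hk : 0 < Real.sqrt m := Real.sqrt_pos.2 h0
  have hk2 : Real.sqrt m ^ 2 = m := Real.sq_sqrt h0.le
  set k := Real.sqrt m
  have h1m : 0 < 1 - m := by linarith
  have hq : 0 < Real.sqrt (1 - m) := Real.sqrt_pos.2 h1m
  have hq2 : Real.sqrt (1 - m) ^ 2 = 1 - m := Real.sq_sqrt h1m.le
  set q := Real.sqrt (1 - m)
  have hd : ∀ θ : ℝ, HasDerivAt (fun θ => -(Real.arsinh (k / q * Real.cos θ) / k))
      (Real.sin θ / Real.sqrt (1 - m * Real.sin θ ^ 2)) θ := by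
    intro θ
    have h1 := (((((Real.hasDerivAt_cos θ).const_mul (k / q)).arsinh)).div_const k).neg
    refine h1.congr_deriv ?_
    have : Real.sqrt (1 + (k / q * Real.cos θ) ^ 2)
        = Real.sqrt (1 - m * Real.sin θ ^ 2) / q := by
      rw [eq_div_iff hq.ne', ← Real.sqrt_sq hq.le, ← Real.sqrt_mul (by positivity)]
      congr 1
      rw [Real.sqrt_sq hq.le, mul_pow, div_pow, hk2, hq2, Real.cos_sq']
      field_simp
      ring
    rw [this]
    have := (Real.sqrt_pos.2 (hpos θ)).ne'
    simp only [smul_eq_mul]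
    field_simp
  have hc : Continuous fun θ : ℝ => Real.sin θ / Real.sqrt (1 - m * Real.sin θ ^ 2) :=
    Real.continuous_sin.div (by fun_prop) fun θ => (Real.sqrt_pos.2 (hpos θ)).ne'
  rw [intervalIntegral.integral_eq_sub_of_hasDerivAt (fun θ _ => hd θ) (hc.intervalIntegrable _ _)]
  simp only [Real.cos_pi_div_two, mul_zero, Real.arsinh_zero, zero_div, neg_zero, zero_sub,
    Real.cos_zero, mul_one, neg_neg]
  congr 1
  have : Real.sqrt (1 + (k / q) ^ 2) = 1 / q := by
    rw [div_pow, hk2, hq2]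
    have : 1 + m / (1 - m) = 1 / (1 - m) := by field_simp; ring
    rw [this, Real.sqrt_div zero_le_one, Real.sqrt_one]
  rw [Real.arsinh, this, ← add_div, add_comm k 1, Real.log_div (by positivity) hq.ne',
    Real.log_sqrt h1m.le, Real.log_div one_ne_zero h1m.ne', Real.log_one]
  ring

/-- For s = sin θ in [0, 1] one has (1 - s)² ≤ 1 - s² ≤ 1 - m s², so replacing the numerator 1 by s
changes the integrand by at most 1: the comparison integral carries the whole singularity. -/
lemma abs_ellipticK_sub_le {m : ℝ} (h0 : 0 < m) (hm : m < 1) :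
    |ellipticK m - (Real.log (1 + Real.sqrt m) + 1 / 2 * Real.log (1 / (1 - m))) / Real.sqrt m|
      ≤ Real.pi / 2 := by
  have hpos := one_sub_mul_sin_sq_pos hm
  have hs : ∀ θ : ℝ, 0 < Real.sqrt (1 - m * Real.sin θ ^ 2) := fun θ => Real.sqrt_pos.2 (hpos θ)
  have hc : Continuous fun θ : ℝ => Real.sin θ / Real.sqrt (1 - m * Real.sin θ ^ 2) :=
    Real.continuous_sin.div (by fun_prop) fun θ => (hs θ).ne'
  rw [← integral_sin_div_sqrt h0 hm, ellipticK, ← intervalIntegral.integral_sub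
    ((continuous_of_one_div_sqrt hm).intervalIntegrable _ _) (hc.intervalIntegrable _ _)]
  have := intervalIntegral.norm_integral_le_of_norm_le_const (a := 0) (b := Real.pi / 2) (C := 1)
    (f := fun θ => 1 / Real.sqrt (1 - m * Real.sin θ ^ 2)
      - Real.sin θ / Real.sqrt (1 - m * Real.sin θ ^ 2)) ?_
  · rw [one_mul, sub_zero, abs_of_pos (by positivity : (0 : ℝ) < Real.pi / 2)] at this
    exact this
  · intro θ hθ
    rw [uIoc_of_le (by positivity)] at hθ
    rw [← sub_div, Real.norm_eq_abs, abs_of_nonneg (div_nonneg (by linarith [Real.sin_le_one θ])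
      (hs θ).le), div_le_one (hs θ)]
    have h1 : 0 ≤ Real.sin θ := Real.sin_nonneg_of_nonneg_of_le_pi hθ.1.le (by linarith [hθ.2, Real.pi_pos])
    refine Real.le_sqrt_of_sq_le ?_
    nlinarith [Real.sin_le_one θ, mul_nonneg h1 (sub_nonneg.2 (Real.sin_le_one θ)), sq_nonneg (Real.sin θ)]

lemma tendsto_log_one_div_one_sub :
    Tendsto (fun m : ℝ => Real.log (1 / (1 - m))) (𝓝[<] 1) atTop := by
  refine Real.tendsto_log_atTop.comp ?_
  simp only [one_div]
  refine tendsto_inv_nhdsGT_zero.comp ?_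
  refine tendsto_nhdsWithin_iff.2 ⟨?_, ?_⟩
  · have : Tendsto (fun m : ℝ => 1 - m) (𝓝 1) (𝓝 (1 - 1)) := (continuous_const.sub continuous_id).tendsto 1
    rw [sub_self] at this
    exact this.mono_left nhdsWithin_le_nhds
  · filter_upwards [self_mem_nhdsWithin] with m hm
    simpa using hm

/-- After division by the divergent logarithm, the bounded difference of `abs_ellipticK_sub_le` and
the bounded term log(1 + √m) disappear, and √m tends to 1. -/
theorem tendsto_ellipticK_div_log :
    Tendsto (fun m => ellipticK m / Real.log (1 / (1 - m))) (𝓝[<] 1) (𝓝 (1 / 2)) := by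
  have hL := tendsto_log_one_div_one_sub
  have hsq : Tendsto (fun m : ℝ => Real.sqrt m) (𝓝[<] 1) (𝓝 1) := by
    have := (Real.continuous_sqrt.tendsto 1)
    rw [Real.sqrt_one] at this
    exact this.mono_left nhdsWithin_le_nhds
  have hlog : Tendsto (fun m : ℝ => Real.log (1 + Real.sqrt m)) (𝓝[<] 1) (𝓝 (Real.log (1 + 1))) :=
    (hsq.const_add 1).log (by norm_num)
  have hev : ∀ᶠ m : ℝ in 𝓝[<] 1, 0 < m ∧ m < 1 ∧ 0 < Real.log (1 / (1 - m)) := by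
    filter_upwards [self_mem_nhdsWithin, nhdsWithin_le_nhds (Ioi_mem_nhds (zero_lt_one' ℝ)),
      hL.eventually_gt_atTop 0] with m h1 h2 h3
    exact ⟨h2, h1, h3⟩
  have h1 : Tendsto (fun m : ℝ => (Real.log (1 + Real.sqrt m) / Real.log (1 / (1 - m)) + 1 / 2)
      / Real.sqrt m) (𝓝[<] 1) (𝓝 ((0 + 1 / 2) / 1)) :=
    ((hlog.div_atTop hL).add_const _).div hsq one_ne_zero
  have h2 : Tendsto (fun m : ℝ => (ellipticK m
      - (Real.log (1 + Real.sqrt m) + 1 / 2 * Real.log (1 / (1 - m))) / Real.sqrt m)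
      / Real.log (1 / (1 - m))) (𝓝[<] 1) (𝓝 0) := by
    refine squeeze_zero_norm' ?_ ((tendsto_const_nhds (x := Real.pi / 2)).div_atTop hL)
    filter_upwards [hev] with m hm
    rw [norm_div, Real.norm_eq_abs, Real.norm_eq_abs, abs_of_pos hm.2.2]
    exact div_le_div_of_nonneg_right (abs_ellipticK_sub_le hm.1 hm.2.1) hm.2.2.le
  have h3 := h2.add h1
  simp only [zero_add, div_one] at h3
  refine h3.congr' ?_
  filter_upwards [hev] with m hm
  have := hm.2.2.ne'
  have := (Real.sqrt_pos.2 hm.1).ne'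
  generalize Real.log (1 / (1 - m)) = L at *
  field_simp
  ring

/-- The logarithmic singularity is weaker than any power; the exponent `1 / 4` suffices here. -/
lemma exists_ellipticK_le :
    ∃ C : ℝ, 0 < C ∧ ∀ m : ℝ, 0 ≤ m → m < 1 → ellipticK m * Real.sqrt (Real.sqrt (1 - m)) ≤ C := by
  have hev := tendsto_ellipticK_div_log.eventually_lt_const (by norm_num : (1 / 2 : ℝ) < 1)
  have hev2 := tendsto_log_one_div_one_sub.eventually_gt_atTop 0
  obtain ⟨c, hc1, hc⟩ := (mem_nhdsLT_iff_exists_Ioo_subset).1 (hev.and hev2)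
  obtain ⟨B, hB⟩ := (isCompact_Icc (a := (0 : ℝ)) (b := c)).exists_bound_of_continuousOn
    (continuousOn_ellipticK.mono fun x hx => lt_of_le_of_lt hx.2 hc1)
  -- `B` bounds `K` on the compact part `m ≤ c`. For `m > c`, `K` is below log(1/(1 - m)) = 4
  -- log(1/q) ≤ 4/q with q = (1 - m)^(1/4), whence the 4.
  refine ⟨max 4 B, by positivity, fun m h0 h1 => ?_⟩
  have h1m : 0 < 1 - m := by linarith
  have hs : Real.sqrt (Real.sqrt (1 - m)) ≤ 1 := by
    rw [Real.sqrt_le_one, Real.sqrt_le_one]; linarith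
  rcases le_or_gt m c with h | h
  · have := hB m ⟨h0, h⟩
    rw [Real.norm_eq_abs, abs_of_nonneg (ellipticK_nonneg m)] at this
    calc _ ≤ ellipticK m * 1 := by gcongr; exact ellipticK_nonneg m
      _ ≤ _ := by rw [mul_one]; exact this.trans (le_max_right _ _)
  · obtain ⟨ha, hb⟩ := hc ⟨h, h1⟩
    rw [div_lt_one hb] at ha
    set q := Real.sqrt (Real.sqrt (1 - m)) with hq
    have hq0 : 0 < q := Real.sqrt_pos.2 (Real.sqrt_pos.2 h1m)
    have hq4 : q ^ 4 = 1 - m := by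
      rw [show q ^ 4 = (q ^ 2) ^ 2 by ring, hq, Real.sq_sqrt (Real.sqrt_nonneg _), Real.sq_sqrt h1m.le]
    have : Real.log (1 / (1 - m)) = 4 * Real.log (1 / q) := by
      rw [← hq4, one_div, one_div, Real.log_inv, Real.log_inv, Real.log_pow]; push_cast; ring
    have h4 : Real.log (1 / q) ≤ 1 / q := (Real.log_le_sub_one_of_pos (by positivity)).trans (by linarith)
    refine le_trans ?_ (le_max_left _ _)
    calc ellipticK m * q ≤ (4 * (1 / q)) * q := by gcongr; linarith
      _ = 4 := by field_simp

/-! ### Points in cylindrical coordinates -/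

lemma inner_cyl (a α c b β d : ℝ) :
    ⟪cyl a α c, cyl b β d⟫ = a * b * Real.cos (α - β) + c * d := by
  simp only [cyl, PiLp.inner_apply, Fin.sum_univ_three, RCLike.inner_apply, conj_trivial,
    Real.cos_sub]
  simp
  ring

lemma norm_cyl_sq (a α c : ℝ) : ‖cyl a α c‖ ^ 2 = a ^ 2 + c ^ 2 := by
  rw [← real_inner_self_eq_norm_sq, inner_cyl]; simp; ring

lemma norm_cyl (a α c : ℝ) : ‖cyl a α c‖ = Real.sqrt (a ^ 2 + c ^ 2) := by
  rw [← norm_cyl_sq, Real.sqrt_sq (norm_nonneg _)]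

lemma cyl_sub_axis (r θ z c : ℝ) (β : ℝ) : cyl r θ z - cyl 0 β c = cyl r θ (z - c) := by
  ext i; fin_cases i <;> simp [cyl]

lemma cyl_add (r θ z r' z' : ℝ) : cyl r θ z + cyl r' θ z' = cyl (r + r') θ (z + z') := by
  ext i; fin_cases i <;> simp [cyl, add_mul]

lemma smul_cyl (k r θ z : ℝ) : k • cyl r θ z = cyl (k * r) θ (k * z) := by
  ext i; fin_cases i <;> simp [cyl, mul_assoc]

lemma cyl_sub (r θ z r' z' : ℝ) : cyl r θ z - cyl r' θ z' = cyl (r - r') θ (z - z') := by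
  ext i; fin_cases i <;> simp [cyl, sub_mul]

lemma norm_cyl_sub_sq (r θ z a c : ℝ) :
    ‖cyl r θ z - cyl a 0 c‖ ^ 2 = r ^ 2 + a ^ 2 - 2 * r * a * Real.cos θ + (z - c) ^ 2 := by
  rw [norm_sub_sq_real, inner_cyl, norm_cyl_sq, norm_cyl_sq, sub_zero]; ring

lemma inner_cyl_sub (r θ z a c nr nz : ℝ) :
    ⟪cyl r θ z - cyl a 0 c, cyl nr θ nz⟫ = (r - a * Real.cos θ) * nr + (z - c) * nz := by
  rw [inner_sub_left, inner_cyl, inner_cyl, sub_self, Real.cos_zero, zero_sub, Real.cos_neg]; ring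

lemma continuous_cyl : Continuous fun p : ℝ × ℝ × ℝ => cyl p.1 p.2.1 p.2.2 := by
  unfold cyl
  refine (PiLp.continuous_toLp 2 _).comp (continuous_pi fun i => ?_)
  fin_cases i <;> simp <;> fun_prop

lemma cyl_injOn {r θ z r' θ' z' : ℝ} (hr : 0 ≤ r) (hr' : 0 ≤ r')
    (h : cyl r θ z = cyl r' θ' z') : r = r' ∧ z = z' := by
  have hz : z = z' := by simpa [cyl] using congrArg (fun x : E3 => x 2) h
  have hn := norm_cyl_sq r θ z
  rw [h, norm_cyl_sq, hz] at hn
  refine ⟨?_, hz⟩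
  nlinarith [(pow_left_inj₀ hr hr' two_ne_zero).1 (by linarith)]

lemma exists_cyl (x : E3) : ∃ r θ z, 0 ≤ r ∧ x = cyl r θ z := by
  refine ⟨‖(⟨x 0, x 1⟩ : ℂ)‖, Complex.arg ⟨x 0, x 1⟩, x 2, norm_nonneg _, ?_⟩
  ext i
  fin_cases i
  · simp [cyl, Complex.norm_mul_cos_arg]
  · simp [cyl, Complex.norm_mul_sin_arg]
  · simp [cyl]

/-- Used twice: with centre x₀ for `G` and with centre x_D for ψ. -/
lemma hasGradientAt_inv_norm_sub (x₀ : E3) {x : E3} (hx : x ≠ x₀) :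
    HasGradientAt (fun x => 1 / ‖x - x₀‖) (-(1 / ‖x - x₀‖ ^ 3) • (x - x₀)) x := by
  have hn : ‖x - x₀‖ ≠ 0 := norm_ne_zero_iff.2 (sub_ne_zero.2 hx)
  have h1 : HasFDerivAt (fun x => ‖x - x₀‖ ^ 2) (2 • innerSL ℝ (x - x₀)) x := by
    have := ((hasFDerivAt_id x).sub_const x₀).norm_sq
    simpa using this
  have h2 := h1.sqrt (by positivity)
  have h3 : HasFDerivAt (fun x => ‖x - x₀‖) ((1 / (2 * √(‖x - x₀‖ ^ 2))) • (2 • innerSL ℝ (x - x₀))) x := by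
    refine h2.congr_of_eventuallyEq (Eventually.of_forall fun y => ?_)
    exact (Real.sqrt_sq (norm_nonneg _)).symm
  have h4 := (hasDerivAt_inv hn).comp_hasFDerivAt x h3
  rw [hasGradientAt_iff_hasFDerivAt]
  simp only [one_div]
  refine h4.congr_fderiv ?_
  ext v
  simp [Real.sqrt_sq (norm_nonneg _)]
  field_simp

lemma gradient_green (x₀ : E3) {x : E3} (hx : x ≠ x₀) :
    ∇ (green x₀) x = -(1 / ‖x - x₀‖ ^ 3) • (x - x₀) :=
  (hasGradientAt_inv_norm_sub x₀ hx).gradient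

/-! ### Distances in the meridian half-plane and the parameter -/

/-- Distance in the meridian half-plane. -/
noncomputable def meridianDist (a c r z : ℝ) : ℝ := Real.sqrt ((r - a) ^ 2 + (z - c) ^ 2)

section param

variable {a c r z : ℝ}

lemma meridianDist_sq (a c r z : ℝ) : meridianDist a c r z ^ 2 = (r - a) ^ 2 + (z - c) ^ 2 :=
  Real.sq_sqrt (by positivity)

lemma meridianDist_nonneg (a c r z : ℝ) : 0 ≤ meridianDist a c r z := Real.sqrt_nonneg _

lemma meridianDist_pos (h : (r, z) ≠ (a, c)) : 0 < meridianDist a c r z := by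
  refine Real.sqrt_pos.2 ?_
  by_contra hle
  have h1 : (r - a) ^ 2 = 0 := by nlinarith [sq_nonneg (r - a), sq_nonneg (z - c)]
  have h2 : (z - c) ^ 2 = 0 := by nlinarith [sq_nonneg (r - a), sq_nonneg (z - c)]
  refine h (Prod.ext ?_ ?_)
  · exact sub_eq_zero.1 (by simpa using h1)
  · exact sub_eq_zero.1 (by simpa using h2)

lemma norm_cyl_sub_cyl (a c r z θ : ℝ) :
    ‖cyl r θ z - cyl a θ c‖ = meridianDist a c r z := by rw [cyl_sub, norm_cyl, meridianDist]

lemma Rbar_sq (a c r z : ℝ) : Rbar a c r z ^ 2 = (r + a) ^ 2 + (z - c) ^ 2 :=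
  Real.sq_sqrt (by positivity)

lemma Rbar_nonneg (a c r z : ℝ) : 0 ≤ Rbar a c r z := Real.sqrt_nonneg _

lemma meridianDist_le_Rbar (ha : 0 ≤ a) (hr : 0 ≤ r) : meridianDist a c r z ≤ Rbar a c r z :=
  Real.sqrt_le_sqrt (by nlinarith [mul_nonneg ha hr])

lemma Rbar_pos (ha : 0 ≤ a) (hr : 0 ≤ r) (h : (r, z) ≠ (a, c)) : 0 < Rbar a c r z :=
  (meridianDist_pos h).trans_le (meridianDist_le_Rbar ha hr)

lemma le_Rbar (ha : 0 ≤ a) (hr : 0 ≤ r) : r ≤ Rbar a c r z :=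
  Real.le_sqrt_of_sq_le (by nlinarith [mul_nonneg ha hr, sq_nonneg a, sq_nonneg (z - c)])

/-- This identity turns every estimate in `1 - m` into one in the distance of the two points: √(1 -
m) is the ratio of that distance to R̄. -/
lemma one_sub_param_mul (h : Rbar a c r z ≠ 0) :
    (1 - param a c r z) * Rbar a c r z ^ 2 = meridianDist a c r z ^ 2 := by
  have := Rbar_sq a c r z
  rw [param, sub_mul, div_mul_cancel₀ _ (pow_ne_zero 2 h), meridianDist_sq, one_mul, this]
  ring

lemma param_nonneg (ha : 0 ≤ a) (hr : 0 ≤ r) : 0 ≤ param a c r z := by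
  unfold param; positivity

lemma param_lt_one (ha : 0 ≤ a) (hr : 0 ≤ r) (h : (r, z) ≠ (a, c)) : param a c r z < 1 := by
  have hR := Rbar_pos ha hr h
  have hd := meridianDist_pos h
  have := one_sub_param_mul hR.ne'
  have : 0 < (1 - param a c r z) * Rbar a c r z ^ 2 := by rw [this]; positivity
  have := pos_of_mul_pos_left this (by positivity)
  linarith

lemma sqrt_one_sub_param (ha : 0 ≤ a) (hr : 0 ≤ r) (h : (r, z) ≠ (a, c)) :
    Real.sqrt (1 - param a c r z) = meridianDist a c r z / Rbar a c r z := by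
  have hR := Rbar_pos ha hr h
  have h1 : 1 - param a c r z = (meridianDist a c r z / Rbar a c r z) ^ 2 := by
    rw [div_pow, eq_div_iff (by positivity), one_sub_param_mul hR.ne']
  rw [h1, Real.sqrt_sq (div_nonneg (meridianDist_nonneg _ _ _ _) hR.le)]

/-- Since 4ra = mR̄², the quotient by `m` cancels and one formula covers both branches. No
hypothesis is needed: where R̄ = 0 both sides are 0, by division by zero. -/
lemma kernelK_eq (a c r z nr : ℝ) :
    kernelK a c r z nr = nr * ellipticK (param a c r z) / (2 * Rbar a c r z) := by
  unfold kernelK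
  simp only
  split_ifs with h
  · rw [h, ellipticK_zero]
    by_cases hR : Rbar a c r z = 0
    · simp [hR]
    · field_simp; ring
  · have hR : Rbar a c r z ≠ 0 := by
      intro h0; exact h (by simp [param, h0])
    have h1 : 4 * r * a = param a c r z * Rbar a c r z ^ 2 := by
      rw [param, div_mul_cancel₀ _ (pow_ne_zero 2 hR)]
    have h2 : 2 * r * a = param a c r z * Rbar a c r z ^ 2 / 2 := by linarith
    rw [h2]
    field_simp

/-- As in `kernelK_eq` the quotient by `m` cancels; moreover (1 - m)R̄² is the squared distance.
Continuity and all bounds are read off from this form, in which the axis is not special. -/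
lemma kernelE_eq (ha : 0 ≤ a) (hr : 0 ≤ r) (hne : (r, z) ≠ (a, c)) (nr nz : ℝ) :
    kernelE a c r z nr nz = r * ellipticE (param a c r z) /
        (meridianDist a c r z ^ 2 * Rbar a c r z) * ((r - a) * nr + (z - c) * nz)
      - ellipticE (param a c r z) * nr / (2 * Rbar a c r z) := by
  have hR := (Rbar_pos ha hr hne).ne'
  have hd := (meridianDist_pos hne).ne'
  have hm : 1 - param a c r z ≠ 0 := by linarith [param_lt_one ha hr hne]
  rw [← one_sub_param_mul hR]
  unfold kernelE
  simp only
  split_ifs with h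
  · rw [h, ellipticE_zero]
    field_simp
    ring
  · have h1 : 4 * r * a = param a c r z * Rbar a c r z ^ 2 := by
      rw [param, div_mul_cancel₀ _ (pow_ne_zero 2 hR)]
    generalize param a c r z = m at *
    generalize Rbar a c r z = R at *
    field_simp
    linear_combination (-(ellipticE m * nr * (1 - m))) * h1

lemma kernelS_nonneg (hr : 0 ≤ r) (a c z : ℝ) : 0 ≤ kernelS a c r z :=
  div_nonneg (mul_nonneg hr (ellipticK_nonneg _)) (Rbar_nonneg _ _ _ _)

lemma kernelS_le (ha : 0 ≤ a) (hr : 0 ≤ r) : kernelS a c r z ≤ ellipticK (param a c r z) := by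
  refine div_le_of_le_mul₀ (Rbar_nonneg _ _ _ _) (ellipticK_nonneg _) ?_
  rw [mul_comm]
  exact mul_le_mul_of_nonneg_left (le_Rbar ha hr) (ellipticK_nonneg _)

lemma meridianDist_mul_abs_kernelK_le (ha : 0 ≤ a) (hr : 0 ≤ r) {nr : ℝ} (hn : |nr| ≤ 1) :
    meridianDist a c r z * |kernelK a c r z nr| ≤ ellipticK (param a c r z) := by
  rw [kernelK_eq, abs_div, abs_mul, abs_of_nonneg (ellipticK_nonneg _),
    abs_of_nonneg (mul_nonneg zero_le_two (Rbar_nonneg _ _ _ _)), mul_div_assoc']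
  refine div_le_of_le_mul₀ (mul_nonneg zero_le_two (Rbar_nonneg _ _ _ _)) (ellipticK_nonneg _) ?_
  have h1 := meridianDist_le_Rbar (c := c) (z := z) ha hr
  have h2 := ellipticK_nonneg (param a c r z)
  have h3 := meridianDist_nonneg a c r z
  calc _ ≤ meridianDist a c r z * (1 * ellipticK (param a c r z)) := by gcongr
    _ ≤ (2 * Rbar a c r z) * ellipticK (param a c r z) := by
        rw [one_mul]; gcongr; linarith
    _ = _ := mul_comm _ _

lemma abs_inner_le_meridianDist {nr nz : ℝ} (hn : |nr| ≤ 1) (hn' : |nz| ≤ 1) :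
    |(r - a) * nr + (z - c) * nz| ≤ 2 * meridianDist a c r z := by
  have h1 : |r - a| ≤ meridianDist a c r z := Real.abs_le_sqrt (by nlinarith [sq_nonneg (z - c)])
  have h2 : |z - c| ≤ meridianDist a c r z := Real.abs_le_sqrt (by nlinarith [sq_nonneg (r - a)])
  calc _ ≤ |r - a| * |nr| + |z - c| * |nz| := by
        rw [← abs_mul, ← abs_mul]; exact abs_add_le ((r - a) * nr) ((z - c) * nz)
    _ ≤ meridianDist a c r z * 1 + meridianDist a c r z * 1 :=
        add_le_add (mul_le_mul h1 hn (abs_nonneg _) (meridianDist_nonneg _ _ _ _))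
          (mul_le_mul h2 hn' (abs_nonneg _) (meridianDist_nonneg _ _ _ _))
    _ = _ := by ring

/-- The product of chord and normal is kept explicit because it is estimated in two ways: to first
order on the whole section, to second order along the arc of the node. The factor 2 comes from E ≤
π/2 ≤ 2 together with r ≤ R̄. -/
lemma abs_kernelE_le (ha : 0 ≤ a) (hr : 0 ≤ r) (hne : (r, z) ≠ (a, c)) (nr nz : ℝ) :
    |kernelE a c r z nr nz| ≤ 2 * |(r - a) * nr + (z - c) * nz| / meridianDist a c r z ^ 2
      + |nr| / Rbar a c r z := by
  have hR := Rbar_pos ha hr hne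
  have hd := meridianDist_pos hne
  have hE0 := ellipticE_nonneg (param a c r z)
  have hE : ellipticE (param a c r z) ≤ 2 := (ellipticE_le (param_nonneg ha hr)).trans
    (by linarith [Real.pi_le_four])
  rw [kernelE_eq ha hr hne]
  refine (norm_sub_le (_ : ℝ) _).trans (add_le_add ?_ ?_)
  · have h1 : r * ellipticE (param a c r z) / (meridianDist a c r z ^ 2 * Rbar a c r z)
        ≤ 2 / meridianDist a c r z ^ 2 := by
      rw [div_le_div_iff₀ (mul_pos (pow_pos hd 2) hR) (pow_pos hd 2)]
      have := le_Rbar (c := c) (z := z) ha hr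
      calc _ ≤ Rbar a c r z * 2 * meridianDist a c r z ^ 2 := by gcongr
        _ = _ := by ring
    rw [Real.norm_eq_abs, abs_mul, abs_of_nonneg (by positivity), mul_div_right_comm 2]
    exact mul_le_mul_of_nonneg_right h1 (abs_nonneg _)
  · rw [Real.norm_eq_abs, abs_div, abs_mul, abs_of_nonneg hE0, abs_of_pos (by positivity : 0 < 2 * Rbar a c r z),
      div_le_div_iff₀ (by positivity) hR]
    have := abs_nonneg nr
    calc _ ≤ 2 * |nr| * Rbar a c r z := by gcongr
      _ = _ := by ring

lemma meridianDist_mul_abs_kernelE_le (ha : 0 ≤ a) (hr : 0 ≤ r) (hne : (r, z) ≠ (a, c))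
    {nr nz : ℝ} (hn : |nr| ≤ 1) (hn' : |nz| ≤ 1) :
    meridianDist a c r z * |kernelE a c r z nr nz| ≤ 5 := by
  have hR := Rbar_pos ha hr hne
  have hd := meridianDist_pos hne
  have h1 := abs_inner_le_meridianDist (a := a) (r := r) (c := c) (z := z) hn hn'
  have h2 := meridianDist_le_Rbar (c := c) (z := z) ha hr
  calc _ ≤ meridianDist a c r z * (2 * (2 * meridianDist a c r z) / meridianDist a c r z ^ 2
        + 1 / Rbar a c r z) := by
        refine mul_le_mul_of_nonneg_left ((abs_kernelE_le ha hr hne _ _).trans ?_) hd.le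
        gcongr
    _ = 4 + meridianDist a c r z / Rbar a c r z := by field_simp; ring
    _ ≤ 5 := by have := (div_le_one hR).2 h2; linarith

/-- The bound of `exists_ellipticK_le`, with (1 - m)^(1/4) rewritten as the square root of distance
over R̄. -/
lemma exists_ellipticK_param_le :
    ∃ C : ℝ, 0 < C ∧ ∀ a c r z : ℝ, 0 ≤ a → 0 ≤ r → (r, z) ≠ (a, c) →
      ellipticK (param a c r z) * Real.sqrt (meridianDist a c r z)
        ≤ C * Real.sqrt (Rbar a c r z) := by
  obtain ⟨C, hC, h⟩ := exists_ellipticK_le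
  refine ⟨C, hC, fun a c r z ha hr hne => ?_⟩
  have hR := Rbar_pos ha hr hne
  have := h _ (param_nonneg (c := c) (z := z) ha hr) (param_lt_one ha hr hne)
  rw [sqrt_one_sub_param ha hr hne, Real.sqrt_div (meridianDist_nonneg _ _ _ _), mul_div_assoc',
    div_le_iff₀ (Real.sqrt_pos.2 hR)] at this
  exact this

end param

/-! ### Azimuthal integrals -/

/-- Reflection folds [π, 2π] onto [0, π]; then θ is replaced by π - 2θ, with cos(π - 2θ) = 2 sin²θ -
1. This brings the azimuthal integrals to the Legendre form of `K` and `E`. -/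
lemma integral_comp_cos {F : ℝ → ℝ} (hF : Continuous fun θ => F (Real.cos θ)) :
    ∫ θ in (0 : ℝ)..(2 * Real.pi), F (Real.cos θ)
      = 4 * ∫ θ in (0 : ℝ)..(Real.pi / 2), F (2 * Real.sin θ ^ 2 - 1) := by
  have h1 : ∫ θ in (Real.pi : ℝ)..(2 * Real.pi), F (Real.cos θ)
      = ∫ θ in (0 : ℝ)..Real.pi, F (Real.cos θ) := by
    have := intervalIntegral.integral_comp_sub_left (a := 0) (b := Real.pi)
      (fun θ => F (Real.cos θ)) (2 * Real.pi)
    simp only [Real.cos_two_pi_sub] at this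
    rw [this]
    congr 1 <;> ring
  have h2 : ∫ θ in (0 : ℝ)..(Real.pi / 2), F (2 * Real.sin θ ^ 2 - 1)
      = 2⁻¹ * ∫ θ in (0 : ℝ)..Real.pi, F (Real.cos θ) := by
    have := intervalIntegral.integral_comp_sub_mul (a := 0) (b := Real.pi / 2)
      (fun θ => F (Real.cos θ)) (two_ne_zero) (Real.pi)
    rw [show Real.pi - 2 * (Real.pi / 2) = 0 by ring, mul_zero, sub_zero, smul_eq_mul] at this
    rw [← this]
    congr 1
    ext θ
    rw [Real.cos_pi_sub, Real.cos_two_mul, Real.cos_sq']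
    congr 1; ring
  rw [← intervalIntegral.integral_add_adjacent_intervals (hF.intervalIntegrable 0 Real.pi)
    (hF.intervalIntegrable Real.pi (2 * Real.pi)), h1, h2]
  ring

section azimuthal

variable {a c r z : ℝ}

lemma norm_cyl_sub_pos (ha : 0 ≤ a) (hr : 0 ≤ r) (h : (r, z) ≠ (a, c)) (θ : ℝ) :
    0 < ‖cyl r θ z - cyl a 0 c‖ := by
  rw [norm_pos_iff, sub_ne_zero]
  intro he
  obtain ⟨h1, h2⟩ := cyl_injOn hr ha he
  exact h (by rw [h1, h2])

lemma meridianDist_le_norm (ha : 0 ≤ a) (hr : 0 ≤ r) (θ : ℝ) :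
    meridianDist a c r z ≤ ‖cyl r θ z - cyl a 0 c‖ := by
  refine Real.sqrt_le_iff.2 ⟨norm_nonneg _, ?_⟩
  rw [norm_cyl_sub_sq]
  nlinarith [mul_nonneg (mul_nonneg ha hr) (sub_nonneg.2 (Real.cos_le_one θ))]

lemma sqrt_eq_Rbar_mul (ha : 0 ≤ a) (hr : 0 ≤ r) (h : (r, z) ≠ (a, c)) (θ : ℝ) :
    Real.sqrt (r ^ 2 + a ^ 2 - 2 * r * a * (2 * Real.sin θ ^ 2 - 1) + (z - c) ^ 2)
      = Rbar a c r z * Real.sqrt (1 - param a c r z * Real.sin θ ^ 2) := by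
  have hR := Rbar_pos ha hr h
  rw [← Real.sqrt_sq hR.le, ← Real.sqrt_mul (by positivity)]
  congr 1
  have h1 : 4 * r * a = param a c r z * Rbar a c r z ^ 2 := by
    rw [param, div_mul_cancel₀ _ (pow_ne_zero 2 hR.ne')]
  linear_combination (-Real.sin θ ^ 2) * h1 - Rbar_sq a c r z

theorem integral_green (ha : 0 ≤ a) (hr : 0 ≤ r) (h : (r, z) ≠ (a, c)) :
    r * (∫ θ in (0 : ℝ)..(2 * Real.pi), green (cyl a 0 c) (cyl r θ z)) = 4 * kernelS a c r z := by
  have hn : ∀ θ, ‖cyl r θ z - cyl a 0 c‖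
      = Real.sqrt (r ^ 2 + a ^ 2 - 2 * r * a * Real.cos θ + (z - c) ^ 2) := fun θ => by
    rw [← norm_cyl_sub_sq, Real.sqrt_sq (norm_nonneg _)]
  have hc := integral_comp_cos
    (F := fun x => 1 / Real.sqrt (r ^ 2 + a ^ 2 - 2 * r * a * x + (z - c) ^ 2)) (by
      refine continuous_const.div (by fun_prop) fun θ => ?_
      rw [← hn]; exact (norm_cyl_sub_pos ha hr h θ).ne')
  simp only [← hn] at hc
  unfold green
  rw [hc]
  simp only [sqrt_eq_Rbar_mul ha hr h]
  have hR := (Rbar_pos ha hr h).ne'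
  have : ∀ θ : ℝ, 1 / (Rbar a c r z * Real.sqrt (1 - param a c r z * Real.sin θ ^ 2))
      = (Rbar a c r z)⁻¹ * (1 / Real.sqrt (1 - param a c r z * Real.sin θ ^ 2)) := fun θ => by
    rw [one_div, mul_inv, one_div]
  simp only [this]
  rw [intervalIntegral.integral_const_mul, kernelS, ellipticK]
  field_simp

theorem integral_normal_deriv_green (ha : 0 ≤ a) (hr : 0 ≤ r) (h : (r, z) ≠ (a, c))
    (nr nz : ℝ) :
    r * (∫ θ in (0 : ℝ)..(2 * Real.pi), ⟪∇ (green (cyl a 0 c)) (cyl r θ z), cyl nr θ nz⟫)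
      = -4 * (kernelE a c r z nr nz + kernelK a c r z nr) := by
  have hn : ∀ θ, ‖cyl r θ z - cyl a 0 c‖
      = Real.sqrt (r ^ 2 + a ^ 2 - 2 * r * a * Real.cos θ + (z - c) ^ 2) := fun θ => by
    rw [← norm_cyl_sub_sq, Real.sqrt_sq (norm_nonneg _)]
  have hR := Rbar_pos ha hr h
  have hd := meridianDist_pos h
  have hm := param_lt_one ha hr h
  have hs : ∀ θ : ℝ, 0 < Real.sqrt (1 - param a c r z * Real.sin θ ^ 2) := fun θ =>
    Real.sqrt_pos.2 (one_sub_mul_sin_sq_pos hm θ)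
  have hc3 : Continuous fun θ : ℝ => 1 / Real.sqrt (1 - param a c r z * Real.sin θ ^ 2) ^ 3 :=
    continuous_const.div (by fun_prop) fun θ => (pow_pos (hs θ) 3).ne'
  have hc1 := continuous_of_one_div_sqrt hm
  have e1 : ∀ θ, ⟪∇ (green (cyl a 0 c)) (cyl r θ z), cyl nr θ nz⟫
      = -(((r - a * Real.cos θ) * nr + (z - c) * nz) / ‖cyl r θ z - cyl a 0 c‖ ^ 3) := fun θ => by
    have hp := norm_cyl_sub_pos ha hr h θ
    rw [gradient_green _ (sub_ne_zero.1 (norm_pos_iff.1 hp)), inner_smul_left, inner_cyl_sub]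
    simp only [conj_trivial]
    ring
  have hc := integral_comp_cos
    (F := fun x => -(((r - a * x) * nr + (z - c) * nz)
      / Real.sqrt (r ^ 2 + a ^ 2 - 2 * r * a * x + (z - c) ^ 2) ^ 3)) (by
      refine (Continuous.div (by fun_prop) (by fun_prop) fun θ => ?_).neg
      rw [← hn]; exact (pow_pos (norm_cyl_sub_pos ha hr h θ) 3).ne')
  simp only [← hn] at hc
  simp only [e1]
  rw [hc]
  simp only [sqrt_eq_Rbar_mul ha hr h]
  have hI3 := hc3.intervalIntegrable (μ := volume) 0 (Real.pi / 2)
  have hI1 := hc1.intervalIntegrable (μ := volume) 0 (Real.pi / 2)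
  have hE := integral_one_div_sqrt_pow_three hm
  rw [kernelE_eq ha hr h, kernelK_eq, ← one_sub_param_mul hR.ne']
  have hKdef : (∫ θ in (0 : ℝ)..(Real.pi / 2), 1 / Real.sqrt (1 - param a c r z * Real.sin θ ^ 2))
    = ellipticK (param a c r z) := rfl
  have h1 : 4 * r * a = param a c r z * Rbar a c r z ^ 2 := by
    rw [param, div_mul_cancel₀ _ (pow_ne_zero 2 hR.ne')]
  have hR' := hR.ne'
  have hm' : 1 - param a c r z ≠ 0 := by linarith
  -- For m = 0 one of the points is on the axis and the integrand is elementary; otherwise division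
  -- by `m` is allowed.
  by_cases hm0 : param a c r z = 0
  · rw [hm0] at h1 hE hKdef ⊢
    simp only [zero_mul, sub_zero, Real.sqrt_one, mul_one, ellipticE_zero, ellipticK_zero]
    have hra : r = 0 ∨ a = 0 := by
      have : r * a = 0 := by linarith
      exact mul_eq_zero.1 this
    rcases hra with h0 | h0
    · rw [h0]; simp; ring
    · rw [h0]
      simp
      field_simp
      ring
  -- In the numerator sin²θ is replaced by (1 - Δ²)/m, which leaves one multiple of Δ⁻³, integrating
  -- to E/(1 - m), and one of Δ⁻¹, integrating to K.
  · have e2 : ∀ θ : ℝ, -(((r - a * (2 * Real.sin θ ^ 2 - 1)) * nr + (z - c) * nz) /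
        (Rbar a c r z * Real.sqrt (1 - param a c r z * Real.sin θ ^ 2)) ^ 3)
        = -(((r + a) * nr + (z - c) * nz - 2 * a * nr / param a c r z) / Rbar a c r z ^ 3)
            * (1 / Real.sqrt (1 - param a c r z * Real.sin θ ^ 2) ^ 3)
          + -(2 * a * nr / param a c r z / Rbar a c r z ^ 3)
            * (1 / Real.sqrt (1 - param a c r z * Real.sin θ ^ 2)) := fun θ => by
      have hsq := Real.sq_sqrt (one_sub_mul_sin_sq_pos hm θ).le
      have hs0 := (hs θ).ne'
      generalize Real.sqrt (1 - param a c r z * Real.sin θ ^ 2) = D at *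
      generalize param a c r z = m at *
      field_simp
      linear_combination (2 * a * nr) * hsq
    simp only [e2]
    rw [intervalIntegral.integral_add (hI3.const_mul _) (hI1.const_mul _),
      intervalIntegral.integral_const_mul, intervalIntegral.integral_const_mul, hE, hKdef]
    generalize param a c r z = m at *
    generalize ellipticE m = E at *
    generalize ellipticK m = K at *
    generalize Rbar a c r z = R at *
    have hk : a * r = m * R ^ 2 / 4 := by linarith
    field_simp
    linear_combination (4 * (1 - m) * nr * (E - K)) * hk

end azimuthal

/-! ### Joint continuity of the kernels -/

lemma continuous_Rbar : Continuous fun p : ℝ × ℝ × ℝ × ℝ => Rbar p.1 p.2.1 p.2.2.1 p.2.2.2 := by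
  unfold Rbar; fun_prop

lemma continuous_meridianDist :
    Continuous fun p : ℝ × ℝ × ℝ × ℝ => meridianDist p.1 p.2.1 p.2.2.1 p.2.2.2 := by
  unfold meridianDist; fun_prop

/-- Pairs of distinct points `(a, c)`, `(r, z)` of the meridian half-plane. -/
def offDiag : Set (ℝ × ℝ × ℝ × ℝ) := {p | 0 ≤ p.1 ∧ 0 ≤ p.2.2.1 ∧ (p.2.2.1, p.2.2.2) ≠ (p.1, p.2.1)}

lemma continuousOn_param :
    ContinuousOn (fun p : ℝ × ℝ × ℝ × ℝ => param p.1 p.2.1 p.2.2.1 p.2.2.2) offDiag := by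
  unfold param
  refine ContinuousOn.div (by fun_prop) (continuous_Rbar.pow 2).continuousOn fun p hp => ?_
  exact pow_ne_zero 2 (Rbar_pos hp.1 hp.2.1 hp.2.2).ne'

lemma continuousOn_ellipticK_param :
    ContinuousOn (fun p : ℝ × ℝ × ℝ × ℝ => ellipticK (param p.1 p.2.1 p.2.2.1 p.2.2.2)) offDiag :=
  continuousOn_ellipticK.comp continuousOn_param fun _ hp => param_lt_one hp.1 hp.2.1 hp.2.2

lemma continuousOn_kernelS :
    ContinuousOn (fun p : ℝ × ℝ × ℝ × ℝ => kernelS p.1 p.2.1 p.2.2.1 p.2.2.2) offDiag := by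
  unfold kernelS
  refine ContinuousOn.div (ContinuousOn.mul (by fun_prop) continuousOn_ellipticK_param)
    continuous_Rbar.continuousOn fun p hp => ?_
  exact (Rbar_pos hp.1 hp.2.1 hp.2.2).ne'

lemma continuousOn_kernelK :
    ContinuousOn (fun p : ℝ × ℝ × ℝ × ℝ × ℝ =>
        kernelK p.1 p.2.1 p.2.2.1 p.2.2.2.1 p.2.2.2.2)
        {p | 0 ≤ p.1 ∧ 0 ≤ p.2.2.1 ∧ (p.2.2.1, p.2.2.2.1) ≠ (p.1, p.2.1)} := by
  simp only [kernelK_eq]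
  have hq : Continuous fun p : ℝ × ℝ × ℝ × ℝ × ℝ => (p.1, p.2.1, p.2.2.1, p.2.2.2.1) := by
    fun_prop
  have hmaps : MapsTo (fun p : ℝ × ℝ × ℝ × ℝ × ℝ => (p.1, p.2.1, p.2.2.1, p.2.2.2.1))
      {p | 0 ≤ p.1 ∧ 0 ≤ p.2.2.1 ∧ (p.2.2.1, p.2.2.2.1) ≠ (p.1, p.2.1)} offDiag := fun p hp => hp
  have hK := continuousOn_ellipticK_param.comp hq.continuousOn hmaps
  refine ContinuousOn.div (ContinuousOn.mul (by fun_prop) hK)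
    (continuous_const.mul (continuous_Rbar.comp hq)).continuousOn fun p hp => ?_
  exact mul_ne_zero two_ne_zero (Rbar_pos hp.1 hp.2.1 hp.2.2).ne'

lemma continuousOn_kernelE :
    ContinuousOn (fun p : ℝ × ℝ × ℝ × ℝ × ℝ × ℝ =>
        kernelE p.1 p.2.1 p.2.2.1 p.2.2.2.1 p.2.2.2.2.1 p.2.2.2.2.2)
        {p | 0 ≤ p.1 ∧ 0 ≤ p.2.2.1 ∧ (p.2.2.1, p.2.2.2.1) ≠ (p.1, p.2.1)} := by
  have hq : Continuous fun p : ℝ × ℝ × ℝ × ℝ × ℝ × ℝ => (p.1, p.2.1, p.2.2.1, p.2.2.2.1) := by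
    fun_prop
  refine ContinuousOn.congr (f := fun p : ℝ × ℝ × ℝ × ℝ × ℝ × ℝ =>
    p.2.2.1 * ellipticE (param p.1 p.2.1 p.2.2.1 p.2.2.2.1) /
        (meridianDist p.1 p.2.1 p.2.2.1 p.2.2.2.1 ^ 2 * Rbar p.1 p.2.1 p.2.2.1 p.2.2.2.1)
        * ((p.2.2.1 - p.1) * p.2.2.2.2.1 + (p.2.2.2.1 - p.2.1) * p.2.2.2.2.2)
      - ellipticE (param p.1 p.2.1 p.2.2.1 p.2.2.2.1) * p.2.2.2.2.1
        / (2 * Rbar p.1 p.2.1 p.2.2.1 p.2.2.2.1)) ?_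
    fun p hp => kernelE_eq hp.1 hp.2.1 hp.2.2 _ _
  have hmaps : MapsTo (fun p : ℝ × ℝ × ℝ × ℝ × ℝ × ℝ => (p.1, p.2.1, p.2.2.1, p.2.2.2.1))
      {p | 0 ≤ p.1 ∧ 0 ≤ p.2.2.1 ∧ (p.2.2.1, p.2.2.2.1) ≠ (p.1, p.2.1)} offDiag := fun p hp => hp
  have hR := continuous_Rbar.comp hq
  have hd := continuous_meridianDist.comp hq
  have hE := continuous_ellipticE.comp_continuousOn
    (continuousOn_param.comp hq.continuousOn hmaps)
  refine ContinuousOn.sub (ContinuousOn.mul (ContinuousOn.div (ContinuousOn.mul (by fun_prop) hE)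
    ((hd.pow 2).mul hR).continuousOn fun p hp => ?_) (by fun_prop))
    (ContinuousOn.div (hE.mul (by fun_prop)) (continuous_const.mul hR).continuousOn fun p hp => ?_)
  · exact mul_ne_zero (pow_ne_zero 2 (meridianDist_pos hp.2.2).ne')
      (Rbar_pos hp.1 hp.2.1 hp.2.2).ne'
  · exact mul_ne_zero two_ne_zero (Rbar_pos hp.1 hp.2.1 hp.2.2).ne'

/-! ### The meridian section of the domain -/

namespace MeridianArc

variable (γ : MeridianArc)

/-- The arc as a map into the meridian half-plane. -/
def pt (t : ℝ) : ℝ × ℝ := (γ.r t, γ.z t)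

lemma hasDerivAt_r (t : ℝ) : HasDerivAt γ.r (deriv γ.r t) t :=
  (γ.contDiff_r.differentiable (by norm_num) t).hasDerivAt

lemma hasDerivAt_z (t : ℝ) : HasDerivAt γ.z (deriv γ.z t) t :=
  (γ.contDiff_z.differentiable (by norm_num) t).hasDerivAt

lemma contDiff_deriv_r : ContDiff ℝ 1 (deriv γ.r) :=
  ((contDiff_succ_iff_deriv (n := 1)).1 γ.contDiff_r).2.2

lemma contDiff_deriv_z : ContDiff ℝ 1 (deriv γ.z) :=
  ((contDiff_succ_iff_deriv (n := 1)).1 γ.contDiff_z).2.2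

lemma continuous_r : Continuous γ.r := γ.contDiff_r.continuous

lemma continuous_z : Continuous γ.z := γ.contDiff_z.continuous

lemma continuous_deriv_r : Continuous (deriv γ.r) := γ.contDiff_deriv_r.continuous

lemma continuous_deriv_z : Continuous (deriv γ.z) := γ.contDiff_deriv_z.continuous

lemma continuous_pt : Continuous γ.pt := γ.continuous_r.prodMk γ.continuous_z

lemma speed_pos {t : ℝ} (ht : t ∈ Icc (0 : ℝ) 1) : 0 < γ.speed t :=
  Real.sqrt_pos.2 (γ.regular t ht)

lemma speed_sq (t : ℝ) : γ.speed t ^ 2 = deriv γ.r t ^ 2 + deriv γ.z t ^ 2 :=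
  Real.sq_sqrt (by positivity)

lemma continuous_speed : Continuous γ.speed := by
  have h1 := γ.continuous_deriv_r
  have h2 := γ.continuous_deriv_z
  unfold speed
  fun_prop

lemma continuousOn_nr : ContinuousOn γ.nr (Icc 0 1) :=
  γ.continuous_deriv_z.continuousOn.div γ.continuous_speed.continuousOn
    fun _ ht => (γ.speed_pos ht).ne'

lemma continuousOn_nz : ContinuousOn γ.nz (Icc 0 1) :=
  γ.continuous_deriv_r.neg.continuousOn.div γ.continuous_speed.continuousOn
    fun _ ht => (γ.speed_pos ht).ne'

lemma abs_nr_le_one (t : ℝ) : |γ.nr t| ≤ 1 := by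
  rw [nr, abs_div, abs_of_nonneg (show 0 ≤ γ.speed t from Real.sqrt_nonneg _)]
  exact div_le_one_of_le₀ (Real.abs_le_sqrt (by nlinarith [sq_nonneg (deriv γ.r t)]))
    (Real.sqrt_nonneg _)

lemma abs_nz_le_one (t : ℝ) : |γ.nz t| ≤ 1 := by
  rw [nz, abs_div, abs_neg, abs_of_nonneg (show 0 ≤ γ.speed t from Real.sqrt_nonneg _)]
  exact div_le_one_of_le₀ (Real.abs_le_sqrt (by nlinarith [sq_nonneg (deriv γ.z t)]))
    (Real.sqrt_nonneg _)

/-- The map `(t, s) ↦ γ(t) - s w`, with which a neighbourhood of an arc is parametrized. -/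
noncomputable def tube (w : ℝ × ℝ) (q : ℝ × ℝ) : ℝ × ℝ := (γ.r q.1 - q.2 * w.1, γ.z q.1 - q.2 * w.2)

/-- The Jacobian determinant of `tube`. -/
noncomputable def tubeJac (w : ℝ × ℝ) (t : ℝ) : ℝ := deriv γ.z t * w.1 - deriv γ.r t * w.2

/-- The right-hand normal vector `(z', -r')` (not normalized). -/
noncomputable def conormal (t : ℝ) : ℝ × ℝ := (deriv γ.z t, -deriv γ.r t)

lemma continuous_tube (w : ℝ × ℝ) : Continuous (γ.tube w) := by
  have h1 := γ.continuous_r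
  have h2 := γ.continuous_z
  unfold tube
  fun_prop

@[simp] lemma tube_zero (w : ℝ × ℝ) (t : ℝ) : γ.tube w (t, 0) = γ.pt t := by simp [tube, pt]

lemma continuous_tubeJac (w : ℝ × ℝ) : Continuous (γ.tubeJac w) := by
  have h1 := γ.continuous_deriv_r
  have h2 := γ.continuous_deriv_z
  unfold tubeJac
  fun_prop

lemma surf_eq (t θ : ℝ) : γ.surf (t, θ) = cyl (γ.r t) θ (γ.z t) := rfl

lemma normal_eq (t θ : ℝ) : γ.normal (t, θ) = cyl (γ.nr t) θ (γ.nz t) := rfl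

end MeridianArc

namespace AxisymDomain

variable (D : AxisymDomain)

/-- The closed meridian section of the domain. -/
def section' : Set (ℝ × ℝ) := {p | 0 ≤ p.1 ∧ cyl p.1 0 p.2 ∈ closure D.Ω}

/-- The open meridian section of the domain, without the axis. -/
def inner : Set (ℝ × ℝ) := {p | 0 < p.1 ∧ cyl p.1 0 p.2 ∈ D.Ω}

lemma continuous_cyl_zero : Continuous fun p : ℝ × ℝ => cyl p.1 0 p.2 :=
  continuous_cyl.comp (by fun_prop : Continuous fun p : ℝ × ℝ => (p.1, (0 : ℝ), p.2))

lemma isOpen_inner : IsOpen D.inner :=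
  (isOpen_lt continuous_const continuous_fst).inter (D.isOpen.preimage continuous_cyl_zero)

lemma isClosed_section : IsClosed D.section' :=
  (isClosed_le continuous_const continuous_fst).inter
    (isClosed_closure.preimage continuous_cyl_zero)

lemma isCompact_section : IsCompact D.section' := by
  refine Metric.isCompact_of_isClosed_isBounded D.isClosed_section ?_
  obtain ⟨R, hR⟩ := D.bounded.closure.exists_norm_le
  refine isBounded_iff_forall_norm_le.2 ⟨R, fun p hp => ?_⟩
  refine le_trans ?_ (hR _ hp.2)
  rw [norm_cyl, Prod.norm_def]
  refine max_le (Real.abs_le_sqrt ?_) (Real.abs_le_sqrt ?_)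
  · nlinarith [sq_nonneg p.2]
  · nlinarith [sq_nonneg p.1]

lemma inner_subset_section : D.inner ⊆ D.section' :=
  fun _ hp => ⟨hp.1.le, subset_closure hp.2⟩

lemma cyl_mem_frontier_iff {p : ℝ × ℝ} (hp : 0 ≤ p.1) :
    cyl p.1 0 p.2 ∈ frontier D.Ω ↔ ∃ i, ∃ t ∈ Icc (0 : ℝ) 1, (D.arc i).pt t = p := by
  rw [D.frontier_eq]
  constructor
  · rintro ⟨i, t, ht, θ, h⟩
    obtain ⟨h1, h2⟩ := cyl_injOn hp ((D.arc i).r_nonneg t ht) h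
    exact ⟨i, t, ht, Prod.ext h1.symm h2.symm⟩
  · rintro ⟨i, t, ht, rfl⟩
    exact ⟨i, t, ht, 0, rfl⟩

lemma pt_mem_section {i : Fin D.N} {t : ℝ} (ht : t ∈ Icc (0 : ℝ) 1) :
    (D.arc i).pt t ∈ D.section' :=
  ⟨(D.arc i).r_nonneg t ht, frontier_subset_closure
    ((D.cyl_mem_frontier_iff ((D.arc i).r_nonneg t ht)).2 ⟨i, t, ht, rfl⟩)⟩

lemma notMem_of_frontier {x : E3} (hx : x ∈ frontier D.Ω) : x ∉ D.Ω := by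
  rw [frontier, D.isOpen.interior_eq] at hx
  exact hx.2

/-- A connected piece of the meridian half-plane that avoids the meridian curve and meets the
domain lies in it. -/
lemma mem_of_isPreconnected {s : Set (ℝ × ℝ)} (hs : IsPreconnected s) (hs0 : ∀ p ∈ s, 0 ≤ p.1)
    (hcurve : ∀ p ∈ s, ∀ i, ∀ t ∈ Icc (0 : ℝ) 1, (D.arc i).pt t ≠ p)
    {p : ℝ × ℝ} (hp : p ∈ s) (hpΩ : cyl p.1 0 p.2 ∈ closure D.Ω) :
    ∀ q ∈ s, cyl q.1 0 q.2 ∈ D.Ω := by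
  have hfr : ∀ q ∈ s, cyl q.1 0 q.2 ∉ frontier D.Ω := fun q hq h => by
    obtain ⟨i, t, ht, h⟩ := (D.cyl_mem_frontier_iff (hs0 q hq)).1 h
    exact hcurve q hq i t ht h
  have hmem : ∀ q ∈ s, cyl q.1 0 q.2 ∈ closure D.Ω → cyl q.1 0 q.2 ∈ D.Ω := fun q hq h => by
    by_contra hn
    refine hfr q hq ?_
    rw [frontier, D.isOpen.interior_eq]
    exact ⟨h, hn⟩
  have himg := hs.image _ continuous_cyl_zero.continuousOn
  have hne : (((fun p : ℝ × ℝ => cyl p.1 0 p.2) '' s) ∩ D.Ω).Nonempty :=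
    ⟨_, ⟨p, hp, rfl⟩, hmem p hp hpΩ⟩
  have := himg.subset_left_of_subset_union D.isOpen isClosed_closure.isOpen_compl
    (disjoint_compl_right.mono_left subset_closure) ?_ hne
  · exact fun q hq => this ⟨q, hq, rfl⟩
  · rintro _ ⟨q, hq, rfl⟩
    by_cases h : cyl q.1 0 q.2 ∈ closure D.Ω
    · exact Or.inl (hmem q hq h)
    · exact Or.inr h

variable {D}

lemma IsNode.mem_Icc {i : Fin D.N} {t : ℝ} (h : D.IsNode i t) : t ∈ Icc (0 : ℝ) 1 :=
  h.elim (fun h => Ioo_subset_Icc_self h) fun h => h.1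

lemma IsNode.unique {i : Fin D.N} {t : ℝ} (h : D.IsNode i t) {j : Fin D.N} {s : ℝ}
    (hs : s ∈ Icc (0 : ℝ) 1) (he : (D.arc j).pt s = (D.arc i).pt t) : j = i ∧ s = t := by
  have h1 : (D.arc j).r s = (D.arc i).r t := congrArg Prod.fst he
  have h2 : (D.arc j).z s = (D.arc i).z t := congrArg Prod.snd he
  rcases h with h | ⟨_, h0, _, hu⟩
  · obtain ⟨ha, hb⟩ := D.simple i j t h s hs h1.symm h2.symm
    exact ⟨ha.symm, hb.symm⟩
  · exact hu j s hs (h1.trans h0) h2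

set_option maxHeartbeats 1000000 in
/-- Tubular coordinates near a node: `(t, s) ↦ γ(t) - s w` with `w = (z'(t₀), -r'(t₀))` are
injective near `(t₀, 0)`, cover a neighbourhood of the node in the closed half-plane, and meet the
meridian curve only where `s = 0`. -/
theorem IsNode.exists_tube {i : Fin D.N} {t₀ : ℝ} (hn : D.IsNode i t₀) {η : ℝ} (hη : 0 < η) :
    ∃ δ > 0, ∃ h > 0, ∃ ρ > 0, ∃ C > 0,
      (t₀ ∈ Ioo (0 : ℝ) 1 → Icc (t₀ - δ) (t₀ + δ) ⊆ Ioo 0 1) ∧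
      (∀ t ∈ Icc (t₀ - δ) (t₀ + δ), 0 < (D.arc i).tubeJac ((D.arc i).conormal t₀) t) ∧
      InjOn ((D.arc i).tube ((D.arc i).conormal t₀)) (Icc (t₀ - δ) (t₀ + δ) ×ˢ univ) ∧
      (∀ t ∈ Icc (t₀ - δ) (t₀ + δ) ∩ Icc 0 1, ∀ s, |s| ≤ h →
        0 ≤ ((D.arc i).tube ((D.arc i).conormal t₀) (t, s)).1 ∧
        (t₀ ∈ Ioo (0 : ℝ) 1 → 0 < ((D.arc i).tube ((D.arc i).conormal t₀) (t, s)).1) ∧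
        dist ((D.arc i).tube ((D.arc i).conormal t₀) (t, s)) ((D.arc i).pt t₀) < η ∧
        (s ≠ 0 → ∀ j, ∀ t' ∈ Icc (0 : ℝ) 1,
          (D.arc j).pt t' ≠ (D.arc i).tube ((D.arc i).conormal t₀) (t, s))) ∧
      (∀ p : ℝ × ℝ, 0 ≤ p.1 → dist p ((D.arc i).pt t₀) < ρ →
        ∃ t ∈ Ioo (t₀ - δ) (t₀ + δ) ∩ Icc 0 1, ∃ s, |s| < h ∧
          (D.arc i).tube ((D.arc i).conormal t₀) (t, s) = p ∧
          |t - t₀| ≤ C * dist p ((D.arc i).pt t₀) ∧ |s| ≤ C * dist p ((D.arc i).pt t₀)) := by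
  set γ := D.arc i with hγ
  set w := γ.conormal t₀ with hw
  have ht₀ := hn.mem_Icc
  have hreg := γ.regular t₀ ht₀
  have hW : 0 < w.1 ^ 2 + w.2 ^ 2 := by
    simp only [hw, MeridianArc.conormal]; linarith [neg_sq (deriv γ.r t₀)]
  have hJ₀ : 0 < γ.tubeJac w t₀ := by
    simp only [hw, MeridianArc.conormal, MeridianArc.tubeJac]; linarith
  set c := γ.tubeJac w t₀ / 2 with hc
  have hc0 : 0 < c := half_pos hJ₀
  -- `u` is the coordinate orthogonal to `w`, so on the tube it depends on `t` alone. Its derivative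
  -- is the Jacobian, which equals |w|² at `t₀`; hence `u` is increasing nearby with slope at least
  -- `c`, and this gives both injectivity and, by the intermediate value theorem, covering.
  set u : ℝ → ℝ := fun t => w.1 * γ.z t - w.2 * γ.r t with hu
  have hud : ∀ t, HasDerivAt u (γ.tubeJac w t) t := fun t =>
    (((γ.hasDerivAt_z t).const_mul w.1).sub ((γ.hasDerivAt_r t).const_mul w.2)).congr_deriv
      (by simp only [MeridianArc.tubeJac]; ring)
  have hutube : ∀ t s, w.1 * (γ.tube w (t, s)).2 - w.2 * (γ.tube w (t, s)).1 = u t := fun t s => by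
    simp only [MeridianArc.tube, hu]; ring
  obtain ⟨δ₀, hδ₀, hJ⟩ : ∃ δ₀ > 0, ∀ t ∈ Icc (t₀ - δ₀) (t₀ + δ₀), c < γ.tubeJac w t := by
    have := (γ.continuous_tubeJac w).continuousAt.eventually (lt_mem_nhds (half_lt_self hJ₀))
    obtain ⟨δ, hδ, h⟩ := Metric.nhds_basis_closedBall.eventually_iff.1 this
    exact ⟨δ, hδ, fun t ht => h (by rwa [Real.closedBall_eq_Icc])⟩
  have hmono : ∀ s ∈ Icc (t₀ - δ₀) (t₀ + δ₀), ∀ t ∈ Icc (t₀ - δ₀) (t₀ + δ₀), s ≤ t →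
      c * (t - s) ≤ u t - u s := fun s hs t ht hst =>
    (convex_Icc _ _).mul_sub_le_image_sub_of_le_deriv
      (fun x _ => (hud x).continuousAt.continuousWithinAt)
      (fun x _ => (hud x).differentiableAt.differentiableWithinAt)
      (fun x hx => by rw [(hud x).deriv]; exact (hJ x (interior_subset hx)).le) s hs t ht hst
  have hinj : InjOn (γ.tube w) (Icc (t₀ - δ₀) (t₀ + δ₀) ×ˢ univ) := by
    rintro ⟨t, s⟩ ht ⟨t', s'⟩ ht' he
    have h1 : u t = u t' := by rw [← hutube t s, ← hutube t' s', he]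
    have h2 : t = t' := by
      rcases le_total t t' with h | h
      · have := nonpos_of_mul_nonpos_right (show c * (t' - t) ≤ 0 by linarith [hmono t ht.1 t' ht'.1 h]) hc0
        linarith
      · have := nonpos_of_mul_nonpos_right (show c * (t - t') ≤ 0 by linarith [hmono t' ht'.1 t ht.1 h]) hc0
        linarith
    subst h2
    have e1 : γ.r t - s * w.1 = γ.r t - s' * w.1 := congrArg Prod.fst he
    have e2 : γ.z t - s * w.2 = γ.z t - s' * w.2 := congrArg Prod.snd he
    have : (s - s') * (w.1 ^ 2 + w.2 ^ 2) = 0 := by linear_combination (-w.1) * e1 - w.2 * e2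
    have := (mul_eq_zero.1 this).resolve_right hW.ne'
    rw [sub_eq_zero.1 this]
  -- The rest of the curve is a finite union of compact pieces that misses the node, so it keeps a
  -- positive distance from it.
  obtain ⟨ρ₀, hρ₀, hfar⟩ : ∃ ρ₀ > 0, ∀ j, ∀ t' ∈ Icc (0 : ℝ) 1,
      dist ((D.arc j).pt t') (γ.pt t₀) < ρ₀ → j = i ∧ t' ∈ Icc (t₀ - δ₀) (t₀ + δ₀) := by
    set K : Set (ℝ × ℝ) := ⋃ j, (D.arc j).pt ''
      (Icc (0 : ℝ) 1 ∩ {t' | j = i → t' ∉ Ioo (t₀ - δ₀) (t₀ + δ₀)}) with hK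
    have hKc : IsClosed K := by
      refine isClosed_iUnion_of_finite fun j => ?_
      refine ((isCompact_Icc.inter_right ?_).image (D.arc j).continuous_pt).isClosed
      by_cases hj : j = i
      · have := (isOpen_Ioo (a := t₀ - δ₀) (b := t₀ + δ₀)).isClosed_compl
        rw [compl_def] at this
        simpa only [hj, true_imp_iff] using this
      · simp [hj]
    have hKn : γ.pt t₀ ∈ Kᶜ := by
      rw [mem_compl_iff, hK, mem_iUnion]
      rintro ⟨j, t', ⟨ht', h⟩, he⟩
      obtain ⟨rfl, rfl⟩ := hn.unique ht' he
      exact h rfl ⟨by linarith, by linarith⟩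
    obtain ⟨ρ, hρ, hball⟩ := Metric.isOpen_iff.1 hKc.isOpen_compl _ hKn
    refine ⟨ρ, hρ, fun j t' ht' hd => ?_⟩
    by_contra hcon
    refine hball (Metric.mem_ball.2 hd) (mem_iUnion.2 ⟨j, t', ⟨ht', fun hj ht => ?_⟩, rfl⟩)
    exact hcon ⟨hj, Ioo_subset_Icc_self ht⟩
  obtain ⟨L, hL0, hL⟩ : ∃ L > 0, ∀ᶠ t in 𝓝 t₀, |γ.r t - γ.r t₀| ≤ L * |t - t₀| ∧
      |γ.z t - γ.z t₀| ≤ L * |t - t₀| := by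
    obtain ⟨L₁, h₁, hb₁⟩ := (γ.hasDerivAt_r t₀).differentiableAt.isBigO_sub.exists_pos
    obtain ⟨L₂, h₂, hb₂⟩ := (γ.hasDerivAt_z t₀).differentiableAt.isBigO_sub.exists_pos
    refine ⟨max L₁ L₂, lt_max_of_lt_left h₁, ?_⟩
    filter_upwards [hb₁.bound, hb₂.bound] with t k₁ k₂
    exact ⟨k₁.trans (mul_le_mul_of_nonneg_right (le_max_left _ _) (norm_nonneg _)),
      k₂.trans (mul_le_mul_of_nonneg_right (le_max_right _ _) (norm_nonneg _))⟩
  obtain ⟨δ, hδ, hE⟩ : ∃ δ > 0, ∀ q ∈ Metric.closedBall (t₀, (0 : ℝ)) δ,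
      dist (γ.tube w q) (γ.pt t₀) < min η ρ₀ ∧ (t₀ ∈ Ioo (0 : ℝ) 1 → 0 < (γ.tube w q).1) ∧
      (t₀ ∈ Ioo (0 : ℝ) 1 → q.1 ∈ Ioo (0 : ℝ) 1) ∧ q.1 ∈ Icc (t₀ - δ₀) (t₀ + δ₀) ∧
      |q.1 - t₀| < 1 ∧
      (|γ.r q.1 - γ.r t₀| ≤ L * |q.1 - t₀| ∧ |γ.z q.1 - γ.z t₀| ≤ L * |q.1 - t₀|) := by
    have hfst : Tendsto (Prod.fst : ℝ × ℝ → ℝ) (𝓝 (t₀, 0)) (𝓝 t₀) := continuous_fst.tendsto _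
    have htube := (γ.continuous_tube w).tendsto (t₀, 0)
    have e1 := htube.eventually (Metric.ball_mem_nhds _ (lt_min hη hρ₀))
    have e2 : ∀ᶠ q in 𝓝 (t₀, (0 : ℝ)), t₀ ∈ Ioo (0 : ℝ) 1 → 0 < (γ.tube w q).1 := by
      by_cases h : t₀ ∈ Ioo (0 : ℝ) 1
      · have := ((continuous_fst.comp (γ.continuous_tube w)).tendsto (t₀, 0)).eventually
          (lt_mem_nhds (show 0 < (γ.tube w (t₀, 0)).1 by
            rw [γ.tube_zero]; exact γ.r_pos t₀ h))
        filter_upwards [this] with q hq _ using hq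
      · exact Eventually.of_forall fun q hq => absurd hq h
    have e3 : ∀ᶠ q in 𝓝 (t₀, (0 : ℝ)), t₀ ∈ Ioo (0 : ℝ) 1 → q.1 ∈ Ioo (0 : ℝ) 1 := by
      by_cases h : t₀ ∈ Ioo (0 : ℝ) 1
      · filter_upwards [hfst.eventually (Ioo_mem_nhds h.1 h.2)] with q hq _ using hq
      · exact Eventually.of_forall fun q hq => absurd hq h
    have e4 := hfst.eventually (Icc_mem_nhds (show t₀ - δ₀ < t₀ by linarith)
      (show t₀ < t₀ + δ₀ by linarith))
    have e5 := hfst.eventually (Metric.ball_mem_nhds t₀ one_pos)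
    have := (e1.and (e2.and (e3.and (e4.and (e5.and (hfst.eventually hL))))))
    rw [γ.tube_zero] at this
    obtain ⟨δ, hδ, h⟩ := Metric.nhds_basis_closedBall.eventually_iff.1 this
    exact ⟨δ, hδ, fun q hq => h hq⟩
  have hmem : ∀ t ∈ Icc (t₀ - δ) (t₀ + δ), ∀ s, |s| ≤ δ →
      (t, s) ∈ Metric.closedBall (t₀, (0 : ℝ)) δ := fun t ht s hs => by
    rw [Metric.mem_closedBall, Prod.dist_eq]
    refine max_le ?_ ?_
    · rw [Real.dist_eq, abs_le]; constructor <;> linarith [ht.1, ht.2]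
    · simpa [Real.dist_eq] using hs
  have hsub : Icc (t₀ - δ) (t₀ + δ) ⊆ Icc (t₀ - δ₀) (t₀ + δ₀) := fun t ht =>
    (hE _ (hmem t ht 0 (by simpa using hδ.le))).2.2.2.1
  set A := |w.1| + |w.2| with hA
  have hA0 : 0 < A := by
    by_contra h
    have h1 := abs_nonneg w.1
    have h2 := abs_nonneg w.2
    have h3 : w.1 = 0 := abs_eq_zero.1 (by linarith)
    have h4 : w.2 = 0 := abs_eq_zero.1 (by linarith)
    simp [h3, h4] at hW
  -- `C₁` controls the displacement in `t` through the slope `c` of `u`; `C₂` then controls `s`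
  -- through the Lipschitz bound `L` for the arc at `t₀`. The radius δ/(C₁ + C₂) makes both
  -- displacements smaller than δ.
  set C₁ := A / c with hC₁
  set C₂ := A * (L * C₁ + 1) / (w.1 ^ 2 + w.2 ^ 2) with hC₂
  have hC₁0 : 0 < C₁ := by positivity
  have hC₂0 : 0 < C₂ := by positivity
  have hC : 0 < C₁ + C₂ := by positivity
  refine ⟨δ, hδ, δ, hδ, δ / (C₁ + C₂), by positivity, C₁ + C₂, hC,
    fun h t ht => (hE _ (hmem t ht 0 (by simpa using hδ.le))).2.2.1 h,
    fun t ht => hc0.trans (hJ t (hsub ht)), hinj.mono (prod_mono hsub subset_rfl), ?_, ?_⟩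
  · rintro t ⟨ht, ht01⟩ s hs
    obtain ⟨h1, h2, -⟩ := hE _ (hmem t ht s hs)
    refine ⟨?_, h2, h1.trans_le (min_le_left _ _), fun hs0 j t' ht' he => ?_⟩
    -- At an end point on the axis z'(t₀) = 0, so `w` is axial and moving along it does not change
    -- `r`.
    · rcases hn with h | ⟨_, _, hz, _⟩
      · exact (h2 h).le
      · have : w.1 = 0 := hz
        simpa [MeridianArc.tube, this] using γ.r_nonneg t ht01
    · obtain ⟨rfl, ht''⟩ := hfar j t' ht' (by rw [he]; exact h1.trans_le (min_le_right _ _))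
      rw [← γ.tube_zero w] at he
      have := hinj ⟨ht'', mem_univ _⟩ ⟨hsub ht, mem_univ _⟩ he
      exact hs0 (congrArg Prod.snd this).symm
  · intro p hp hd
    set d := dist p (γ.pt t₀) with hddef
    have hdr : |p.1 - γ.r t₀| ≤ d := by
      rw [hddef, Prod.dist_eq]; exact le_max_left _ _
    have hdz : |p.2 - γ.z t₀| ≤ d := by
      rw [hddef, Prod.dist_eq]; exact le_max_right _ _
    rw [lt_div_iff₀ hC] at hd
    have hd0 : 0 ≤ d := dist_nonneg
    have hℓ : |w.1 * p.2 - w.2 * p.1 - u t₀| ≤ A * d := by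
      calc _ = |w.1 * (p.2 - γ.z t₀) - w.2 * (p.1 - γ.r t₀)| := by
            congr 1; simp only [hu]; ring
        _ ≤ |w.1 * (p.2 - γ.z t₀)| + |w.2 * (p.1 - γ.r t₀)| := norm_sub_le (_ : ℝ) _
        _ ≤ |w.1| * d + |w.2| * d := by rw [abs_mul, abs_mul]; gcongr
        _ = _ := by rw [hA]; ring
    have hAd : A * d ≤ c * δ := by
      have : A = C₁ * c := by rw [hC₁]; field_simp
      rw [this]
      have : C₁ * d ≤ δ := by linarith [mul_nonneg hC₂0.le hd0]
      calc C₁ * c * d = c * (C₁ * d) := by ring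
        _ ≤ c * δ := by gcongr
    obtain ⟨hℓ1, hℓ2⟩ := abs_le.1 hℓ
    have hI : ∀ t, |t - t₀| ≤ δ → t ∈ Icc (t₀ - δ₀) (t₀ + δ₀) := fun t ht => by
      rw [abs_le] at ht
      exact hsub ⟨by linarith, by linarith⟩
    have ht₀I : t₀ ∈ Icc (t₀ - δ₀) (t₀ + δ₀) := hI _ (by simpa using hδ.le)
    have hδ1 : δ < 1 := by
      have := (hE _ (hmem (t₀ + δ) ⟨by linarith, le_rfl⟩ 0 (by simpa using hδ.le))).2.2.2.2.1
      simpa [abs_of_pos hδ] using this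
    have hend : t₀ ∉ Ioo (0 : ℝ) 1 → (t₀ = 0 ∨ t₀ = 1) ∧ γ.r t₀ = 0 ∧ w.1 = 0 := fun h => by
      refine ⟨?_, (hn.resolve_left h).2.1, (hn.resolve_left h).2.2.1⟩
      by_contra hcon
      rw [not_or] at hcon
      exact h ⟨lt_of_le_of_ne ht₀.1 (Ne.symm hcon.1), lt_of_le_of_ne ht₀.2 hcon.2⟩
    -- The value of the `u`-coordinate at `p` must be bracketed by parameters inside [0, 1]. If t₀ -
    -- δ falls outside, the node is the end point `t₀ = 0` on the axis, where `u = -w₂ r` vanishes;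
    -- r ≥ 0 on the arc forces w₂ < 0, and p.1 ≥ 0 then shows that `t₀` itself serves.
    obtain ⟨α, hα1, hα2, hα0, hα⟩ : ∃ α, t₀ - δ ≤ α ∧ α ≤ t₀ ∧ 0 ≤ α ∧
        u α ≤ w.1 * p.2 - w.2 * p.1 := by
      rcases le_or_gt 0 (t₀ - δ) with h | h
      · refine ⟨t₀ - δ, le_rfl, by linarith, h, ?_⟩
        have := hmono _ (hI (t₀ - δ) (by simp [abs_of_pos hδ])) _ ht₀I (by linarith)
        rw [sub_sub_cancel] at this
        linarith
      · have hni : t₀ ∉ Ioo (0 : ℝ) 1 := fun hin => by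
          have := (hE _ (hmem (t₀ - δ) ⟨le_rfl, by linarith⟩ 0 (by simpa using hδ.le))).2.2.1 hin
          exact absurd this.1 (by simpa using h.le)
        obtain ⟨h01, hr0, hw1⟩ := hend hni
        have h0 : t₀ = 0 := h01.resolve_right fun h1 => by linarith
        refine ⟨t₀, by linarith, le_rfl, ht₀.1, ?_⟩
        have h3 := hmono _ ht₀I _ (hI (t₀ + δ) (by simp [abs_of_pos hδ])) (by linarith)
        have h4 := γ.r_nonneg (t₀ + δ) ⟨by linarith, by linarith⟩
        simp only [hu, hw1, hr0, zero_mul, mul_zero, zero_sub, add_sub_cancel_left] at h3 ⊢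
        have h5 : 0 < c * δ := mul_pos hc0 hδ
        have h6 : w.2 < 0 := by
          by_contra h6
          have := mul_nonneg (not_lt.1 h6) h4
          linarith
        have := mul_nonneg (neg_nonneg.2 h6.le) hp
        linarith
    obtain ⟨β, hβ1, hβ2, hβ0, hβ⟩ : ∃ β, β ≤ t₀ + δ ∧ t₀ ≤ β ∧ β ≤ 1 ∧
        w.1 * p.2 - w.2 * p.1 ≤ u β := by
      rcases le_or_gt (t₀ + δ) 1 with h | h
      · refine ⟨t₀ + δ, le_rfl, by linarith, h, ?_⟩
        have := hmono _ ht₀I _ (hI (t₀ + δ) (by simp [abs_of_pos hδ])) (by linarith)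
        rw [add_sub_cancel_left] at this
        linarith
      · have hni : t₀ ∉ Ioo (0 : ℝ) 1 := fun hin => by
          have := (hE _ (hmem (t₀ + δ) ⟨by linarith, le_rfl⟩ 0 (by simpa using hδ.le))).2.2.1 hin
          exact absurd this.2 (by simpa using h.le)
        obtain ⟨h01, hr0, hw1⟩ := hend hni
        have h0 : t₀ = 1 := h01.resolve_left fun h1 => by linarith
        refine ⟨t₀, by linarith, le_rfl, ht₀.2, ?_⟩
        have h3 := hmono _ (hI (t₀ - δ) (by simp [abs_of_pos hδ])) _ ht₀I (by linarith)
        have h4 := γ.r_nonneg (t₀ - δ) ⟨by linarith, by linarith⟩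
        simp only [hu, hw1, hr0, zero_mul, mul_zero, zero_sub, sub_sub_cancel] at h3 ⊢
        have h5 : 0 < c * δ := mul_pos hc0 hδ
        have h6 : 0 < w.2 := by
          by_contra h6
          have := mul_nonneg (neg_nonneg.2 (not_lt.1 h6)) h4
          linarith
        have := mul_nonneg h6.le hp
        linarith
    obtain ⟨t, ⟨htα, htβ⟩, htu⟩ := intermediate_value_Icc (hα2.trans hβ2)
      (fun x _ => (hud x).continuousAt.continuousWithinAt) ⟨hα, hβ⟩
    have htI : t ∈ Icc (t₀ - δ) (t₀ + δ) := ⟨hα1.trans htα, htβ.trans hβ1⟩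
    have htd : |t - t₀| ≤ C₁ * d := by
      have hu2 : c * |t - t₀| ≤ |u t - u t₀| := by
        rcases le_total t t₀ with h | h
        · have := hmono t (hsub htI) t₀ ht₀I h
          rw [abs_of_nonpos (by linarith), abs_sub_comm]
          exact le_trans (by linarith) (le_abs_self _)
        · have := hmono t₀ ht₀I t (hsub htI) h
          rw [abs_of_nonneg (by linarith)]
          exact this.trans (le_abs_self _)
      rw [htu] at hu2
      rw [hC₁, div_mul_eq_mul_div, le_div_iff₀ hc0]
      linarith
    have htδ : |t - t₀| < δ := by linarith [mul_nonneg hC₂0.le hd0, htd]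
    obtain ⟨hLr, hLz⟩ := (hE _ (hmem t htI 0 (by simpa using hδ.le))).2.2.2.2.2
    simp only at hLr hLz
    have hr : |γ.r t - p.1| ≤ (L * C₁ + 1) * d := by
      calc _ = |(γ.r t - γ.r t₀) - (p.1 - γ.r t₀)| := by congr 1; ring
        _ ≤ |γ.r t - γ.r t₀| + |p.1 - γ.r t₀| := norm_sub_le (_ : ℝ) _
        _ ≤ L * (C₁ * d) + d := by gcongr; exact hLr.trans (by gcongr)
        _ = _ := by ring
    have hz : |γ.z t - p.2| ≤ (L * C₁ + 1) * d := by
      calc _ = |(γ.z t - γ.z t₀) - (p.2 - γ.z t₀)| := by congr 1; ring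
        _ ≤ |γ.z t - γ.z t₀| + |p.2 - γ.z t₀| := norm_sub_le (_ : ℝ) _
        _ ≤ L * (C₁ * d) + d := by gcongr; exact hLz.trans (by gcongr)
        _ = _ := by ring
    set s := (w.1 * (γ.r t - p.1) + w.2 * (γ.z t - p.2)) / (w.1 ^ 2 + w.2 ^ 2) with hs
    have hsd : |s| ≤ C₂ * d := by
      rw [hs, abs_div, abs_of_pos hW, hC₂, div_mul_eq_mul_div]
      refine div_le_div_of_nonneg_right ?_ hW.le
      calc _ ≤ |w.1 * (γ.r t - p.1)| + |w.2 * (γ.z t - p.2)| := norm_add_le (_ : ℝ) _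
        _ ≤ |w.1| * ((L * C₁ + 1) * d) + |w.2| * ((L * C₁ + 1) * d) := by
            rw [abs_mul, abs_mul]; gcongr
        _ = _ := by rw [hA]; ring
    refine ⟨t, ⟨?_, hα0.trans htα, htβ.trans hβ0⟩, s, ?_, ?_, ?_, ?_⟩
    · rw [abs_lt] at htδ
      exact ⟨by linarith, by linarith⟩
    · linarith [mul_nonneg hC₁0.le hd0]
    · have h0 : w.1 * (γ.z t - p.2) = w.2 * (γ.r t - p.1) := by
        simp only [hu] at htu; linarith
      refine Prod.ext ?_ ?_
      · simp only [MeridianArc.tube]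
        have : s * w.1 = γ.r t - p.1 := by
          rw [hs, div_mul_eq_mul_div, div_eq_iff hW.ne']
          linear_combination w.2 * h0
        linarith
      · simp only [MeridianArc.tube]
        have : s * w.2 = γ.z t - p.2 := by
          rw [hs, div_mul_eq_mul_div, div_eq_iff hW.ne']
          linear_combination (-w.1) * h0
        linarith
    · linarith [mul_nonneg hC₂0.le hd0]
    · linarith [mul_nonneg hC₁0.le hd0]

end AxisymDomain
/-! ### The divergence theorem in a meridian section -/

/-- The flux identity on a rectangle for a field whose normal component vanishes on all sides but
the lower one. -/
lemma integral_div_rectangle {f g : ℝ × ℝ → ℝ} {f' g' : ℝ × ℝ → ℝ × ℝ →L[ℝ] ℝ} {φ : ℝ × ℝ → ℝ}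
    {a₁ b₁ a₂ b₂ : ℝ} (h₁ : a₁ ≤ b₁) (h₂ : a₂ ≤ b₂)
    (hf : ContinuousOn f (Icc a₁ b₁ ×ˢ Icc a₂ b₂)) (hg : ContinuousOn g (Icc a₁ b₁ ×ˢ Icc a₂ b₂))
    (hφ : ContinuousOn φ (Icc a₁ b₁ ×ˢ Icc a₂ b₂))
    (hf' : ∀ x ∈ Ioo a₁ b₁ ×ˢ Ioo a₂ b₂, HasFDerivAt f (f' x) x)
    (hg' : ∀ x ∈ Ioo a₁ b₁ ×ˢ Ioo a₂ b₂, HasFDerivAt g (g' x) x)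
    (hdiv : ∀ x ∈ Ioo a₁ b₁ ×ˢ Ioo a₂ b₂, f' x (1, 0) + g' x (0, 1) = φ x)
    (hleft : ∀ y ∈ Icc a₂ b₂, f (a₁, y) = 0) (hright : ∀ y ∈ Icc a₂ b₂, f (b₁, y) = 0)
    (htop : ∀ x ∈ Icc a₁ b₁, g (x, b₂) = 0) :
    ∫ x in Ioo a₁ b₁ ×ˢ Ioo a₂ b₂, φ x = -∫ x in a₁..b₁, g (x, a₂) := by
  have hae : (Ioo a₁ b₁ ×ˢ Ioo a₂ b₂ : Set (ℝ × ℝ)) =ᵐ[volume] Icc a₁ b₁ ×ˢ Icc a₂ b₂ :=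
    Measure.set_prod_ae_eq Ioo_ae_eq_Icc Ioo_ae_eq_Icc
  have hmeas : MeasurableSet (Ioo a₁ b₁ ×ˢ Ioo a₂ b₂) := measurableSet_Ioo.prod measurableSet_Ioo
  have hint : IntegrableOn φ (Icc a₁ b₁ ×ˢ Icc a₂ b₂) :=
    hφ.integrableOn_compact (isCompact_Icc.prod isCompact_Icc)
  -- On the sides of the rectangle `f'` and `g'` carry no information; there the integrand is
  -- replaced by the continuous `φ`, which agrees with it almost everywhere.
  have hint' : IntegrableOn (fun x => f' x (1, 0) + g' x (0, 1)) (Icc a₁ b₁ ×ˢ Icc a₂ b₂) := by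
    rw [← integrableOn_congr_set_ae hae] at hint ⊢
    exact hint.congr_fun (fun x hx => (hdiv x hx).symm) hmeas
  have key := integral_divergence_prod_Icc_of_hasFDerivAt_of_le f g f' g' (a₁, a₂) (b₁, b₂)
    ⟨h₁, h₂⟩ (by rwa [← Icc_prod_Icc]) (by rwa [← Icc_prod_Icc]) hf' hg' (by rwa [← Icc_prod_Icc])
  rw [← Icc_prod_Icc, ← setIntegral_congr_set hae, setIntegral_congr_fun hmeas hdiv] at key
  rw [key]
  have e1 : ∫ x in a₁..b₁, g (x, b₂) = 0 := by
    refine (intervalIntegral.integral_congr (g := fun _ => 0) fun x hx => ?_).trans (by simp)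
    rw [uIcc_of_le h₁] at hx
    exact htop x hx
  have e2 : ∫ y in a₂..b₂, f (b₁, y) = 0 := by
    refine (intervalIntegral.integral_congr (g := fun _ => 0) fun x hx => ?_).trans (by simp)
    rw [uIcc_of_le h₂] at hx
    exact hright x hx
  have e3 : ∫ y in a₂..b₂, f (a₁, y) = 0 := by
    refine (intervalIntegral.integral_congr (g := fun _ => 0) fun x hx => ?_).trans (by simp)
    rw [uIcc_of_le h₂] at hx
    exact hleft x hx
  simp only [e1, e2, e3]
  ring

/-- A product with a factor that vanishes near a point does not see a singularity there. -/
lemma continuousOn_mul_of_eventuallyEq_zero {X : Type*} [TopologicalSpace X] [T1Space X]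
    {S : Set X} {p₀ : X} {k F : X → ℝ} (hk : Continuous k) (hk0 : k =ᶠ[𝓝 p₀] 0)
    (hF : ContinuousOn F (S \ {p₀})) : ContinuousOn (fun p => k p * F p) S := by
  intro p hp
  by_cases h : p = p₀
  · subst h
    refine ContinuousAt.continuousWithinAt (continuousAt_const.congr (f := fun _ => (0 : ℝ)) ?_)
    filter_upwards [hk0] with q hq
    simp [hq]
  · refine hk.continuousWithinAt.mul ((hF p ⟨hp, h⟩).mono_of_mem_nhdsWithin ?_)
    exact inter_mem_nhdsWithin S (isOpen_compl_singleton.mem_nhds h)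

namespace MeridianArc

variable (γ : MeridianArc)

/-- The flux density `V · n |γ'|` of a plane field through an arc. -/
noncomputable def flux (V₁ V₂ : ℝ × ℝ → ℝ) (t : ℝ) : ℝ :=
  V₁ (γ.pt t) * deriv γ.z t - V₂ (γ.pt t) * deriv γ.r t

/-- The derivative of `tube`. -/
noncomputable def tubeDeriv (w q : ℝ × ℝ) : ℝ × ℝ →L[ℝ] ℝ × ℝ :=
  (Matrix.toLin (.finTwoProd ℝ) (.finTwoProd ℝ)
    !![deriv γ.r q.1, -w.1; deriv γ.z q.1, -w.2]).toContinuousLinearMap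

lemma tubeDeriv_apply (w q v : ℝ × ℝ) : γ.tubeDeriv w q v =
    (deriv γ.r q.1 * v.1 - w.1 * v.2, deriv γ.z q.1 * v.1 - w.2 * v.2) := by
  simp only [tubeDeriv, LinearMap.coe_toContinuousLinearMap', Matrix.toLin_finTwoProd_apply]
  ext <;> simp <;> ring

lemma det_tubeDeriv (w q : ℝ × ℝ) : (γ.tubeDeriv w q).det = γ.tubeJac w q.1 := by
  simp only [tubeDeriv, LinearMap.det_toContinuousLinearMap, LinearMap.det_toLin,
    Matrix.det_fin_two_of, tubeJac]
  ring

lemma hasFDerivAt_tube (w q : ℝ × ℝ) : HasFDerivAt (γ.tube w) (γ.tubeDeriv w q) q := by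
  have h1 : HasFDerivAt (fun q : ℝ × ℝ => γ.r q.1 - q.2 * w.1)
      (deriv γ.r q.1 • ContinuousLinearMap.fst ℝ ℝ ℝ - w.1 • ContinuousLinearMap.snd ℝ ℝ ℝ) q :=
    ((γ.hasDerivAt_r q.1).comp_hasFDerivAt q hasFDerivAt_fst).sub (hasFDerivAt_snd.mul_const w.1)
  have h2 : HasFDerivAt (fun q : ℝ × ℝ => γ.z q.1 - q.2 * w.2)
      (deriv γ.z q.1 • ContinuousLinearMap.fst ℝ ℝ ℝ - w.2 • ContinuousLinearMap.snd ℝ ℝ ℝ) q :=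
    ((γ.hasDerivAt_z q.1).comp_hasFDerivAt q hasFDerivAt_fst).sub (hasFDerivAt_snd.mul_const w.2)
  refine (h1.prodMk h2).congr_fderiv ?_
  ext <;> simp [tubeDeriv_apply]

end MeridianArc

namespace AxisymDomain

variable (D : AxisymDomain)

/-- A solenoidal plane field in the meridian section, continuous up to the boundary apart from one
boundary point, with no flux through the axis and integrable flux through the boundary. -/
structure IsSolenoidal (V₁ V₂ : ℝ × ℝ → ℝ) (p₀ : ℝ × ℝ) : Prop where
  node : ∃ i, ∃ t ∈ Icc (0 : ℝ) 1, (D.arc i).pt t = p₀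
  cont₁ : ContinuousOn V₁ (D.section' \ {p₀})
  cont₂ : ContinuousOn V₂ (D.section' \ {p₀})
  div_free : ∀ p ∈ D.inner, ∃ A B : ℝ × ℝ →L[ℝ] ℝ,
    HasFDerivAt V₁ A p ∧ HasFDerivAt V₂ B p ∧ A (1, 0) + B (0, 1) = 0
  axis : ∀ p ∈ D.section', p.1 = 0 → p ≠ p₀ → V₁ p = 0
  integrable : ∀ j, IntervalIntegrable ((D.arc j).flux V₁ V₂) volume 0 1

/-- The derivative of `ζ` in the direction of the field `V`. -/
noncomputable def along (V₁ V₂ ζ : ℝ × ℝ → ℝ) (p : ℝ × ℝ) : ℝ :=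
  fderiv ℝ ζ p (1, 0) * V₁ p + fderiv ℝ ζ p (0, 1) * V₂ p

/-- The defect in the integration by parts formula for the field `V` and the function `ζ`. -/
noncomputable def defect (V₁ V₂ ζ : ℝ × ℝ → ℝ) : ℝ :=
  (∫ p in D.inner, along V₁ V₂ ζ p)
    - ∑ j, ∫ t in (0 : ℝ)..1, ζ ((D.arc j).pt t) * (D.arc j).flux V₁ V₂ t

variable {D} {V₁ V₂ : ℝ × ℝ → ℝ} {p₀ : ℝ × ℝ}

lemma along_eq_zero {ζ : ℝ × ℝ → ℝ} {p : ℝ × ℝ} (h : p ∉ tsupport ζ) : along V₁ V₂ ζ p = 0 := by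
  have : fderiv ℝ ζ p = 0 := by
    by_contra hne
    exact h (support_fderiv_subset ℝ hne)
  simp [along, this]

lemma continuous_fderiv_apply {ζ : ℝ × ℝ → ℝ} (hζ : ContDiff ℝ 1 ζ) (v : ℝ × ℝ) :
    Continuous fun p => fderiv ℝ ζ p v :=
  (hζ.continuous_fderiv one_ne_zero).clm_apply continuous_const

lemma IsSolenoidal.continuousOn_along (hV : D.IsSolenoidal V₁ V₂ p₀) {ζ : ℝ × ℝ → ℝ}
    (hζ : ContDiff ℝ 1 ζ) (h0 : ζ =ᶠ[𝓝 p₀] 0) : ContinuousOn (along V₁ V₂ ζ) D.section' := by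
  have h1 : ∀ v : ℝ × ℝ, (fun p => fderiv ℝ ζ p v) =ᶠ[𝓝 p₀] 0 := fun v => by
    filter_upwards [h0.fderiv (𝕜 := ℝ)] with p hp
    rw [hp]
    simp
  exact (continuousOn_mul_of_eventuallyEq_zero (continuous_fderiv_apply hζ _) (h1 _) hV.cont₁).add
    (continuousOn_mul_of_eventuallyEq_zero (continuous_fderiv_apply hζ _) (h1 _) hV.cont₂)

lemma IsSolenoidal.integrableOn_along (hV : D.IsSolenoidal V₁ V₂ p₀) {ζ : ℝ × ℝ → ℝ}
    (hζ : ContDiff ℝ 1 ζ) (h0 : ζ =ᶠ[𝓝 p₀] 0) : IntegrableOn (along V₁ V₂ ζ) D.inner :=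
  ((hV.continuousOn_along hζ h0).integrableOn_compact D.isCompact_section).mono_set
    D.inner_subset_section

lemma IsSolenoidal.intervalIntegrable_mul_flux (hV : D.IsSolenoidal V₁ V₂ p₀) {ζ : ℝ × ℝ → ℝ}
    (hζ : Continuous ζ) (j : Fin D.N) :
    IntervalIntegrable (fun t => ζ ((D.arc j).pt t) * (D.arc j).flux V₁ V₂ t) volume 0 1 :=
  (hV.integrable j).continuousOn_mul (hζ.comp (D.arc j).continuous_pt).continuousOn

/-- Both functions vanish near `p₀`, which is what makes the area integrals converge separately. -/
lemma IsSolenoidal.defect_sub (hV : D.IsSolenoidal V₁ V₂ p₀) {ζ₁ ζ₂ : ℝ × ℝ → ℝ}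
    (h₁ : ContDiff ℝ 1 ζ₁) (h₂ : ContDiff ℝ 1 ζ₂) (h₁0 : ζ₁ =ᶠ[𝓝 p₀] 0) (h₂0 : ζ₂ =ᶠ[𝓝 p₀] 0) :
    D.defect V₁ V₂ (fun p => ζ₁ p - ζ₂ p) = D.defect V₁ V₂ ζ₁ - D.defect V₁ V₂ ζ₂ := by
  have e1 : ∀ p, along V₁ V₂ (fun p => ζ₁ p - ζ₂ p) p = along V₁ V₂ ζ₁ p - along V₁ V₂ ζ₂ p := by
    intro p
    have : fderiv ℝ (fun p => ζ₁ p - ζ₂ p) p = fderiv ℝ ζ₁ p - fderiv ℝ ζ₂ p :=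
      fderiv_fun_sub (h₁.differentiable one_ne_zero p) (h₂.differentiable one_ne_zero p)
    simp only [along, this, sub_apply]
    ring
  unfold defect
  simp only [e1, sub_mul]
  rw [integral_sub (hV.integrableOn_along h₁ h₁0) (hV.integrableOn_along h₂ h₂0)]
  simp only [intervalIntegral.integral_sub (hV.intervalIntegrable_mul_flux h₁.continuous _)
    (hV.intervalIntegrable_mul_flux h₂.continuous _), Finset.sum_sub_distrib]
  ring

lemma defect_eq_zero_of_eqOn {ζ : ℝ × ℝ → ℝ} (h : ∀ p ∈ D.section', ζ p = 0) :
    D.defect V₁ V₂ ζ = 0 := by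
  have e1 : ∫ p in D.inner, along V₁ V₂ ζ p = 0 := by
    refine setIntegral_eq_zero_of_forall_eq_zero fun p hp => ?_
    have : fderiv ℝ ζ p = 0 := by
      have : ζ =ᶠ[𝓝 p] fun _ => 0 := by
        filter_upwards [D.isOpen_inner.mem_nhds hp] with q hq
        exact h q (D.inner_subset_section hq)
      rw [this.fderiv_eq]
      simp
    simp [along, this]
  have e2 : ∀ j, ∫ t in (0 : ℝ)..1, ζ ((D.arc j).pt t) * (D.arc j).flux V₁ V₂ t = 0 := fun j => by
    refine (intervalIntegral.integral_congr (g := fun _ => 0) fun t ht => ?_).trans (by simp)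
    rw [uIcc_of_le zero_le_one] at ht
    simp [h _ (D.pt_mem_section ht)]
  simp [defect, e1, e2]

lemma IsSolenoidal.hasFDerivAt_mul (hV : D.IsSolenoidal V₁ V₂ p₀) {ζ : ℝ × ℝ → ℝ}
    (hζ : ContDiff ℝ 1 ζ) {p : ℝ × ℝ} (hp : p ∈ D.inner) :
    ∃ A B : ℝ × ℝ →L[ℝ] ℝ, HasFDerivAt (fun p => ζ p * V₁ p) A p ∧
      HasFDerivAt (fun p => ζ p * V₂ p) B p ∧ A (1, 0) + B (0, 1) = along V₁ V₂ ζ p := by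
  obtain ⟨A, B, hA, hB, hAB⟩ := hV.div_free p hp
  have hd := (hζ.differentiable one_ne_zero p).hasFDerivAt
  refine ⟨_, _, hd.mul hA, hd.mul hB, ?_⟩
  simp only [add_apply, FunLike.coe_smul, Pi.smul_apply, smul_eq_mul, along]
  linear_combination (ζ p) * hAB

/-- Integration by parts near a point of the (three-dimensional) interior, on the axis or not. -/
lemma IsSolenoidal.defect_eq_zero_of_mem (hV : D.IsSolenoidal V₁ V₂ p₀) {p : ℝ × ℝ}
    (hp0 : 0 ≤ p.1) (hp : cyl p.1 0 p.2 ∈ D.Ω) :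
    ∃ ρ > 0, ∀ ζ : ℝ × ℝ → ℝ, ContDiff ℝ 1 ζ → tsupport ζ ⊆ Metric.ball p ρ →
      D.defect V₁ V₂ ζ = 0 := by
  obtain ⟨ρ, hρ, hball⟩ := Metric.nhds_basis_closedBall.mem_iff.1
    ((D.isOpen.preimage continuous_cyl_zero).mem_nhds hp)
  refine ⟨ρ, hρ, fun ζ hζ hsupp => ?_⟩
  have hcurve : ∀ j, ∀ t ∈ Icc (0 : ℝ) 1, (D.arc j).pt t ∉ Metric.closedBall p ρ := by
    intro j t ht hm
    exact D.notMem_of_frontier ((D.cyl_mem_frontier_iff ((D.arc j).r_nonneg t ht)).2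
      ⟨j, t, ht, rfl⟩) (hball hm)
  have hζ0 : ∀ q, q ∉ Metric.ball p ρ → ζ q = 0 := fun q hq =>
    image_eq_zero_of_notMem_tsupport fun h => hq (hsupp h)
  obtain ⟨i, t, ht, hpt⟩ := hV.node
  have hp₀ : p₀ ∉ Metric.closedBall p ρ := hpt ▸ hcurve i t ht
  have hζp₀ : ζ =ᶠ[𝓝 p₀] 0 := by
    filter_upwards [Metric.isClosed_closedBall.isOpen_compl.mem_nhds hp₀] with q hq
    exact hζ0 q fun h => hq (Metric.ball_subset_closedBall h)
  -- The box is cut off at the axis. On its left side either the box ends at the axis, where `V₁`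
  -- vanishes, or ζ vanishes; on the other three sides ζ vanishes.
  set a := max 0 (p.1 - ρ) with ha
  have hbox : Icc a (p.1 + ρ) ×ˢ Icc (p.2 - ρ) (p.2 + ρ) ⊆ Metric.closedBall p ρ := by
    rintro q ⟨hq1, hq2⟩
    rw [Metric.mem_closedBall, Prod.dist_eq]
    refine max_le ?_ ?_
    · rw [Real.dist_eq, abs_le]
      have := (le_max_right 0 (p.1 - ρ)).trans hq1.1
      constructor <;> linarith [hq1.2]
    · rw [Real.dist_eq, abs_le]
      constructor <;> linarith [hq2.1, hq2.2]
  have hsec : Icc a (p.1 + ρ) ×ˢ Icc (p.2 - ρ) (p.2 + ρ) ⊆ D.section' \ {p₀} := fun q hq =>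
    ⟨⟨(le_max_left _ _).trans hq.1.1, subset_closure (hball (hbox hq))⟩, fun h => hp₀ (h ▸ hbox hq)⟩
  have hin : Ioo a (p.1 + ρ) ×ˢ Ioo (p.2 - ρ) (p.2 + ρ) ⊆ D.inner := fun q hq =>
    ⟨(le_max_left _ _).trans_lt hq.1.1,
      hball (hbox ⟨Ioo_subset_Icc_self hq.1, Ioo_subset_Icc_self hq.2⟩)⟩
  have hnot : ∀ q : ℝ × ℝ, ρ ≤ |q.1 - p.1| ∨ ρ ≤ |q.2 - p.2| → ζ q = 0 := fun q hq => by
    refine hζ0 q fun hm => ?_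
    rw [Metric.mem_ball, Prod.dist_eq, max_lt_iff, Real.dist_eq, Real.dist_eq] at hm
    rcases hq with h | h
    · linarith [hm.1]
    · linarith [hm.2]
  choose! A B hA hB hAB using fun q (hq : q ∈ D.inner) => hV.hasFDerivAt_mul hζ hq
  have key := integral_div_rectangle (f := fun p => ζ p * V₁ p) (g := fun p => ζ p * V₂ p)
    (f' := A) (g' := B) (φ := along V₁ V₂ ζ) (a₁ := a) (b₁ := p.1 + ρ) (a₂ := p.2 - ρ)
    (b₂ := p.2 + ρ) (max_le (by linarith) (by linarith)) (by linarith)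
    (hζ.continuous.continuousOn.mul (hV.cont₁.mono hsec))
    (hζ.continuous.continuousOn.mul (hV.cont₂.mono hsec))
    ((hV.continuousOn_along hζ hζp₀).mono fun q hq => (hsec hq).1)
    (fun q hq => hA q (hin hq)) (fun q hq => hB q (hin hq)) (fun q hq => hAB q (hin hq))
    ?_ ?_ ?_
  · have e1 : ∫ q in D.inner, along V₁ V₂ ζ q = 0 := by
      rw [setIntegral_eq_of_subset_of_forall_sdiff_eq_zero D.isOpen_inner.measurableSet hin, key]
      · rw [neg_eq_zero]
        refine (intervalIntegral.integral_congr (g := fun _ => 0) fun x _ => ?_).trans (by simp)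
        simp only
        rw [hnot (x, p.2 - ρ) (Or.inr (by simp [abs_of_pos hρ])), zero_mul]
      · rintro q ⟨hq, hqn⟩
        refine along_eq_zero fun hs => hqn ?_
        have hm := hsupp hs
        rw [Metric.mem_ball, Prod.dist_eq, max_lt_iff, Real.dist_eq, Real.dist_eq, abs_lt,
          abs_lt] at hm
        exact ⟨⟨max_lt hq.1 (by linarith [hm.1.1]), by linarith [hm.1.2]⟩,
          ⟨by linarith [hm.2.1], by linarith [hm.2.2]⟩⟩
    have e2 : ∀ j, ∫ t in (0 : ℝ)..1, ζ ((D.arc j).pt t) * (D.arc j).flux V₁ V₂ t = 0 := by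
      intro j
      refine (intervalIntegral.integral_congr (g := fun _ => 0) fun t ht => ?_).trans (by simp)
      rw [uIcc_of_le zero_le_one] at ht
      simp [hζ0 _ fun h => hcurve j t ht (Metric.ball_subset_closedBall h)]
    simp [defect, e1, e2]
  · intro y hy
    rcases le_or_gt (p.1 - ρ) 0 with h | h
    · have ha0 : a = 0 := max_eq_left h
      have hm := hsec (show (a, y) ∈ _ from ⟨⟨le_rfl, max_le (by linarith) (by linarith)⟩, hy⟩)
      rw [hV.axis (a, y) hm.1 ha0 hm.2, mul_zero]
    · have ha0 : a = p.1 - ρ := max_eq_right h.le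
      rw [hnot (a, y) (Or.inl (by simp [ha0, abs_of_pos hρ])), zero_mul]
  · intro y _
    rw [hnot (p.1 + ρ, y) (Or.inl (by simp [abs_of_pos hρ])), zero_mul]
  · intro x _
    rw [hnot (x, p.2 + ρ) (Or.inr (by simp [abs_of_pos hρ])), zero_mul]

end AxisymDomain

/-! ### Integration by parts at the boundary in tubular coordinates -/

namespace AxisymDomain
variable {D : AxisymDomain} {V₁ V₂ : ℝ × ℝ → ℝ} {p₀ : ℝ × ℝ}

/-- Near an interior point of an arc the domain is the side `s > 0` of the tubular coordinates. -/
lemma tube_mem_of_pos {i : Fin D.N} {t₀ δ h : ℝ} (ht₀ : t₀ ∈ Ioo (0 : ℝ) 1) (hδ : 0 < δ)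
    (hh : 0 < h)
    (hT : ∀ t ∈ Icc (t₀ - δ) (t₀ + δ), ∀ s, |s| ≤ h →
      0 ≤ ((D.arc i).tube ((D.arc i).conormal t₀) (t, s)).1 ∧
        (s ≠ 0 → ∀ j, ∀ t' ∈ Icc (0 : ℝ) 1,
          (D.arc j).pt t' ≠ (D.arc i).tube ((D.arc i).conormal t₀) (t, s))) :
    ∀ t ∈ Icc (t₀ - δ) (t₀ + δ), ∀ s,
      (0 < s → s ≤ h → cyl ((D.arc i).tube ((D.arc i).conormal t₀) (t, s)).1 0
        ((D.arc i).tube ((D.arc i).conormal t₀) (t, s)).2 ∈ D.Ω) ∧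
      (-h ≤ s → s < 0 → cyl ((D.arc i).tube ((D.arc i).conormal t₀) (t, s)).1 0
        ((D.arc i).tube ((D.arc i).conormal t₀) (t, s)).2 ∉ closure D.Ω) := by
  set γ := D.arc i with hγ
  set w := γ.conormal t₀ with hw
  have htI : t₀ ∈ Icc (t₀ - δ) (t₀ + δ) := ⟨by linarith, by linarith⟩
  have hv := γ.speed_pos (Ioo_subset_Icc_self ht₀)
  -- `outward` supplies one point of Ω and one point of the exterior on the normal line at `t₀`.
  -- Each half of the tube is connected and avoids the curve, so one point decides the whole half.
  -- Division by the speed below accounts for `w` not being normalized.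
  have hout := (D.outward i t₀ ht₀).and (Ioc_mem_nhdsGT (show 0 < h * γ.speed t₀ by positivity))
  obtain ⟨ε, ⟨h1, h2⟩, hε0, hε⟩ := hout.exists
  have e1 : ∀ k : ℝ, γ.surf (t₀, 0) - k • γ.normal (t₀, 0)
      = cyl (γ.tube w (t₀, k / γ.speed t₀)).1 0 (γ.tube w (t₀, k / γ.speed t₀)).2 := fun k => by
    rw [γ.surf_eq, γ.normal_eq, smul_cyl, cyl_sub]
    simp only [MeridianArc.tube, hw, MeridianArc.conormal, MeridianArc.nr, MeridianArc.nz]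
    congr 1 <;> ring
  have hin := h1
  have hex := h2
  rw [e1] at hin
  rw [show γ.surf (t₀, 0) + ε • γ.normal (t₀, 0) = γ.surf (t₀, 0) - (-ε) • γ.normal (t₀, 0) by
    rw [neg_smul, sub_neg_eq_add], e1] at hex
  have hs₀ : 0 < ε / γ.speed t₀ := by positivity
  have hs₀h : ε / γ.speed t₀ ≤ h := (div_le_iff₀ hv).2 hε
  have hconn : ∀ J : Set ℝ, Convex ℝ J → IsPreconnected
      (γ.tube w '' (Icc (t₀ - δ) (t₀ + δ) ×ˢ J)) := fun J hJ =>
    (((convex_Icc _ _).prod hJ).isPreconnected).image _ (γ.continuous_tube w).continuousOn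
  have hcon : ∀ J : Set ℝ, Convex ℝ J → (∀ s ∈ J, |s| ≤ h ∧ s ≠ 0) →
      ∀ t ∈ Icc (t₀ - δ) (t₀ + δ), ∀ s ∈ J,
      cyl (γ.tube w (t, s)).1 0 (γ.tube w (t, s)).2 ∈ closure D.Ω →
      ∀ t' ∈ Icc (t₀ - δ) (t₀ + δ), ∀ s' ∈ J,
      cyl (γ.tube w (t', s')).1 0 (γ.tube w (t', s')).2 ∈ D.Ω := by
    intro J hJ hJs t ht s hs hmem t' ht' s' hs'
    refine D.mem_of_isPreconnected (hconn J hJ) ?_ ?_ (mem_image_of_mem _ ⟨ht, hs⟩) hmem _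
      (mem_image_of_mem _ ⟨ht', hs'⟩)
    · rintro _ ⟨⟨x, y⟩, ⟨hx, hy⟩, rfl⟩
      exact (hT x hx y (hJs y hy).1).1
    · rintro _ ⟨⟨x, y⟩, ⟨hx, hy⟩, rfl⟩
      exact (hT x hx y (hJs y hy).1).2 (hJs y hy).2
  intro t ht s
  constructor
  · intro hs0 hsh
    exact hcon (Ioc 0 h) (convex_Ioc _ _)
      (fun s hs => ⟨by rw [abs_of_pos hs.1]; exact hs.2, hs.1.ne'⟩) t₀ htI _ ⟨hs₀, hs₀h⟩
      (subset_closure hin) t ht s ⟨hs0, hsh⟩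
  · intro hsh hs0 hmem
    refine hex (subset_closure (hcon (Ico (-h) 0) (convex_Ico _ _)
      (fun s hs => ⟨by rw [abs_of_neg hs.2]; linarith [hs.1], hs.2.ne⟩) t ht s ⟨hsh, hs0⟩ hmem
      t₀ htI _ ⟨?_, ?_⟩))
    · rw [neg_div]; linarith
    · rw [neg_div]; linarith

/-- Integration by parts near an interior point of an arc. -/
lemma IsSolenoidal.defect_eq_zero_of_arc (hV : D.IsSolenoidal V₁ V₂ p₀) {i : Fin D.N} {t₀ : ℝ}
    (ht₀ : t₀ ∈ Ioo (0 : ℝ) 1) (hne : (D.arc i).pt t₀ ≠ p₀) :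
    ∃ ρ > 0, ∀ ζ : ℝ × ℝ → ℝ, ContDiff ℝ 1 ζ → tsupport ζ ⊆ Metric.ball ((D.arc i).pt t₀) ρ →
      D.defect V₁ V₂ ζ = 0 := by
  obtain ⟨δ, hδ, h, hh, ρ', hρ', C, -, hsub, hJ, hinj, hT, hcov⟩ :=
    IsNode.exists_tube (Or.inl ht₀ : D.IsNode i t₀) (dist_pos.2 hne)
  replace hsub := hsub ht₀
  set γ := D.arc i with hγ
  set w := γ.conormal t₀ with hw
  have hI01 : ∀ t ∈ Icc (t₀ - δ) (t₀ + δ), t ∈ Icc (0 : ℝ) 1 := fun t ht =>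
    Ioo_subset_Icc_self (hsub ht)
  have hside := tube_mem_of_pos ht₀ hδ hh fun t ht s hs =>
    ⟨(hT t ⟨ht, hI01 t ht⟩ s hs).1, (hT t ⟨ht, hI01 t ht⟩ s hs).2.2.2⟩
  have hρp₀ : 0 < dist (γ.pt t₀) p₀ := dist_pos.2 hne
  set ρ := min ρ' (dist (γ.pt t₀) p₀) with hρdef
  refine ⟨ρ, lt_min hρ' hρp₀, fun ζ hζ hsupp => ?_⟩
  have hζ0 : ∀ q, q ∉ Metric.ball (γ.pt t₀) ρ → ζ q = 0 := fun q hq =>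
    image_eq_zero_of_notMem_tsupport fun h => hq (hsupp h)
  have hζp₀ : ζ =ᶠ[𝓝 p₀] 0 := by
    have : p₀ ∉ tsupport ζ := fun h => by
      have := (Metric.mem_ball.1 (hsupp h)).trans_le (min_le_right _ _)
      rw [dist_comm] at this
      exact lt_irrefl _ this
    exact notMem_tsupport_iff_eventuallyEq.1 this
  have hcov' : ∀ p : ℝ × ℝ, 0 ≤ p.1 → p ∈ Metric.ball (γ.pt t₀) ρ →
      ∃ t ∈ Ioo (t₀ - δ) (t₀ + δ), ∃ s, |s| < h ∧ γ.tube w (t, s) = p := fun p hp hm => by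
    obtain ⟨t, ht, s, hs, he, -⟩ := hcov p hp ((Metric.mem_ball.1 hm).trans_le (min_le_left _ _))
    exact ⟨t, ht.1, s, hs, he⟩
  have hbox : ∀ q ∈ Icc (t₀ - δ) (t₀ + δ) ×ˢ Icc 0 h, γ.tube w q ∈ D.section' \ {p₀} := by
    rintro ⟨t, s⟩ ⟨ht, hs⟩
    have habs : |s| ≤ h := by rw [abs_of_nonneg hs.1]; exact hs.2
    obtain ⟨h1, h2, h3, h4⟩ := hT t ⟨ht, hI01 t ht⟩ s habs
    refine ⟨⟨h1, ?_⟩, fun he => ?_⟩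
    · rcases eq_or_lt_of_le hs.1 with h0 | h0
      · subst h0
        rw [γ.tube_zero]
        exact (D.pt_mem_section (hI01 t ht)).2
      · exact subset_closure ((hside t ht s).1 h0 hs.2)
    · rw [mem_singleton_iff] at he
      rw [he, dist_comm] at h3
      exact lt_irrefl _ h3
  have hin : ∀ q ∈ Ioo (t₀ - δ) (t₀ + δ) ×ˢ Ioo 0 h, γ.tube w q ∈ D.inner := by
    rintro ⟨t, s⟩ ⟨ht, hs⟩
    have ht' := Ioo_subset_Icc_self ht
    have habs : |s| ≤ h := by rw [abs_of_pos hs.1]; exact hs.2.le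
    exact ⟨(hT t ⟨ht', hI01 t ht'⟩ s habs).2.1 ht₀, (hside t ht' s).1 hs.1 hs.2.le⟩
  have hface : ∀ q ∈ Icc (t₀ - δ) (t₀ + δ) ×ˢ Icc 0 h,
      (q.1 ∉ Ioo (t₀ - δ) (t₀ + δ) ∨ q.2 = h) → ζ (γ.tube w q) = 0 := by
    rintro q hq hor
    refine hζ0 _ fun hm => ?_
    obtain ⟨t, ht, s, hs, he⟩ := hcov' _ (hbox q hq).1.1 hm
    have := hinj ⟨Ioo_subset_Icc_self ht, mem_univ _⟩ ⟨hq.1, mem_univ _⟩ he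
    rw [← this] at hor
    rcases hor with h1 | h1
    · exact h1 ht
    · rw [show s = h from h1] at hs
      exact absurd (le_abs_self h) (not_le.2 hs)
  choose! A B hA hB hAB using fun q (hq : q ∈ D.inner) => hV.hasFDerivAt_mul hζ hq
  have hmaps : MapsTo (γ.tube w) (Icc (t₀ - δ) (t₀ + δ) ×ˢ Icc 0 h) (D.section' \ {p₀}) := hbox
  have hc := (γ.continuous_tube w).continuousOn (s := Icc (t₀ - δ) (t₀ + δ) ×ˢ Icc 0 h)
  have hU₁ := (hζ.continuous.continuousOn.mul hV.cont₁).comp hc hmaps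
  have hU₂ := (hζ.continuous.continuousOn.mul hV.cont₂).comp hc hmaps
  have hr1 : Continuous fun q : ℝ × ℝ => deriv γ.r q.1 := γ.continuous_deriv_r.comp continuous_fst
  have hz1 : Continuous fun q : ℝ × ℝ => deriv γ.z q.1 := γ.continuous_deriv_z.comp continuous_fst
  have hrd : ∀ q : ℝ × ℝ, HasFDerivAt (fun q : ℝ × ℝ => deriv γ.r q.1)
      (deriv (deriv γ.r) q.1 • ContinuousLinearMap.fst ℝ ℝ ℝ) q := fun q =>
    ((γ.contDiff_deriv_r.differentiable one_ne_zero q.1).hasDerivAt).comp_hasFDerivAt q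
      hasFDerivAt_fst
  have hzd : ∀ q : ℝ × ℝ, HasFDerivAt (fun q : ℝ × ℝ => deriv γ.z q.1)
      (deriv (deriv γ.z) q.1 • ContinuousLinearMap.fst ℝ ℝ ℝ) q := fun q =>
    ((γ.contDiff_deriv_z.differentiable one_ne_zero q.1).hasDerivAt).comp_hasFDerivAt q
      hasFDerivAt_fst
  have hcA := fun q (hq : q ∈ Ioo (t₀ - δ) (t₀ + δ) ×ˢ Ioo 0 h) =>
    (hA _ (hin q hq)).comp q (γ.hasFDerivAt_tube w q)
  have hcB := fun q (hq : q ∈ Ioo (t₀ - δ) (t₀ + δ) ×ˢ Ioo 0 h) =>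
    (hB _ (hin q hq)).comp q (γ.hasFDerivAt_tube w q)
  -- The Piola transform: the adjugate of the Jacobian matrix of the tube is applied to ζV. The
  -- divergence of the result in (t, s) is the Jacobian times the divergence of ζV, and on `s = 0`
  -- its second component is minus ζ times the flux density. The coefficients of `g` depend on `t`
  -- only, so second derivatives of the arc drop out.
  have key := integral_div_rectangle (a₁ := t₀ - δ) (b₁ := t₀ + δ) (a₂ := 0) (b₂ := h)
    (f := fun q => w.1 * (ζ (γ.tube w q) * V₂ (γ.tube w q))
      - w.2 * (ζ (γ.tube w q) * V₁ (γ.tube w q)))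
    (g := fun q => deriv γ.r q.1 * (ζ (γ.tube w q) * V₂ (γ.tube w q))
      - deriv γ.z q.1 * (ζ (γ.tube w q) * V₁ (γ.tube w q)))
    (φ := fun q => γ.tubeJac w q.1 * along V₁ V₂ ζ (γ.tube w q)) (by linarith) hh.le
    ((continuousOn_const.mul hU₂).sub (continuousOn_const.mul hU₁))
    ((hr1.continuousOn.mul hU₂).sub (hz1.continuousOn.mul hU₁))
    (((γ.continuous_tubeJac w).comp continuous_fst).continuousOn.mul
      ((hV.continuousOn_along hζ hζp₀).comp hc fun q hq => (hbox q hq).1))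
    (fun q hq => ((hcB q hq).const_mul w.1).sub ((hcA q hq).const_mul w.2))
    (fun q hq => ((hrd q).mul (hcB q hq)).sub ((hzd q).mul (hcA q hq))) ?_ ?_ ?_ ?_
  · have hmeas : MeasurableSet (Ioo (t₀ - δ) (t₀ + δ) ×ˢ Ioo 0 h) :=
      measurableSet_Ioo.prod measurableSet_Ioo
    have himage : γ.tube w '' (Ioo (t₀ - δ) (t₀ + δ) ×ˢ Ioo 0 h) ⊆ D.inner := by
      rintro _ ⟨q, hq, rfl⟩
      exact hin q hq
    have e1 : ∫ q in D.inner, along V₁ V₂ ζ q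
        = ∫ q in Ioo (t₀ - δ) (t₀ + δ) ×ˢ Ioo 0 h,
            γ.tubeJac w q.1 * along V₁ V₂ ζ (γ.tube w q) := by
      rw [setIntegral_eq_of_subset_of_forall_sdiff_eq_zero D.isOpen_inner.measurableSet himage]
      · rw [integral_image_eq_integral_abs_det_fderiv_smul volume hmeas
          (fun q _ => (γ.hasFDerivAt_tube w q).hasFDerivWithinAt)
          (hinj.mono (prod_mono Ioo_subset_Icc_self (subset_univ _)))]
        refine setIntegral_congr_fun hmeas fun q hq => ?_
        simp only [γ.det_tubeDeriv, smul_eq_mul]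
        rw [abs_of_pos (hJ q.1 (Ioo_subset_Icc_self hq.1))]
      · rintro q ⟨hq, hqn⟩
        refine along_eq_zero fun hs => hqn ?_
        obtain ⟨t, ht, s, hs, he⟩ := hcov' q hq.1.le (hsupp hs)
        refine ⟨(t, s), ⟨ht, ?_, (abs_lt.1 hs).2⟩, he⟩
        by_contra hneg
        have hclos : cyl q.1 0 q.2 ∈ closure D.Ω := subset_closure hq.2
        rcases eq_or_lt_of_le (not_lt.1 hneg) with h0 | h0
        · simp only at h0
          rw [h0, γ.tube_zero] at he
          refine D.notMem_of_frontier ((D.cyl_mem_frontier_iff hq.1.le).2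
            ⟨i, t, hI01 t (Ioo_subset_Icc_self ht), he⟩) hq.2
        · rw [← he] at hclos
          exact (hside t (Ioo_subset_Icc_self ht) s).2 (abs_lt.1 hs).1.le h0 hclos
    have hpt : ∀ j, ∀ t ∈ Icc (0 : ℝ) 1, ζ ((D.arc j).pt t) ≠ 0 →
        j = i ∧ t ∈ Ioo (t₀ - δ) (t₀ + δ) := by
      intro j t ht hz
      have hm : (D.arc j).pt t ∈ Metric.ball (γ.pt t₀) ρ := by
        by_contra hm
        exact hz (hζ0 _ hm)
      obtain ⟨t', ht', s, hs, he⟩ := hcov' _ ((D.arc j).r_nonneg t ht) hm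
      have ht'' := Ioo_subset_Icc_self ht'
      have hs0 : s = 0 := by
        by_contra hs0
        exact (hT t' ⟨ht'', hI01 t' ht''⟩ s hs.le).2.2.2 hs0 j t ht he.symm
      rw [hs0, γ.tube_zero] at he
      obtain ⟨h1, h2⟩ := D.simple i j t' (hsub ht'') t ht (congrArg Prod.fst he)
        (congrArg Prod.snd he)
      exact ⟨h1.symm, h2 ▸ ht'⟩
    have e2 : ∑ j, ∫ t in (0 : ℝ)..1, ζ ((D.arc j).pt t) * (D.arc j).flux V₁ V₂ t
        = ∫ t in (t₀ - δ)..(t₀ + δ), ζ (γ.pt t) * γ.flux V₁ V₂ t := by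
      rw [Finset.sum_eq_single i]
      · rw [intervalIntegral.integral_of_le zero_le_one,
          intervalIntegral.integral_of_le (by linarith : t₀ - δ ≤ t₀ + δ)]
        refine setIntegral_eq_of_subset_of_forall_sdiff_eq_zero measurableSet_Ioc ?_ ?_
        · intro t ht
          exact Ioo_subset_Ioc_self (hsub ⟨ht.1.le, ht.2⟩)
        · rintro t ⟨ht, htn⟩
          have : ζ (γ.pt t) = 0 := by
            by_contra hz
            exact htn (Ioo_subset_Ioc_self (hpt i t ⟨ht.1.le, ht.2⟩ hz).2)
          rw [this, zero_mul]
      · intro j _ hj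
        refine (intervalIntegral.integral_congr (g := fun _ => 0) fun t ht => ?_).trans (by simp)
        rw [uIcc_of_le zero_le_one] at ht
        have : ζ ((D.arc j).pt t) = 0 := by
          by_contra hz
          exact hj (hpt j t ht hz).1
        simp [this]
      · simp
    rw [defect, e1, e2, key, ← intervalIntegral.integral_neg, sub_eq_zero]
    refine intervalIntegral.integral_congr fun t _ => ?_
    simp only [γ.tube_zero, MeridianArc.flux]
    ring
  · intro q hq
    have hab := hAB _ (hin q hq)
    set p := γ.tube w q
    have eA : ∀ v : ℝ × ℝ, A p v = v.1 * A p (1, 0) + v.2 * A p (0, 1) := fun v => by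
      conv_lhs => rw [show v = v.1 • (1, 0) + v.2 • ((0, 1) : ℝ × ℝ) by ext <;> simp]
      rw [map_add, map_smul, map_smul, smul_eq_mul, smul_eq_mul]
    have eB : ∀ v : ℝ × ℝ, B p v = v.1 * B p (1, 0) + v.2 * B p (0, 1) := fun v => by
      conv_lhs => rw [show v = v.1 • (1, 0) + v.2 • ((0, 1) : ℝ × ℝ) by ext <;> simp]
      rw [map_add, map_smul, map_smul, smul_eq_mul, smul_eq_mul]
    rw [← hab]
    simp only [add_apply, sub_apply, FunLike.coe_smul, Pi.smul_apply, smul_eq_mul,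
      ContinuousLinearMap.comp_apply, γ.tubeDeriv_apply, ContinuousLinearMap.coe_fst',
      MeridianArc.tubeJac, Function.comp_apply]
    rw [eA (_, _), eB (_, _), eA (_ * (0 : ℝ) - _, _), eB (_ * (0 : ℝ) - _, _)]
    simp only
    ring
  · intro s hs
    have := hface (t₀ - δ, s) ⟨⟨le_rfl, by linarith⟩, hs⟩ (Or.inl fun h => lt_irrefl _ h.1)
    simp [this]
  · intro s hs
    have := hface (t₀ + δ, s) ⟨⟨by linarith, le_rfl⟩, hs⟩ (Or.inl fun h => lt_irrefl _ h.2)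
    simp [this]
  · intro t ht
    have := hface (t, h) ⟨ht, ⟨hh.le, le_rfl⟩⟩ (Or.inr rfl)
    simp [this]

end AxisymDomain
/-- Cutoff functions with the usual scaling. -/
lemma exists_cutoff : ∃ (b : ℝ → ℝ × ℝ → ℝ × ℝ → ℝ) (M : ℝ), 0 < M ∧ ∀ ε > 0, ∀ q,
    ContDiff ℝ 1 (b ε q) ∧ (∀ p, 0 ≤ b ε q p ∧ b ε q p ≤ 1) ∧
    (∀ p, dist p q ≤ ε → b ε q p = 1) ∧ (∀ p, 2 * ε ≤ dist p q → b ε q p = 0) ∧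
    (∀ p v, ‖v‖ ≤ 1 → |fderiv ℝ (b ε q) p v| ≤ M / ε) ∧
    (∀ p v, fderiv ℝ (b ε q) p v ≠ 0 → ε ≤ dist p q ∧ dist p q ≤ 2 * ε) := by
  let f : ContDiffBump (0 : ℝ × ℝ) := ⟨1, 2, one_pos, one_lt_two⟩
  obtain ⟨M, hM⟩ := (f.hasCompactSupport.fderiv (𝕜 := ℝ)).exists_bound_of_continuous
    ((f.contDiff (n := 1)).continuous_fderiv one_ne_zero)
  refine ⟨fun ε q p => f (ε⁻¹ • (p - q)), max M 1, by positivity, fun ε hε q => ?_⟩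
  have hcd : ContDiff ℝ 1 fun p : ℝ × ℝ => f (ε⁻¹ • (p - q)) :=
    f.contDiff.comp (by fun_prop : ContDiff ℝ 1 fun p : ℝ × ℝ => ε⁻¹ • (p - q))
  have hnorm : ∀ p : ℝ × ℝ, dist (ε⁻¹ • (p - q)) 0 = dist p q / ε := fun p => by
    rw [dist_zero_right, norm_smul, Real.norm_eq_abs, abs_of_pos (inv_pos.2 hε), dist_eq_norm,
      inv_mul_eq_div]
  have h1 : ∀ p, dist p q ≤ ε → f (ε⁻¹ • (p - q)) = 1 := fun p hp =>
    f.one_of_mem_closedBall (by rw [Metric.mem_closedBall, hnorm]; exact (div_le_one hε).2 hp)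
  have h2 : ∀ p, 2 * ε ≤ dist p q → f (ε⁻¹ • (p - q)) = 0 := fun p hp =>
    f.zero_of_le_dist (by rw [hnorm]; exact (le_div_iff₀ hε).2 hp)
  refine ⟨hcd, fun p => ⟨f.nonneg, f.le_one⟩, h1, h2, fun p v hv => ?_, fun p v hne => ?_⟩
  · have hd : HasFDerivAt (fun p : ℝ × ℝ => f (ε⁻¹ • (p - q)))
        ((fderiv ℝ f (ε⁻¹ • (p - q))).comp (ε⁻¹ • ContinuousLinearMap.id ℝ (ℝ × ℝ))) p :=
      ((f.contDiff (n := 1)).differentiable one_ne_zero _).hasFDerivAt.comp p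
        (((hasFDerivAt_id p).sub_const q).const_smul ε⁻¹)
    rw [hd.fderiv]
    simp only [ContinuousLinearMap.comp_apply, FunLike.coe_smul, Pi.smul_apply,
      ContinuousLinearMap.id_apply, map_smul, smul_eq_mul]
    rw [abs_mul, abs_of_pos (inv_pos.2 hε), inv_mul_eq_div]
    refine div_le_div_of_nonneg_right ?_ hε.le
    calc _ ≤ ‖fderiv ℝ f (ε⁻¹ • (p - q))‖ * ‖v‖ := ContinuousLinearMap.le_opNorm _ _
      _ ≤ M * 1 := mul_le_mul (hM _) hv (norm_nonneg _) ((norm_nonneg _).trans (hM p))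
      _ ≤ _ := by rw [mul_one]; exact le_max_left _ _
  · by_contra hcon
    rw [not_and_or, not_le, not_le] at hcon
    refine hne ?_
    have hconst : ∀ c : ℝ, (fun p : ℝ × ℝ => f (ε⁻¹ • (p - q))) =ᶠ[𝓝 p] (fun _ => c) →
        fderiv ℝ (fun p : ℝ × ℝ => f (ε⁻¹ • (p - q))) p v = 0 := fun c hc => by
      rw [hc.fderiv_eq]; simp
    rcases hcon with h | h
    · refine hconst 1 ?_
      filter_upwards [(isOpen_lt (continuous_id.dist continuous_const) continuous_const).mem_nhds h]
        with x hx using h1 x (le_of_lt hx)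
    · refine hconst 0 ?_
      filter_upwards [(isOpen_lt continuous_const (continuous_id.dist continuous_const)).mem_nhds h]
        with x hx using h2 x (le_of_lt hx)

/-! ### From local integration by parts to the divergence theorem with corners -/

namespace AxisymDomain
variable {D : AxisymDomain} {V₁ V₂ : ℝ × ℝ → ℝ} {p₀ : ℝ × ℝ}

open Classical in
/-- The end points of the arcs, and one more point. -/
noncomputable def corners (D : AxisymDomain) (p₀ : ℝ × ℝ) : Finset (ℝ × ℝ) :=
  insert p₀ (Finset.univ.image (fun j => (D.arc j).pt 0) ∪
    Finset.univ.image (fun j => (D.arc j).pt 1))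

lemma mem_corners_self : p₀ ∈ D.corners p₀ := by simp [corners]

lemma pt_mem_corners {j : Fin D.N} {t : ℝ} (ht : t = 0 ∨ t = 1) :
    (D.arc j).pt t ∈ D.corners p₀ := by
  classical
  simp only [corners, Finset.mem_insert, Finset.mem_union, Finset.mem_image, Finset.mem_univ,
    true_and]
  rcases ht with rfl | rfl
  · exact Or.inr (Or.inl ⟨j, rfl⟩)
  · exact Or.inr (Or.inr ⟨j, rfl⟩)

lemma pt_notMem_corners {j : Fin D.N} {t : ℝ} (ht : t ∈ Ioo (0 : ℝ) 1)
    (hne : (D.arc j).pt t ≠ p₀) : (D.arc j).pt t ∉ D.corners p₀ := by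
  classical
  simp only [corners, Finset.mem_insert, Finset.mem_union, Finset.mem_image, Finset.mem_univ,
    true_and]
  rintro (h | ⟨k, hk⟩ | ⟨k, hk⟩)
  · exact hne h
  · have := (D.simple j k t ht 0 (by simp) (congrArg Prod.fst hk.symm)
      (congrArg Prod.snd hk.symm)).2
    exact ht.1.ne' this
  · have := (D.simple j k t ht 1 (by simp) (congrArg Prod.fst hk.symm)
      (congrArg Prod.snd hk.symm)).2
    exact ht.2.ne this

/-- Integration by parts near any point of the section other than the corners. -/
lemma IsSolenoidal.exists_defect_eq_zero (hV : D.IsSolenoidal V₁ V₂ p₀) {p : ℝ × ℝ}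
    (hp : p ∈ D.section') (hpc : p ∉ D.corners p₀) :
    ∃ ρ > 0, ∀ ζ : ℝ × ℝ → ℝ, ContDiff ℝ 1 ζ → tsupport ζ ⊆ Metric.ball p ρ →
      D.defect V₁ V₂ ζ = 0 := by
  by_cases h : cyl p.1 0 p.2 ∈ D.Ω
  · exact hV.defect_eq_zero_of_mem hp.1 h
  · have hfr : cyl p.1 0 p.2 ∈ frontier D.Ω := by
      rw [frontier, D.isOpen.interior_eq]
      exact ⟨hp.2, h⟩
    obtain ⟨i, t, ht, rfl⟩ := (D.cyl_mem_frontier_iff hp.1).1 hfr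
    have ht0 : t ≠ 0 := fun h0 => hpc (pt_mem_corners (Or.inl h0))
    have ht1 : t ≠ 1 := fun h0 => hpc (pt_mem_corners (Or.inr h0))
    exact hV.defect_eq_zero_of_arc ⟨lt_of_le_of_ne ht.1 ht0.symm, lt_of_le_of_ne ht.2 ht1⟩
      fun h0 => hpc (h0 ▸ mem_corners_self)

/-- Integration by parts against functions that vanish near the corners. -/
theorem IsSolenoidal.defect_eq_zero (hV : D.IsSolenoidal V₁ V₂ p₀) {ζ : ℝ × ℝ → ℝ}
    (hζ : ContDiff ℝ 1 ζ) (h0 : ∀ q ∈ D.corners p₀, ζ =ᶠ[𝓝 q] 0) : D.defect V₁ V₂ ζ = 0 := by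
  have hK : IsCompact (D.section' ∩ tsupport ζ) :=
    D.isCompact_section.inter_right (isClosed_tsupport ζ)
  have hloc : ∀ p ∈ D.section' ∩ tsupport ζ, ∃ f : ContDiffBump p,
      ∀ ξ : ℝ × ℝ → ℝ, ContDiff ℝ 1 ξ → D.defect V₁ V₂ (fun x => ξ x * f x) = 0 := by
    rintro p ⟨hp, hps⟩
    have hpc : p ∉ D.corners p₀ := fun h => notMem_tsupport_iff_eventuallyEq.2 (h0 p h) hps
    obtain ⟨ρ, hρ, h⟩ := hV.exists_defect_eq_zero hp hpc
    refine ⟨⟨ρ / 4, ρ / 2, by positivity, by linarith⟩, fun ξ hξ => h _ ?_ ?_⟩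
    · exact hξ.mul (ContDiffBump.contDiff _)
    · refine (tsupport_mul_subset_right).trans ?_
      rw [ContDiffBump.tsupport_eq]
      exact Metric.closedBall_subset_ball (half_lt_self hρ)
  choose! f hf using fun p => fun hp => hloc p hp
  obtain ⟨s, hsK, hcov⟩ := hK.elim_nhds_subcover (fun p => Metric.ball p (f p).rIn)
    fun p _ => Metric.ball_mem_nhds p (f p).rIn_pos
  have hp₀ : ζ =ᶠ[𝓝 p₀] 0 := h0 p₀ mem_corners_self
  -- Bumps are peeled off one at a time: passing from ξ to ξ(1 - f) changes the defect by that of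
  -- ξf, which is 0. When all factors are present the product vanishes on the section, since every
  -- point of the support of ζ there lies where some bump equals 1.
  have key : ∀ s' : Finset (ℝ × ℝ), s' ⊆ s →
      D.defect V₁ V₂ ζ = D.defect V₁ V₂ fun x => ζ x * ∏ p ∈ s', (1 - f p x) := by
    classical
    intro s'
    induction s' using Finset.induction_on with
    | empty => intro _; simp
    | insert a t ha ih =>
      intro hsub
      rw [ih ((Finset.subset_insert a t).trans hsub)]
      have hat := hsK a (hsub (Finset.mem_insert_self a t))
      set ξ : ℝ × ℝ → ℝ := fun x => ζ x * ∏ p ∈ t, (1 - f p x) with hξdef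
      have hξ : ContDiff ℝ 1 ξ :=
        hζ.mul (contDiff_prod fun p _ => contDiff_const.sub (f p).contDiff)
      have hξ0 : ξ =ᶠ[𝓝 p₀] 0 := by
        filter_upwards [hp₀] with x hx
        simp [hξdef, hx]
      have hξf : (fun x => ξ x * f a x) =ᶠ[𝓝 p₀] 0 := by
        filter_upwards [hξ0] with x hx
        simp [hx]
      have := hV.defect_sub hξ (hξ.mul (f a).contDiff) hξ0 hξf
      rw [hf a hat ξ hξ, sub_zero] at this
      rw [← this]
      congr 1
      ext x
      rw [Finset.prod_insert ha, hξdef]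
      ring
  rw [key s subset_rfl]
  refine defect_eq_zero_of_eqOn fun p hp => ?_
  by_cases hps : p ∈ tsupport ζ
  · obtain ⟨a, ha, hpa⟩ := mem_iUnion₂.1 (hcov ⟨hp, hps⟩)
    rw [Finset.prod_eq_zero ha, mul_zero]
    rw [(f a).one_of_mem_closedBall (Metric.ball_subset_closedBall hpa), sub_self]
  · rw [image_eq_zero_of_notMem_tsupport hps, zero_mul]

set_option maxHeartbeats 800000 in
/-- **Divergence theorem** for a solenoidal field that may blow up at one boundary point like the
inverse square root of the distance. -/
theorem IsSolenoidal.sum_flux_eq_zero (hV : D.IsSolenoidal V₁ V₂ p₀) {C : ℝ}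
    (hC₁ : ∀ p ∈ D.section', p ≠ p₀ → |V₁ p| ≤ C / Real.sqrt (dist p p₀))
    (hC₂ : ∀ p ∈ D.section', p ≠ p₀ → |V₂ p| ≤ C / Real.sqrt (dist p p₀)) :
    ∑ j, ∫ t in (0 : ℝ)..1, (D.arc j).flux V₁ V₂ t = 0 := by
  classical
  obtain ⟨b, M, hM, hb⟩ := exists_cutoff
  set P := D.corners p₀ with hP
  set ζ : ℝ → ℝ × ℝ → ℝ := fun ε p => 1 - ∑ q ∈ P, b ε q p with hζdef
  have hζ : ∀ ε > 0, ContDiff ℝ 1 (ζ ε) := fun ε hε =>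
    contDiff_const.sub (ContDiff.sum fun q _ => (hb ε hε q).1)
  -- the flux against the cutoff converges
  have hlim : Tendsto (fun ε => ∑ j, ∫ t in (0 : ℝ)..1,
      ζ ε ((D.arc j).pt t) * (D.arc j).flux V₁ V₂ t) (𝓝[>] 0)
      (𝓝 (∑ j, ∫ t in (0 : ℝ)..1, (D.arc j).flux V₁ V₂ t)) := by
    refine tendsto_finsetSum _ fun j _ => ?_
    refine intervalIntegral.tendsto_integral_filter_of_dominated_convergence
      (fun t => (1 + P.card) * |(D.arc j).flux V₁ V₂ t|) ?_ ?_ ?_ ?_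
    · filter_upwards [self_mem_nhdsWithin] with ε hε
      rw [uIoc_of_le zero_le_one]
      exact (hV.intervalIntegrable_mul_flux (hζ ε hε).continuous j).1.aestronglyMeasurable
    · filter_upwards [self_mem_nhdsWithin] with ε hε
      refine Eventually.of_forall fun t _ => ?_
      rw [norm_mul, Real.norm_eq_abs, Real.norm_eq_abs]
      refine mul_le_mul_of_nonneg_right ?_ (abs_nonneg _)
      have h1 : 0 ≤ ∑ q ∈ P, b ε q ((D.arc j).pt t) :=
        Finset.sum_nonneg fun q _ => ((hb ε hε q).2.1 _).1
      have h2 : ∑ q ∈ P, b ε q ((D.arc j).pt t) ≤ P.card := by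
        refine (Finset.sum_le_card_nsmul P _ 1 fun q _ => ((hb ε hε q).2.1 _).2).trans ?_
        simp
      rw [abs_le]
      constructor <;> simp only [hζdef] <;> linarith
    · exact ((hV.integrable j).abs).const_mul _
    -- Interior points of an arc are no end points, and the arc passes `p₀` at most once in its
    -- interior. So for almost every `t` the cutoff equals 1 as soon as ε is small.
    · have hcount : {t : ℝ | t ∈ Ioo (0 : ℝ) 1 ∧ (D.arc j).pt t = p₀}.Countable := by
        refine Set.Subsingleton.countable fun t ht t' ht' => ?_
        have he := ht.2.trans ht'.2.symm
        exact (D.simple j j t ht.1 t' (Ioo_subset_Icc_self ht'.1) (congrArg Prod.fst he)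
          (congrArg Prod.snd he)).2
      have hae := (hcount.union (countable_singleton 1)).ae_notMem volume
      filter_upwards [hae] with t ht hI
      rw [uIoc_of_le zero_le_one] at hI
      simp only [mem_union, mem_ofPred_eq, mem_singleton_iff, not_or, not_and] at ht
      have ht' : t ∈ Ioo (0 : ℝ) 1 := ⟨hI.1, lt_of_le_of_ne hI.2 ht.2⟩
      have hnc := pt_notMem_corners ht' (ht.1 ht')
      refine tendsto_const_nhds.congr' ?_
      have hev : ∀ᶠ ε in 𝓝[>] (0 : ℝ), ∀ q ∈ P, 2 * ε < dist ((D.arc j).pt t) q := by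
        refine (Filter.eventually_all_finset P).2 fun q hq => ?_
        have hd : 0 < dist ((D.arc j).pt t) q := dist_pos.2 fun h => hnc (h ▸ hq)
        filter_upwards [nhdsWithin_le_nhds (Iio_mem_nhds (half_pos hd))] with ε hε
        rw [mem_Iio] at hε
        linarith
      filter_upwards [hev, self_mem_nhdsWithin] with ε h1 hε
      have : ∑ q ∈ P, b ε q ((D.arc j).pt t) = 0 :=
        Finset.sum_eq_zero fun q hq => (hb ε hε q).2.2.2.1 _ (h1 q hq).le
      simp [hζdef, this]
  -- the volume term is small
  have hsep : ∀ᶠ ε in 𝓝[>] (0 : ℝ), ∀ q ∈ P, ∀ q' ∈ P, q ≠ q' → 3 * ε < dist q q' := by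
    refine (Filter.eventually_all_finset P).2 fun q _ =>
      (Filter.eventually_all_finset P).2 fun q' _ => ?_
    by_cases h : q = q'
    · exact Eventually.of_forall fun ε hne => absurd h hne
    · have hd : 0 < dist q q' := dist_pos.2 h
      filter_upwards [nhdsWithin_le_nhds (Iio_mem_nhds (by positivity : 0 < dist q q' / 3))]
        with ε hε _
      rw [mem_Iio] at hε
      linarith
  have hC0 : 0 ≤ |C| := abs_nonneg C
  have hbound : ∀ᶠ ε in 𝓝[>] (0 : ℝ),
      ‖∑ j, ∫ t in (0 : ℝ)..1, ζ ε ((D.arc j).pt t) * (D.arc j).flux V₁ V₂ t‖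
        ≤ (32 * P.card * M * |C|) * Real.sqrt ε := by
    filter_upwards [hsep, self_mem_nhdsWithin] with ε hsep hε
    rw [mem_Ioi] at hε
    -- Within ε of one corner its own bump is 1, and by the separation 3ε all other bumps, supported
    -- within 2ε, are 0.
    have hnear : ∀ q ∈ P, ζ ε =ᶠ[𝓝 q] 0 := by
      intro q hq
      filter_upwards [Metric.ball_mem_nhds q hε] with x hx
      have hx' : dist x q < ε := hx
      have : ∑ q' ∈ P, b ε q' x = 1 := by
        rw [Finset.sum_eq_single q]
        · exact (hb ε hε q).2.2.1 x hx'.le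
        · intro q' hq' hne
          refine (hb ε hε q').2.2.2.1 x ?_
          have h1 := hsep q hq q' hq' hne.symm
          have h2 := dist_triangle_left q q' x
          linarith
        · exact fun h => absurd hq h
      simp [hζdef, this]
    have hdef := hV.defect_eq_zero (hζ ε hε) hnear
    rw [defect, sub_eq_zero] at hdef
    rw [← hdef]
    -- Two components, gradient of a cutoff at most M/ε, and field at most |C|/√ε wherever that
    -- gradient is nonzero.
    set c : ℝ := 2 * (M / ε) * (|C| / Real.sqrt ε) with hc
    have hc0 : 0 ≤ c := by positivity
    have hfd : ∀ p v, fderiv ℝ (ζ ε) p v = -∑ q ∈ P, fderiv ℝ (b ε q) p v := fun p v => by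
      have h1 : HasFDerivAt (ζ ε) (-∑ q ∈ P, fderiv ℝ (b ε q) p) p :=
        (HasFDerivAt.fun_sum fun q _ =>
          ((hb ε hε q).1.differentiable one_ne_zero p).hasFDerivAt).const_sub 1
      rw [h1.fderiv]
      simp
    have hpt : ∀ p ∈ D.inner, ‖along V₁ V₂ (ζ ε) p‖
        ≤ ∑ q ∈ P, (Metric.closedBall q (2 * ε)).indicator (fun _ => c) p := by
      intro p hp
      have e : along V₁ V₂ (ζ ε) p = -∑ q ∈ P,
          (fderiv ℝ (b ε q) p (1, 0) * V₁ p + fderiv ℝ (b ε q) p (0, 1) * V₂ p) := by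
        rw [along, hfd, hfd, Finset.sum_add_distrib, ← Finset.sum_mul, ← Finset.sum_mul]
        ring
      rw [e, norm_neg]
      refine norm_sum_le_of_le P fun q hq => ?_
      have hterm : ∀ (v : ℝ × ℝ) (F : ℝ × ℝ → ℝ), ‖v‖ ≤ 1 →
          (∀ p ∈ D.section', p ≠ p₀ → |F p| ≤ C / Real.sqrt (dist p p₀)) →
          |fderiv ℝ (b ε q) p v * F p|
            ≤ (Metric.closedBall q (2 * ε)).indicator (fun _ => c / 2) p := by
        intro v F hv hF
        by_cases h0 : fderiv ℝ (b ε q) p v = 0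
        · rw [h0, zero_mul, abs_zero]
          exact indicator_nonneg (fun _ _ => by positivity) _
        · obtain ⟨ha, ha'⟩ := (hb ε hε q).2.2.2.2.2 p v h0
          rw [indicator_of_mem (Metric.mem_closedBall.2 ha')]
          -- The gradient of the bump at `p₀` lives at distance at least ε; a bump at another corner
          -- reaches 2ε, and corners are more than 3ε apart.
          have hfar : ε ≤ dist p p₀ := by
            by_cases hq0 : q = p₀
            · rwa [← hq0]
            · have h1 := hsep q hq p₀ mem_corners_self hq0
              have h2 := dist_triangle_left q p₀ p
              linarith
          have hne : p ≠ p₀ := fun h => by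
            rw [h, dist_self] at hfar
            linarith
          have hFp : |F p| ≤ |C| / Real.sqrt ε := by
            refine (hF p (D.inner_subset_section hp) hne).trans ?_
            refine div_le_div₀ hC0 (le_abs_self C) (Real.sqrt_pos.2 hε) (Real.sqrt_le_sqrt hfar)
          rw [abs_mul, hc]
          calc _ ≤ (M / ε) * (|C| / Real.sqrt ε) :=
                mul_le_mul ((hb ε hε q).2.2.2.2.1 p v hv) hFp (abs_nonneg _) (by positivity)
            _ = _ := by ring
      have h1 := hterm (1, 0) V₁ (by simp [Prod.norm_def]) hC₁
      have h2 := hterm (0, 1) V₂ (by simp [Prod.norm_def]) hC₂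
      refine (norm_add_le _ _).trans ((add_le_add h1 h2).trans (le_of_eq ?_))
      by_cases hm : p ∈ Metric.closedBall q (2 * ε)
      · simp only [indicator_of_mem hm]; ring
      · simp only [indicator_of_notMem hm]; ring
    have hvol : ∀ q : ℝ × ℝ, volume.real (Metric.closedBall q (2 * ε)) = 16 * ε ^ 2 := fun q => by
      rw [show Metric.closedBall q (2 * ε)
          = Metric.closedBall q.1 (2 * ε) ×ˢ Metric.closedBall q.2 (2 * ε) from
        (closedBall_prod_same q.1 q.2 _).symm, Measure.volume_eq_prod, measureReal_prod_prod,
        Real.volume_real_closedBall (by positivity), Real.volume_real_closedBall (by positivity)]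
      ring
    have hfin : ∀ q : ℝ × ℝ, volume (Metric.closedBall q (2 * ε)) ≠ ⊤ := fun q =>
      (isCompact_closedBall q _).measure_lt_top.ne
    have hig : ∀ q : ℝ × ℝ, Integrable ((Metric.closedBall q (2 * ε)).indicator fun _ => c) :=
      fun q => (integrable_indicator_iff Metric.isClosed_closedBall.measurableSet).2
        (integrableOn_const (hfin q))
    calc ‖∫ p in D.inner, along V₁ V₂ (ζ ε) p‖
        ≤ ∫ p in D.inner, ∑ q ∈ P, (Metric.closedBall q (2 * ε)).indicator (fun _ => c) p := by
          refine norm_integral_le_of_norm_le ?_ ?_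
          · exact integrable_finsetSum _ fun q _ => (hig q).integrableOn
          · exact (ae_restrict_iff' D.isOpen_inner.measurableSet).2 (Eventually.of_forall hpt)
      _ ≤ ∫ p, ∑ q ∈ P, (Metric.closedBall q (2 * ε)).indicator (fun _ => c) p := by
          refine setIntegral_le_integral (integrable_finsetSum _ fun q _ => hig q) ?_
          exact Eventually.of_forall fun p =>
            Finset.sum_nonneg fun q _ => indicator_nonneg (fun _ _ => hc0) _
      _ = ∑ q ∈ P, 16 * ε ^ 2 * c := by
          rw [integral_finsetSum _ fun q _ => hig q]
          refine Finset.sum_congr rfl fun q _ => ?_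
          rw [integral_indicator Metric.isClosed_closedBall.measurableSet, setIntegral_const,
            hvol, smul_eq_mul]
      -- 16ε² is the area of a ball of radius 2ε in the sup metric, a square of side 4ε.
      _ = (32 * P.card * M * |C|) * Real.sqrt ε := by
          rw [Finset.sum_const, nsmul_eq_mul, hc]
          have hs := Real.sq_sqrt hε.le
          have hs0 := (Real.sqrt_pos.2 hε).ne'
          field_simp
          linear_combination (-(32 * (P.card : ℝ) * |C|)) * hs
  have hzero : Tendsto (fun ε => ∑ j, ∫ t in (0 : ℝ)..1,
      ζ ε ((D.arc j).pt t) * (D.arc j).flux V₁ V₂ t) (𝓝[>] 0) (𝓝 0) := by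
    refine squeeze_zero_norm' hbound ?_
    have : Tendsto (fun ε => (32 * P.card * M * |C|) * Real.sqrt ε) (𝓝 0)
        (𝓝 ((32 * P.card * M * |C|) * Real.sqrt 0)) :=
      (continuous_const.mul Real.continuous_sqrt).tendsto 0
    rw [Real.sqrt_zero, mul_zero] at this
    exact this.mono_left nhdsWithin_le_nhds
  exact tendsto_nhds_unique hlim hzero

end AxisymDomain
/-! ### Axisymmetric harmonic functions in the meridian half-plane -/

/-- Linear forms on the plane in coordinates. -/
noncomputable def form (a b : ℝ) : ℝ × ℝ →L[ℝ] ℝ :=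
  a • ContinuousLinearMap.fst ℝ ℝ ℝ + b • ContinuousLinearMap.snd ℝ ℝ ℝ

@[simp] lemma form_apply (a b : ℝ) (v : ℝ × ℝ) : form a b v = a * v.1 + b * v.2 := by simp [form]

/-- `u` has the gradient `(u₁, u₂)` at `p` and satisfies `∂ᵣ(r ∂ᵣu) + ∂_z(r ∂_z u) = 0` there. -/
structure IsAxisymHarmonicAt (u u₁ u₂ : ℝ × ℝ → ℝ) (p : ℝ × ℝ) : Prop where
  hasFDerivAt : HasFDerivAt u (form (u₁ p) (u₂ p)) p
  laplace : ∃ A B : ℝ × ℝ →L[ℝ] ℝ, HasFDerivAt u₁ A p ∧ HasFDerivAt u₂ B p ∧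
    u₁ p + p.1 * (A (1, 0) + B (0, 1)) = 0

namespace IsAxisymHarmonicAt

variable {u u₁ u₂ v v₁ v₂ : ℝ × ℝ → ℝ} {p : ℝ × ℝ}

lemma sub (hu : IsAxisymHarmonicAt u u₁ u₂ p) (hv : IsAxisymHarmonicAt v v₁ v₂ p) :
    IsAxisymHarmonicAt (fun q => u q - v q) (fun q => u₁ q - v₁ q) (fun q => u₂ q - v₂ q) p := by
  obtain ⟨A, B, hA, hB, h⟩ := hu.laplace
  obtain ⟨A', B', hA', hB', h'⟩ := hv.laplace
  refine ⟨(hu.hasFDerivAt.sub hv.hasFDerivAt).congr_fderiv ?_, _, _, hA.sub hA', hB.sub hB', ?_⟩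
  · ext <;> simp
  · simp only [sub_apply]
    linear_combination h - h'

lemma const_add_mul (hu : IsAxisymHarmonicAt u u₁ u₂ p) (c k : ℝ) :
    IsAxisymHarmonicAt (fun q => c + k * u q) (fun q => k * u₁ q) (fun q => k * u₂ q) p := by
  obtain ⟨A, B, hA, hB, h⟩ := hu.laplace
  refine ⟨((hu.hasFDerivAt.const_mul k).const_add c).congr_fderiv ?_, _, _,
    hA.const_mul k, hB.const_mul k, ?_⟩
  · ext <;> simp
  · simp only [FunLike.coe_smul, Pi.smul_apply, smul_eq_mul]
    linear_combination k * h

lemma congr (hu : IsAxisymHarmonicAt u u₁ u₂ p) (h : v =ᶠ[𝓝 p] u) (h₁ : v₁ =ᶠ[𝓝 p] u₁)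
    (h₂ : v₂ =ᶠ[𝓝 p] u₂) : IsAxisymHarmonicAt v v₁ v₂ p := by
  obtain ⟨A, B, hA, hB, hAB⟩ := hu.laplace
  refine ⟨?_, A, B, hA.congr_of_eventuallyEq h₁, hB.congr_of_eventuallyEq h₂, ?_⟩
  · rw [h₁.eq_of_nhds, h₂.eq_of_nhds]
    exact hu.hasFDerivAt.congr_of_eventuallyEq h
  · rw [h₁.eq_of_nhds]
    exact hAB

/-- The field of Green's second identity is solenoidal. -/
lemma green_field (hu : IsAxisymHarmonicAt u u₁ u₂ p) (hv : IsAxisymHarmonicAt v v₁ v₂ p) :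
    ∃ A B : ℝ × ℝ →L[ℝ] ℝ,
      HasFDerivAt (fun q => q.1 * (u q * v₁ q - v q * u₁ q)) A p ∧
      HasFDerivAt (fun q => q.1 * (u q * v₂ q - v q * u₂ q)) B p ∧ A (1, 0) + B (0, 1) = 0 := by
  obtain ⟨A, B, hA, hB, h⟩ := hu.laplace
  obtain ⟨A', B', hA', hB', h'⟩ := hv.laplace
  refine ⟨_, _, hasFDerivAt_fst.mul ((hu.hasFDerivAt.mul hA').sub (hv.hasFDerivAt.mul hA)),
    hasFDerivAt_fst.mul ((hu.hasFDerivAt.mul hB').sub (hv.hasFDerivAt.mul hB)), ?_⟩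
  simp only [add_apply, sub_apply, FunLike.coe_smul, Pi.smul_apply, smul_eq_mul, form_apply,
    ContinuousLinearMap.coe_fst']
  -- The products of first derivatives cancel by symmetry; what remains is `u` times the equation
  -- for `v` minus `v` times the equation for `u`.
  linear_combination (u p) * h' - (v p) * h

end IsAxisymHarmonicAt

/-! ### The ring potential -/

/-- Square of the distance between `(a, 0, c)` and the point with azimuth `θ` above `p`. -/
noncomputable def ringSq (a c θ : ℝ) (p : ℝ × ℝ) : ℝ :=
  p.1 ^ 2 + a ^ 2 - 2 * p.1 * a * Real.cos θ + (p.2 - c) ^ 2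

/-- Reciprocal distance, see `ringSq`. -/
noncomputable def ringInv (a c θ : ℝ) (p : ℝ × ℝ) : ℝ := (Real.sqrt (ringSq a c θ p))⁻¹

section ring

variable {a c θ : ℝ} {p : ℝ × ℝ}

lemma ringSq_eq (a c θ : ℝ) (p : ℝ × ℝ) : ringSq a c θ p = ‖cyl p.1 θ p.2 - cyl a 0 c‖ ^ 2 :=
  (norm_cyl_sub_sq _ _ _ _ _).symm

lemma ringSq_pos (ha : 0 ≤ a) (hp : 0 ≤ p.1) (hne : p ≠ (a, c)) : 0 < ringSq a c θ p := by
  rw [ringSq_eq]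
  exact pow_pos (norm_cyl_sub_pos ha hp hne θ) 2

lemma ringInv_eq (a c θ : ℝ) (p : ℝ × ℝ) :
    ringInv a c θ p = 1 / ‖cyl p.1 θ p.2 - cyl a 0 c‖ := by
  rw [ringInv, ringSq_eq, Real.sqrt_sq (norm_nonneg _), one_div]

lemma ringInv_sq_mul (h : 0 < ringSq a c θ p) : ringInv a c θ p ^ 2 * ringSq a c θ p = 1 := by
  rw [ringInv, inv_pow, Real.sq_sqrt h.le, inv_mul_cancel₀ h.ne']

lemma hasFDerivAt_ringInv (h : 0 < ringSq a c θ p) :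
    HasFDerivAt (ringInv a c θ) (form (-(p.1 - a * Real.cos θ) * ringInv a c θ p ^ 3)
      (-(p.2 - c) * ringInv a c θ p ^ 3)) p := by
  have h1 : HasFDerivAt (ringSq a c θ)
      (form (2 * (p.1 - a * Real.cos θ)) (2 * (p.2 - c))) p := by
    have e1 : HasFDerivAt (fun p : ℝ × ℝ => p.1) (ContinuousLinearMap.fst ℝ ℝ ℝ) p :=
      hasFDerivAt_fst
    have e2 : HasFDerivAt (fun p : ℝ × ℝ => p.2) (ContinuousLinearMap.snd ℝ ℝ ℝ) p :=
      hasFDerivAt_snd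
    have := (((e1.pow 2).add_const (a ^ 2)).sub
      (((e1.const_mul 2).mul_const a).mul_const (Real.cos θ))).add ((e2.sub_const c).pow 2)
    refine this.congr_fderiv ?_
    ext <;> simp
    ring
  have hs := (Real.sqrt_pos.2 h).ne'
  refine ((hasDerivAt_inv hs).comp_hasFDerivAt p (h1.sqrt h.ne')).congr_fderiv ?_
  ext <;> simp [ringInv] <;> field_simp <;> ring

lemma hasFDerivAt_ringInv_pow_three (h : 0 < ringSq a c θ p) :
    HasFDerivAt (fun q => ringInv a c θ q ^ 3)
      (form (-3 * (p.1 - a * Real.cos θ) * ringInv a c θ p ^ 5)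
      (-3 * (p.2 - c) * ringInv a c θ p ^ 5)) p := by
  refine ((hasFDerivAt_ringInv h).pow 3).congr_fderiv ?_
  ext <;> simp <;> ring

lemma hasFDerivAt_ringInv_fst (h : 0 < ringSq a c θ p) :
    HasFDerivAt (fun q => -(q.1 - a * Real.cos θ) * ringInv a c θ q ^ 3)
      (form (-ringInv a c θ p ^ 3 + 3 * (p.1 - a * Real.cos θ) ^ 2 * ringInv a c θ p ^ 5)
        (3 * (p.1 - a * Real.cos θ) * (p.2 - c) * ringInv a c θ p ^ 5)) p := by
  have e1 : HasFDerivAt (fun p : ℝ × ℝ => p.1) (ContinuousLinearMap.fst ℝ ℝ ℝ) p := hasFDerivAt_fst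
  refine (((e1.sub_const (a * Real.cos θ)).neg).mul
    (hasFDerivAt_ringInv_pow_three h)).congr_fderiv ?_
  ext <;> simp <;> ring

lemma hasFDerivAt_ringInv_snd (h : 0 < ringSq a c θ p) :
    HasFDerivAt (fun q => -(q.2 - c) * ringInv a c θ q ^ 3)
      (form (3 * (p.1 - a * Real.cos θ) * (p.2 - c) * ringInv a c θ p ^ 5)
        (-ringInv a c θ p ^ 3 + 3 * (p.2 - c) ^ 2 * ringInv a c θ p ^ 5)) p := by
  have e2 : HasFDerivAt (fun p : ℝ × ℝ => p.2) (ContinuousLinearMap.snd ℝ ℝ ℝ) p := hasFDerivAt_snd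
  refine (((e2.sub_const c).neg).mul (hasFDerivAt_ringInv_pow_three h)).congr_fderiv ?_
  ext <;> simp <;> ring

/-- The azimuthal derivative balances the Laplacian in the meridian plane. -/
lemma ringInv_laplace (h : 0 < ringSq a c θ p) :
    -(p.1 - a * Real.cos θ) * ringInv a c θ p ^ 3
      + p.1 * ((-ringInv a c θ p ^ 3 + 3 * (p.1 - a * Real.cos θ) ^ 2 * ringInv a c θ p ^ 5)
        + (-ringInv a c θ p ^ 3 + 3 * (p.2 - c) ^ 2 * ringInv a c θ p ^ 5))
      = a * Real.cos θ * ringInv a c θ p ^ 3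
        - 3 * p.1 * a ^ 2 * Real.sin θ ^ 2 * ringInv a c θ p ^ 5 := by
  have h1 := ringInv_sq_mul h
  have h2 := Real.sin_sq_add_cos_sq θ
  unfold ringSq at h1
  generalize ringInv a c θ p = S at *
  linear_combination (3 * p.1 * S ^ 3) * h1 + (3 * p.1 * a ^ 2 * S ^ 5) * h2

/-- A primitive in θ for the right-hand side of `ringInv_laplace`. It is periodic, so that term
integrates to zero over a full turn. -/
lemma hasDerivAt_azimuth (h : 0 < ringSq a c θ p) :
    HasDerivAt (fun θ => a * Real.sin θ * ringInv a c θ p ^ 3)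
      (a * Real.cos θ * ringInv a c θ p ^ 3
        - 3 * p.1 * a ^ 2 * Real.sin θ ^ 2 * ringInv a c θ p ^ 5) θ := by
  have h1 : HasDerivAt (fun θ => ringSq a c θ p) (2 * p.1 * a * Real.sin θ) θ := by
    have := (((Real.hasDerivAt_cos θ).const_mul (2 * p.1 * a)).const_sub
      (p.1 ^ 2 + a ^ 2)).add_const ((p.2 - c) ^ 2)
    exact this.congr_deriv (by ring)
  have hs := (Real.sqrt_pos.2 h).ne'
  have h2 := (hasDerivAt_inv hs).comp θ (h1.sqrt h.ne')
  have h3 : HasDerivAt (fun θ => ringInv a c θ p) (-(p.1 * a * Real.sin θ * ringInv a c θ p ^ 3)) θ := by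
    refine h2.congr_deriv ?_
    simp only [ringInv]
    field_simp
  refine (((Real.hasDerivAt_sin θ).const_mul a).mul (h3.pow 3)).congr_deriv ?_
  simp
  ring

lemma continuousOn_ringInv (a c : ℝ) : ContinuousOn (fun x : ℝ × ℝ × ℝ => ringInv a c x.1 x.2)
    {x | 0 < ringSq a c x.1 x.2} := by
  unfold ringInv
  refine ContinuousOn.inv₀ ?_ fun x hx => (Real.sqrt_pos.2 hx).ne'
  unfold ringSq
  fun_prop

end ring

/-- Differentiation under the integral sign over a period. -/
lemma hasFDerivAt_integral_form {F A B : ℝ → ℝ × ℝ → ℝ} {U : Set (ℝ × ℝ)} (hU : IsOpen U)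
    {p : ℝ × ℝ} (hp : p ∈ U)
    (hF : ContinuousOn (fun x : ℝ × ℝ × ℝ => F x.1 x.2) (univ ×ˢ U))
    (hA : ContinuousOn (fun x : ℝ × ℝ × ℝ => A x.1 x.2) (univ ×ˢ U))
    (hB : ContinuousOn (fun x : ℝ × ℝ × ℝ => B x.1 x.2) (univ ×ˢ U))
    (hd : ∀ θ, ∀ q ∈ U, HasFDerivAt (F θ) (form (A θ q) (B θ q)) q) (T : ℝ) :
    HasFDerivAt (fun q => ∫ θ in (0 : ℝ)..T, F θ q)
      (form (∫ θ in (0 : ℝ)..T, A θ p) (∫ θ in (0 : ℝ)..T, B θ p)) p := by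
  have hslice : ∀ {H : ℝ → ℝ × ℝ → ℝ}, ContinuousOn (fun x : ℝ × ℝ × ℝ => H x.1 x.2) (univ ×ˢ U) →
      ∀ q ∈ U, Continuous fun θ => H θ q := fun {H} hH q hq => by
    have : Continuous fun θ : ℝ => (θ, q) := by fun_prop
    exact continuousOn_univ.1 (hH.comp this.continuousOn fun θ _ => ⟨mem_univ _, hq⟩)
  obtain ⟨δ, hδ, hball⟩ := Metric.nhds_basis_closedBall.mem_iff.1 (hU.mem_nhds hp)
  have hcomp : IsCompact (uIcc 0 T ×ˢ Metric.closedBall p δ) :=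
    isCompact_uIcc.prod (isCompact_closedBall _ _)
  have hsub : uIcc 0 T ×ˢ Metric.closedBall p δ ⊆ univ ×ˢ U := prod_mono (subset_univ _) hball
  obtain ⟨MA, hMA⟩ := hcomp.exists_bound_of_continuousOn (hA.mono hsub)
  obtain ⟨MB, hMB⟩ := hcomp.exists_bound_of_continuousOn (hB.mono hsub)
  have hA' := hslice hA p hp
  have hB' := hslice hB p hp
  have hform : Continuous fun θ => form (A θ p) (B θ p) := by unfold form; fun_prop
  have key := intervalIntegral.hasFDerivAt_integral_of_dominated_of_fderiv_le (μ := volume)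
    (F := fun q θ => F θ q) (F' := fun q θ => form (A θ q) (B θ q)) (x₀ := p) (a := 0) (b := T)
    (s := Metric.closedBall p δ) (bound := fun _ => MA + MB)
    (Metric.closedBall_mem_nhds p hδ) ?_ ((hslice hF p hp).intervalIntegrable _ _)
    hform.aestronglyMeasurable ?_ intervalIntegrable_const ?_
  · refine key.congr_fderiv ?_
    unfold form
    rw [intervalIntegral.integral_add, intervalIntegral.integral_smul_const,
      intervalIntegral.integral_smul_const]
    · exact (hA'.smul continuous_const).intervalIntegrable _ _
    · exact (hB'.smul continuous_const).intervalIntegrable _ _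
  · filter_upwards [hU.mem_nhds hp] with q hq
    exact (hslice hF q hq).aestronglyMeasurable
  · refine Eventually.of_forall fun θ hθ q hq => ?_
    have hθ' := uIoc_subset_uIcc hθ
    refine (norm_add_le _ _).trans (add_le_add ?_ ?_)
    · rw [norm_smul]
      exact (mul_le_of_le_one_right (norm_nonneg _)
        (ContinuousLinearMap.norm_fst_le _ _ _)).trans (hMA (θ, q) ⟨hθ', hq⟩)
    · rw [norm_smul]
      exact (mul_le_of_le_one_right (norm_nonneg _)
        (ContinuousLinearMap.norm_snd_le _ _ _)).trans (hMB (θ, q) ⟨hθ', hq⟩)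
  · exact Eventually.of_forall fun θ _ q hq => hd θ q (hball hq)

/-- The potential of a uniform ring is an axisymmetric harmonic function. -/
lemma isAxisymHarmonicAt_ring {a c : ℝ} (ha : 0 ≤ a) {p : ℝ × ℝ} (hp : 0 < p.1)
    (hne : p ≠ (a, c)) :
    IsAxisymHarmonicAt (fun q => ∫ θ in (0 : ℝ)..(2 * Real.pi), ringInv a c θ q)
      (fun q => ∫ θ in (0 : ℝ)..(2 * Real.pi), -(q.1 - a * Real.cos θ) * ringInv a c θ q ^ 3)
      (fun q => ∫ θ in (0 : ℝ)..(2 * Real.pi), -(q.2 - c) * ringInv a c θ q ^ 3) p := by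
  set U : Set (ℝ × ℝ) := {q | 0 < q.1 ∧ q ≠ (a, c)} with hUdef
  have hU : IsOpen U := (isOpen_lt continuous_const continuous_fst).inter isOpen_compl_singleton
  have hpU : p ∈ U := ⟨hp, hne⟩
  have hpos : ∀ θ, ∀ q ∈ U, 0 < ringSq a c θ q := fun θ q hq => ringSq_pos ha hq.1.le hq.2
  have hS : ContinuousOn (fun x : ℝ × ℝ × ℝ => ringInv a c x.1 x.2) (univ ×ˢ U) :=
    (continuousOn_ringInv a c).mono fun x hx => hpos x.1 x.2 hx.2
  have c1 : ContinuousOn (fun x : ℝ × ℝ × ℝ =>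
      -(x.2.1 - a * Real.cos x.1) * ringInv a c x.1 x.2 ^ 3) (univ ×ˢ U) := by fun_prop
  have c2 : ContinuousOn (fun x : ℝ × ℝ × ℝ =>
      -(x.2.2 - c) * ringInv a c x.1 x.2 ^ 3) (univ ×ˢ U) := by fun_prop
  have c11 : ContinuousOn (fun x : ℝ × ℝ × ℝ => -ringInv a c x.1 x.2 ^ 3
      + 3 * (x.2.1 - a * Real.cos x.1) ^ 2 * ringInv a c x.1 x.2 ^ 5) (univ ×ˢ U) := by fun_prop
  have c12 : ContinuousOn (fun x : ℝ × ℝ × ℝ =>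
      3 * (x.2.1 - a * Real.cos x.1) * (x.2.2 - c) * ringInv a c x.1 x.2 ^ 5) (univ ×ˢ U) := by
    fun_prop
  have c22 : ContinuousOn (fun x : ℝ × ℝ × ℝ => -ringInv a c x.1 x.2 ^ 3
      + 3 * (x.2.2 - c) ^ 2 * ringInv a c x.1 x.2 ^ 5) (univ ×ˢ U) := by fun_prop
  refine ⟨hasFDerivAt_integral_form hU hpU hS c1 c2
    (fun θ q hq => hasFDerivAt_ringInv (hpos θ q hq)) _, _, _,
    hasFDerivAt_integral_form hU hpU c1 c11 c12
      (fun θ q hq => hasFDerivAt_ringInv_fst (hpos θ q hq)) _,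
    hasFDerivAt_integral_form hU hpU c2 c12 c22
      (fun θ q hq => hasFDerivAt_ringInv_snd (hpos θ q hq)) _, ?_⟩
  have hline : Continuous fun θ : ℝ => (θ, p) := by fun_prop
  have hm : MapsTo (fun θ : ℝ => (θ, p)) univ (univ ×ˢ U) := fun θ _ => ⟨mem_univ _, hpU⟩
  have i1 := (continuousOn_univ.1 (c1.comp hline.continuousOn hm)).intervalIntegrable
    (μ := volume) 0 (2 * Real.pi)
  have i11 := (continuousOn_univ.1 (c11.comp hline.continuousOn hm)).intervalIntegrable
    (μ := volume) 0 (2 * Real.pi)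
  have i22 := (continuousOn_univ.1 (c22.comp hline.continuousOn hm)).intervalIntegrable
    (μ := volume) 0 (2 * Real.pi)
  simp only [Function.comp_def] at i1 i11 i22
  simp only [form_apply, mul_one, mul_zero, add_zero, zero_add]
  rw [← intervalIntegral.integral_add i11 i22, ← intervalIntegral.integral_const_mul,
    ← intervalIntegral.integral_add i1 ((i11.add i22).const_mul _)]
  -- The meridian operator applied to the integrand is now an exact azimuthal derivative, whose
  -- primitive contains sin θ and vanishes at 0 and 2π.
  simp only [ringInv_laplace (hpos _ p hpU)]
  rw [intervalIntegral.integral_eq_sub_of_hasDerivAt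
    (fun θ _ => hasDerivAt_azimuth (hpos θ p hpU))]
  · simp
  · have : ContinuousOn (fun x : ℝ × ℝ × ℝ => a * Real.cos x.1 * ringInv a c x.1 x.2 ^ 3
        - 3 * x.2.1 * a ^ 2 * Real.sin x.1 ^ 2 * ringInv a c x.1 x.2 ^ 5) (univ ×ˢ U) := by
      fun_prop
    exact (continuousOn_univ.1 (this.comp hline.continuousOn hm)).intervalIntegrable _ _

/-- The potential of a point charge on the axis is an axisymmetric harmonic function. -/
lemma isAxisymHarmonicAt_point {c : ℝ} {p : ℝ × ℝ} (h : 0 < ringSq 0 c 0 p) :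
    IsAxisymHarmonicAt (ringInv 0 c 0) (fun q => -q.1 * ringInv 0 c 0 q ^ 3)
      (fun q => -(q.2 - c) * ringInv 0 c 0 q ^ 3) p := by
  have h1 := hasFDerivAt_ringInv h
  have h2 := hasFDerivAt_ringInv_fst h
  have h3 := ringInv_laplace h
  simp only [zero_mul, sub_zero] at h1 h2 h3
  refine ⟨h1, _, _, h2, hasFDerivAt_ringInv_snd h, ?_⟩
  simp only [form_apply, mul_one, mul_zero, add_zero, zero_add]
  linear_combination h3

/-! ### Axisymmetric potentials -/

/-- The half-plane of azimuth `θ` as a linear map. -/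
noncomputable def cylMap (θ : ℝ) : ℝ × ℝ →L[ℝ] E3 :=
  (ContinuousLinearMap.fst ℝ ℝ ℝ).smulRight (cyl 1 θ 0)
    + (ContinuousLinearMap.snd ℝ ℝ ℝ).smulRight (cyl 0 θ 1)

@[simp] lemma cylMap_apply (θ : ℝ) (v : ℝ × ℝ) : cylMap θ v = cyl v.1 θ v.2 := by
  simp [cylMap, smul_cyl, cyl_add]

lemma hasFDerivAt_cyl (θ : ℝ) (p : ℝ × ℝ) :
    HasFDerivAt (fun p : ℝ × ℝ => cyl p.1 θ p.2) (cylMap θ) p := by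
  have e : (fun p : ℝ × ℝ => cyl p.1 θ p.2) = cylMap θ := funext fun v => (cylMap_apply θ v).symm
  rw [e]
  exact (cylMap θ).hasFDerivAt

lemma cyl_eq_sum (r θ z : ℝ) : cyl r θ z = (r * Real.cos θ) • cyl 1 0 0
    + (r * Real.sin θ) • cyl 1 (Real.pi / 2) 0 + z • cyl 0 0 1 := by
  ext i; fin_cases i <;> simp [cyl]

lemma hasDerivAt_cyl_angle (r z θ : ℝ) :
    HasDerivAt (fun θ => cyl r θ z) (cyl r (θ + Real.pi / 2) 0) θ := by
  have h : HasDerivAt (fun θ => (r * Real.cos θ) • cyl 1 0 0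
      + (r * Real.sin θ) • cyl 1 (Real.pi / 2) 0 + z • cyl 0 0 1)
      ((r * -Real.sin θ) • cyl 1 0 0 + (r * Real.cos θ) • cyl 1 (Real.pi / 2) 0) θ :=
    (((((Real.hasDerivAt_cos θ).const_mul r).smul_const _).add
      (((Real.hasDerivAt_sin θ).const_mul r).smul_const _)).add_const _)
  have e : (fun θ => cyl r θ z) = fun θ => (r * Real.cos θ) • cyl 1 0 0
      + (r * Real.sin θ) • cyl 1 (Real.pi / 2) 0 + z • cyl 0 0 1 := funext fun θ => cyl_eq_sum r θ z
  rw [e]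
  refine h.congr_deriv ?_
  rw [cyl_eq_sum r (θ + Real.pi / 2), Real.cos_add_pi_div_two, Real.sin_add_pi_div_two, zero_smul,
    add_zero]

/-- `u` is an axisymmetric function that is `C¹` up to the boundary, with gradient `g`. -/
structure IsAxisymC1 (D : AxisymDomain) (u : E3 → ℝ) (g : E3 → E3) : Prop where
  cont : ContinuousOn u (closure D.Ω)
  grad : ∀ x ∈ D.Ω, HasGradientAt u (g x) x
  grad_cont : ContinuousOn g (closure D.Ω)
  axi : ∀ r θ z, cyl r 0 z ∈ closure D.Ω → u (cyl r θ z) = u (cyl r 0 z)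

namespace AxisymDomain

variable (D : AxisymDomain)

/-- A nearby point of Ω is rotated to azimuth 0 and, as Ω is open, pushed off the axis; dropping the
azimuths does not increase distances. Identities proved in the open section thus extend by
continuity to the curve and the axis. -/
lemma mem_closure_inner {r θ z : ℝ} (hr : 0 ≤ r) (h : cyl r θ z ∈ closure D.Ω) :
    (r, z) ∈ closure D.inner := by
  rw [← closure_closure]
  refine Metric.mem_closure_iff.2 fun ε hε => ?_
  obtain ⟨x, hx, hd⟩ := Metric.mem_closure_iff.1 h ε hε
  obtain ⟨r', θ', z', hr', rfl⟩ := exists_cyl x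
  refine ⟨(r', z'), ?_, lt_of_le_of_lt ?_ hd⟩
  · have h0 := D.rotation r' θ' 0 z' hx
    have hlim : Tendsto (fun k : ℝ => (r' + k, z')) (𝓝[>] 0) (𝓝 (r', z')) := by
      have : Tendsto (fun k : ℝ => (r' + k, z')) (𝓝 0) (𝓝 (r' + 0, z')) :=
        (by fun_prop : Continuous fun k : ℝ => (r' + k, z')).tendsto 0
      rw [add_zero] at this
      exact this.mono_left nhdsWithin_le_nhds
    refine mem_closure_of_tendsto hlim ?_
    filter_upwards [self_mem_nhdsWithin,
      hlim.eventually ((D.isOpen.preimage continuous_cyl_zero).mem_nhds h0)] with k hk hk'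
    exact ⟨by rw [mem_Ioi] at hk; simp only; linarith, hk'⟩
  · rw [dist_eq_norm, dist_eq_norm, Prod.norm_def]
    have hsq : ‖cyl r θ z - cyl r' θ' z'‖ ^ 2
        = r ^ 2 + r' ^ 2 - 2 * r * r' * Real.cos (θ - θ') + (z - z') ^ 2 := by
      rw [norm_sub_sq_real, inner_cyl, norm_cyl_sq, norm_cyl_sq]; ring
    have hc := mul_nonneg (mul_nonneg hr hr') (sub_nonneg.2 (Real.cos_le_one (θ - θ')))
    refine max_le (abs_le_of_sq_le_sq ?_ (norm_nonneg _)) (abs_le_of_sq_le_sq ?_ (norm_nonneg _))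
    · rw [hsq]; simp only [Prod.fst_sub]; nlinarith [sq_nonneg (z - z')]
    · rw [hsq]; simp only [Prod.snd_sub]; nlinarith [sq_nonneg (r - r')]

lemma section_subset_closure_inner : D.section' ⊆ closure D.inner := fun _ hp =>
  D.mem_closure_inner hp.1 hp.2

lemma cyl_mem_closure {p : ℝ × ℝ} (hp : p ∈ D.section') (θ : ℝ) :
    cyl p.1 θ p.2 ∈ closure D.Ω := by
  have hc : Continuous fun p : ℝ × ℝ => cyl p.1 θ p.2 :=
    continuous_cyl.comp (by fun_prop : Continuous fun p : ℝ × ℝ => (p.1, θ, p.2))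
  exact map_mem_closure (f := fun p : ℝ × ℝ => cyl p.1 θ p.2) hc (D.section_subset_closure_inner hp)
    fun q hq => D.rotation _ _ _ _ hq.2

end AxisymDomain

namespace IsAxisymC1

variable {D : AxisymDomain} {φ v : E3 → ℝ} {gradφ g : E3 → E3}

lemma sub (h : IsAxisymC1 D φ gradφ) (hv : IsAxisymC1 D v g) :
    IsAxisymC1 D (fun x => φ x - v x) (fun x => gradφ x - g x) where
  cont := h.cont.sub hv.cont
  grad x hx := by
    have := (h.grad x hx).hasFDerivAt.sub (hv.grad x hx).hasFDerivAt
    rw [hasGradientAt_iff_hasFDerivAt, map_sub]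
    exact this
  grad_cont := h.grad_cont.sub hv.grad_cont
  axi r θ z hp := by rw [h.axi r θ z hp, hv.axi r θ z hp]

/-- Both sides are derivatives of φ along corresponding lines in the half-planes of azimuth θ and 0,
on which φ takes the same values. -/
lemma inner_cyl_eq_of_mem (h : IsAxisymC1 D φ gradφ) {r z : ℝ} (hp : cyl r 0 z ∈ D.Ω)
    (θ a b : ℝ) :
    ⟪gradφ (cyl r θ z), cyl a θ b⟫ = ⟪gradφ (cyl r 0 z), cyl a 0 b⟫ := by
  have hder : ∀ θ : ℝ, HasDerivAt (fun s : ℝ => φ (cyl (r + s * a) θ (z + s * b)))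
      ⟪gradφ (cyl r θ z), cyl a θ b⟫ 0 := fun θ => by
    have h1 : HasDerivAt (fun s : ℝ => cyl r θ z + s • cyl a θ b) (cyl a θ b) 0 := by
      simpa using (((hasDerivAt_id (0 : ℝ)).smul_const (cyl a θ b)).const_add (cyl r θ z))
    have h2 := (h.grad _ (D.rotation _ _ θ _ hp)).hasFDerivAt
    have h3 : HasFDerivAt φ (InnerProductSpace.toDual ℝ E3 (gradφ (cyl r θ z)))
        (cyl r θ z + (0 : ℝ) • cyl a θ b) := by simpa using h2
    have h4 := h3.comp_hasDerivAt 0 h1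
    simpa [Function.comp_def, smul_cyl, cyl_add] using h4
  have hev : (fun s : ℝ => φ (cyl (r + s * a) θ (z + s * b)))
      =ᶠ[𝓝 0] fun s : ℝ => φ (cyl (r + s * a) 0 (z + s * b)) := by
    have hc : Continuous fun s : ℝ => cyl (r + s * a) 0 (z + s * b) :=
      continuous_cyl.comp (by fun_prop : Continuous fun s : ℝ => (r + s * a, (0 : ℝ), z + s * b))
    filter_upwards [hc.continuousAt.eventually (D.isOpen.mem_nhds (by simpa using hp))] with s hs
    exact h.axi _ _ _ (subset_closure hs)
  exact ((hder θ).congr_of_eventuallyEq hev.symm).unique (hder 0)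

/-- The gradient is equivariant under rotations about the axis. -/
lemma inner_cyl_eq (h : IsAxisymC1 D φ gradφ) {p : ℝ × ℝ} (hp : p ∈ D.section')
    (θ a b : ℝ) :
    ⟪gradφ (cyl p.1 θ p.2), cyl a θ b⟫ = ⟪gradφ (cyl p.1 0 p.2), cyl a 0 b⟫ := by
  have hcont : ∀ θ : ℝ, ContinuousOn (fun p : ℝ × ℝ => ⟪gradφ (cyl p.1 θ p.2), cyl a θ b⟫)
      D.section' := fun θ => by
    have hc : Continuous fun p : ℝ × ℝ => cyl p.1 θ p.2 :=
      continuous_cyl.comp (by fun_prop : Continuous fun p : ℝ × ℝ => (p.1, θ, p.2))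
    exact (h.grad_cont.comp hc.continuousOn fun q hq => D.cyl_mem_closure hq θ).inner
      continuousOn_const
  have hne : (𝓝[D.inner] p).NeBot :=
    mem_closure_iff_nhdsWithin_neBot.1 (D.section_subset_closure_inner hp)
  have t1 := (hcont θ p hp).mono_left (nhdsWithin_mono p D.inner_subset_section)
  have t2 := (hcont 0 p hp).mono_left (nhdsWithin_mono p D.inner_subset_section)
  refine tendsto_nhds_unique (t1.congr' ?_) t2
  filter_upwards [self_mem_nhdsWithin] with q hq
  exact h.inner_cyl_eq_of_mem hq.2 θ a b

lemma fderiv_apply (h : IsAxisymC1 D φ gradφ) {x : E3} (hx : x ∈ D.Ω) (v : E3) :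
    fderiv ℝ φ x v = ⟪gradφ x, v⟫ := by
  rw [(h.grad x hx).hasFDerivAt.fderiv, InnerProductSpace.toDual_apply_apply]

lemma hasFDerivAt_fderiv (harm : InnerProductSpace.HarmonicOnNhd φ D.Ω) {x : E3} (hx : x ∈ D.Ω) :
    HasFDerivAt (fderiv ℝ φ) (fderiv ℝ (fderiv ℝ φ) x) x :=
  ((((harm x hx).1.fderiv_right (m := 1) (by norm_num)).differentiableAt
    one_ne_zero)).hasFDerivAt

/-- The standard basis is written as the radial, azimuthal and axial directions at azimuth 0, to
match the derivatives computed in cylindrical coordinates. -/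
lemma laplacian_eq_zero (harm : InnerProductSpace.HarmonicOnNhd φ D.Ω) {x : E3} (hx : x ∈ D.Ω) :
    fderiv ℝ (fderiv ℝ φ) x (cyl 1 0 0) (cyl 1 0 0)
      + fderiv ℝ (fderiv ℝ φ) x (cyl 1 (Real.pi / 2) 0) (cyl 1 (Real.pi / 2) 0)
      + fderiv ℝ (fderiv ℝ φ) x (cyl 0 0 1) (cyl 0 0 1) = 0 := by
  have h1 := (harm x hx).2.eq_of_nhds
  rw [InnerProductSpace.laplacian_eq_iteratedFDeriv_orthonormalBasis φ
    (EuclideanSpace.basisFun (Fin 3) ℝ)] at h1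
  have e0 : (EuclideanSpace.single 0 1 : E3) = cyl 1 0 0 := by
    ext i; fin_cases i <;> simp [cyl]
  have e1 : (EuclideanSpace.single 1 1 : E3) = cyl 1 (Real.pi / 2) 0 := by
    ext i; fin_cases i <;> simp [cyl]
  have e2 : (EuclideanSpace.single 2 1 : E3) = cyl 0 0 1 := by
    ext i; fin_cases i <;> simp [cyl]
  simpa [Fin.sum_univ_three, iteratedFDeriv_two_apply, e0, e1, e2] using h1

/-- The derivative in the azimuthal direction vanishes. -/
lemma fderiv_azimuth (h : IsAxisymC1 D φ gradφ) {p : ℝ × ℝ} (hp : p ∈ D.inner) (θ : ℝ) :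
    fderiv ℝ φ (cyl p.1 θ p.2) (cyl 1 (θ + Real.pi / 2) 0) = 0 := by
  have hΩ := D.rotation _ _ θ _ hp.2
  have h0 : HasFDerivAt φ (fderiv ℝ φ (cyl p.1 θ p.2)) (cyl p.1 θ p.2) :=
    (h.grad _ hΩ).hasFDerivAt.differentiableAt.hasFDerivAt
  have h1 : HasDerivAt (fun θ => φ (cyl p.1 θ p.2))
      (fderiv ℝ φ (cyl p.1 θ p.2) (cyl p.1 (θ + Real.pi / 2) 0)) θ :=
    HasFDerivAt.comp_hasDerivAt (f := fun θ => cyl p.1 θ p.2) θ h0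
      (hasDerivAt_cyl_angle p.1 p.2 θ)
  have h2 : (fun θ => φ (cyl p.1 θ p.2)) = fun _ => φ (cyl p.1 0 p.2) :=
    funext fun θ => h.axi _ _ _ (subset_closure hp.2)
  rw [h2] at h1
  have h3 := h1.unique (hasDerivAt_const θ _)
  have e : cyl p.1 (θ + Real.pi / 2) 0 = p.1 • cyl 1 (θ + Real.pi / 2) 0 := by
    rw [smul_cyl, mul_one, mul_zero]
  rw [e, map_smul, smul_eq_mul] at h3
  exact (mul_eq_zero.1 h3).resolve_left hp.1.ne'

/-- The second derivative in the azimuthal direction. -/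
lemma fderiv_fderiv_azimuth (h : IsAxisymC1 D φ gradφ)
    (harm : InnerProductSpace.HarmonicOnNhd φ D.Ω) {p : ℝ × ℝ} (hp : p ∈ D.inner) :
    p.1 * fderiv ℝ (fderiv ℝ φ) (cyl p.1 0 p.2) (cyl 1 (Real.pi / 2) 0) (cyl 1 (Real.pi / 2) 0)
      = ⟪gradφ (cyl p.1 0 p.2), cyl 1 0 0⟫ := by
  have hH := hasFDerivAt_fderiv harm hp.2
  -- The vanishing azimuthal derivative is differentiated once more in θ. The azimuthal unit vector
  -- turns into minus the radial one, which produces the first-order term (1/r) ∂ᵣφ of the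
  -- Laplacian.
  have hc : HasDerivAt (fun θ => cyl 1 (θ + Real.pi / 2) 0)
      (cyl 1 (0 + Real.pi / 2 + Real.pi / 2) 0) 0 :=
    (hasDerivAt_cyl_angle 1 0 (0 + Real.pi / 2)).comp_add_const 0 (Real.pi / 2)
  have hF : HasDerivAt (fun θ => fderiv ℝ φ (cyl p.1 θ p.2))
      (fderiv ℝ (fderiv ℝ φ) (cyl p.1 0 p.2) (cyl p.1 (0 + Real.pi / 2) 0)) 0 :=
    HasFDerivAt.comp_hasDerivAt (f := fun θ => cyl p.1 θ p.2) 0 hH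
      (hasDerivAt_cyl_angle p.1 p.2 0)
  have h1 := hF.clm_apply hc
  have h2 : (fun θ => fderiv ℝ φ (cyl p.1 θ p.2) (cyl 1 (θ + Real.pi / 2) 0))
      = fun _ => (0 : ℝ) := funext fun θ => h.fderiv_azimuth hp θ
  rw [h2] at h1
  have h3 := h1.unique (hasDerivAt_const 0 _)
  have e1 : cyl p.1 (0 + Real.pi / 2) 0 = p.1 • cyl 1 (Real.pi / 2) 0 := by
    rw [smul_cyl, mul_one, mul_zero, zero_add]
  have e2 : cyl 1 (0 + Real.pi / 2 + Real.pi / 2) 0 = -cyl 1 0 0 := by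
    ext i; fin_cases i <;> simp [cyl]
  rw [e1, e2, zero_add, map_neg, map_smul, FunLike.coe_smul, Pi.smul_apply, smul_eq_mul,
    h.fderiv_apply hp.2] at h3
  linarith

lemma hasFDerivAt_inner_gradient (h : IsAxisymC1 D φ gradφ)
    (harm : InnerProductSpace.HarmonicOnNhd φ D.Ω) {p : ℝ × ℝ}
    (hp : p ∈ D.inner) (v : E3) :
    HasFDerivAt (fun q : ℝ × ℝ => ⟪gradφ (cyl q.1 0 q.2), v⟫)
      (((ContinuousLinearMap.apply ℝ ℝ v).comp
        (fderiv ℝ (fderiv ℝ φ) (cyl p.1 0 p.2))).comp (cylMap 0)) p := by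
  have hev : (fun q : ℝ × ℝ => ⟪gradφ (cyl q.1 0 q.2), v⟫)
      =ᶠ[𝓝 p] fun q => fderiv ℝ φ (cyl q.1 0 q.2) v := by
    filter_upwards [D.isOpen_inner.mem_nhds hp] with q hq
    rw [h.fderiv_apply hq.2]
  refine HasFDerivAt.congr_of_eventuallyEq ?_ hev
  have h1 : HasFDerivAt (fun q : ℝ × ℝ => fderiv ℝ φ (cyl q.1 0 q.2))
      ((fderiv ℝ (fderiv ℝ φ) (cyl p.1 0 p.2)).comp (cylMap 0)) p :=
    HasFDerivAt.comp (f := fun q : ℝ × ℝ => cyl q.1 0 q.2) p (hasFDerivAt_fderiv harm hp.2)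
      (hasFDerivAt_cyl 0 p)
  exact (ContinuousLinearMap.apply ℝ ℝ v).hasFDerivAt.comp p h1

/-- An axisymmetric harmonic function satisfies Laplace's equation in cylindrical coordinates. -/
lemma isAxisymHarmonicAt (h : IsAxisymC1 D φ gradφ)
    (harm : InnerProductSpace.HarmonicOnNhd φ D.Ω) {p : ℝ × ℝ} (hp : p ∈ D.inner) :
    IsAxisymHarmonicAt (fun q => φ (cyl q.1 0 q.2))
      (fun q => ⟪gradφ (cyl q.1 0 q.2), cyl 1 0 0⟫)
      (fun q => ⟪gradφ (cyl q.1 0 q.2), cyl 0 0 1⟫) p := by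
  refine ⟨?_, _, _, h.hasFDerivAt_inner_gradient harm hp _, h.hasFDerivAt_inner_gradient harm hp _, ?_⟩
  · have h1 : HasFDerivAt (fun q : ℝ × ℝ => φ (cyl q.1 0 q.2)) _ p :=
      HasFDerivAt.comp (f := fun q : ℝ × ℝ => cyl q.1 0 q.2) p (h.grad _ hp.2).hasFDerivAt
        (hasFDerivAt_cyl 0 p)
    refine h1.congr_fderiv ?_
    ext <;> simp [form]
  · have h1 := laplacian_eq_zero harm hp.2
    have h2 := h.fderiv_fderiv_azimuth harm hp
    simp only [ContinuousLinearMap.comp_apply, cylMap_apply, ContinuousLinearMap.apply_apply]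
    linear_combination p.1 * h1 - h2

end IsAxisymC1
/-! ### The auxiliary function -/

lemma hasGradientAt_auxPsi (φ₀ q₀ : ℝ) (x₀ n₀ xD : E3) {x : E3} (hx : x ≠ xD) :
    HasGradientAt (auxPsi φ₀ q₀ x₀ n₀ xD)
      ((q₀ * (‖x₀ - xD‖ ^ 3 / ⟪n₀, x₀ - xD⟫) / ‖x - xD‖ ^ 3) • (x - xD)) x := by
  have h := (hasGradientAt_inv_norm_sub xD hx).hasFDerivAt
  have h2 := (((h.const_mul ‖x₀ - xD‖).const_sub 1).const_mul
    (q₀ * (‖x₀ - xD‖ ^ 2 / ⟪n₀, x₀ - xD⟫))).const_add φ₀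
  rw [hasGradientAt_iff_hasFDerivAt]
  have e : auxPsi φ₀ q₀ x₀ n₀ xD = fun x => φ₀ + q₀ * (‖x₀ - xD‖ ^ 2 / ⟪n₀, x₀ - xD⟫)
      * (1 - ‖x₀ - xD‖ * (1 / ‖x - xD‖)) := by
    funext y
    rw [auxPsi, mul_one_div]
  rw [e]
  refine h2.congr_fderiv ?_
  ext v
  simp
  ring

lemma gradient_auxPsi (φ₀ q₀ : ℝ) (x₀ n₀ xD : E3) {x : E3} (hx : x ≠ xD) :
    ∇ (auxPsi φ₀ q₀ x₀ n₀ xD) x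
      = (q₀ * (‖x₀ - xD‖ ^ 3 / ⟪n₀, x₀ - xD⟫) / ‖x - xD‖ ^ 3) • (x - xD) :=
  (hasGradientAt_auxPsi φ₀ q₀ x₀ n₀ xD hx).gradient

lemma norm_cyl_sub_axis (r θ z zD : ℝ) : ‖cyl r θ z - cyl 0 0 zD‖ = rho zD r z := by
  rw [cyl_sub_axis, norm_cyl, rho]

lemma inner_cyl_sub_axis (r θ z zD nr nz : ℝ) :
    ⟪cyl r θ z - cyl 0 0 zD, cyl nr θ nz⟫ = sVal zD r z nr nz := by
  rw [inner_cyl_sub, sVal]; ring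

lemma rho_pos_of_ne {r θ z zD : ℝ} (h : cyl r θ z ≠ cyl 0 0 zD) : 0 < rho zD r z := by
  rw [← norm_cyl_sub_axis r θ]
  exact norm_pos_iff.2 (sub_ne_zero.2 h)

lemma auxPsi_cyl (φ₀ q₀ r₀ z₀ nr₀ nz₀ zD : ℝ) {r θ z : ℝ} (h : cyl r θ z ≠ cyl 0 0 zD) :
    auxPsi φ₀ q₀ (cyl r₀ 0 z₀) (cyl nr₀ 0 nz₀) (cyl 0 0 zD) (cyl r θ z)
      = φ₀ + q₀ * ((rho zD r z - rho zD r₀ z₀) / rho zD r z)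
        * (rho zD r₀ z₀ ^ 2 / sVal zD r₀ z₀ nr₀ nz₀) := by
  have hρ := (rho_pos_of_ne h).ne'
  rw [auxPsi, real_inner_comm, inner_cyl_sub_axis, norm_cyl_sub_axis, norm_cyl_sub_axis,
    one_sub_div hρ]
  ring

lemma inner_gradient_auxPsi (φ₀ q₀ r₀ z₀ nr₀ nz₀ zD : ℝ) {r θ z : ℝ} (h : cyl r θ z ≠ cyl 0 0 zD)
    (nr nz : ℝ) :
    ⟪∇ (auxPsi φ₀ q₀ (cyl r₀ 0 z₀) (cyl nr₀ 0 nz₀) (cyl 0 0 zD)) (cyl r θ z), cyl nr θ nz⟫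
      = q₀ * (rho zD r₀ z₀ / rho zD r z) ^ 3
        * (sVal zD r z nr nz / sVal zD r₀ z₀ nr₀ nz₀) := by
  have hρ := (rho_pos_of_ne h).ne'
  rw [gradient_auxPsi _ _ _ _ _ h, real_inner_smul_left, inner_cyl_sub_axis,
    real_inner_comm, inner_cyl_sub_axis, norm_cyl_sub_axis, norm_cyl_sub_axis]
  ring

lemma isAxisymC1_auxPsi {D : AxisymDomain} {zD : ℝ} (hout : cyl 0 0 zD ∉ closure D.Ω)
    (φ₀ q₀ : ℝ) (x₀ n₀ : E3) :
    IsAxisymC1 D (auxPsi φ₀ q₀ x₀ n₀ (cyl 0 0 zD)) (∇ (auxPsi φ₀ q₀ x₀ n₀ (cyl 0 0 zD))) := by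
  have hne : ∀ x ∈ closure D.Ω, x ≠ cyl 0 0 zD := fun x hx h => hout (h ▸ hx)
  have hn : ∀ x ∈ closure D.Ω, ‖x - cyl 0 0 zD‖ ^ 3 ≠ 0 := fun x hx =>
    pow_ne_zero 3 (norm_ne_zero_iff.2 (sub_ne_zero.2 (hne x hx)))
  refine ⟨fun x hx => (hasGradientAt_auxPsi _ _ _ _ _
    (hne x hx)).hasFDerivAt.continuousAt.continuousWithinAt, fun x hx => ?_, ?_, fun r θ z hx => ?_⟩
  · rw [gradient_auxPsi _ _ _ _ _ (hne x (subset_closure hx))]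
    exact hasGradientAt_auxPsi _ _ _ _ _ (hne x (subset_closure hx))
  · refine ContinuousOn.congr (f := fun x => (q₀ * (‖x₀ - cyl 0 0 zD‖ ^ 3 / ⟪n₀, x₀ - cyl 0 0 zD⟫)
      / ‖x - cyl 0 0 zD‖ ^ 3) • (x - cyl 0 0 zD)) ?_
      fun x hx => gradient_auxPsi _ _ _ _ _ (hne x hx)
    exact (continuousOn_const.div (by fun_prop) hn).smul (by fun_prop)
  · simp only [auxPsi, norm_cyl_sub_axis]

/-- ψ is an affine function of the potential of a point charge on the axis, so
`isAxisymHarmonicAt_point` applies. -/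
lemma isAxisymHarmonicAt_auxPsi {D : AxisymDomain} {zD : ℝ} (hout : cyl 0 0 zD ∉ closure D.Ω)
    (φ₀ q₀ : ℝ) (x₀ n₀ : E3) {p : ℝ × ℝ} (hp : p ∈ D.inner) :
    IsAxisymHarmonicAt (fun q => auxPsi φ₀ q₀ x₀ n₀ (cyl 0 0 zD) (cyl q.1 0 q.2))
      (fun q => ⟪∇ (auxPsi φ₀ q₀ x₀ n₀ (cyl 0 0 zD)) (cyl q.1 0 q.2), cyl 1 0 0⟫)
      (fun q => ⟪∇ (auxPsi φ₀ q₀ x₀ n₀ (cyl 0 0 zD)) (cyl q.1 0 q.2), cyl 0 0 1⟫) p := by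
  have hne : ∀ q ∈ D.inner, cyl q.1 0 q.2 ≠ cyl 0 0 zD := fun q hq h =>
    hout (h ▸ subset_closure hq.2)
  have hpos : 0 < ringSq 0 zD 0 p := by
    rw [ringSq_eq]
    exact pow_pos (norm_pos_iff.2 (sub_ne_zero.2 (hne p hp))) 2
  set k := q₀ * (‖x₀ - cyl 0 0 zD‖ ^ 2 / ⟪n₀, x₀ - cyl 0 0 zD⟫) with hk
  set L := ‖x₀ - cyl 0 0 zD‖ with hL
  refine ((isAxisymHarmonicAt_point hpos).const_add_mul (φ₀ + k) (-(k * L))).congr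
    (Eventually.of_forall fun q => ?_) ?_ ?_
  · simp only [auxPsi, ringInv_eq]; rw [← hk, ← hL]; ring
  · filter_upwards [D.isOpen_inner.mem_nhds hp] with q hq
    simp only [gradient_auxPsi _ _ _ _ _ (hne q hq), ringInv_eq, real_inner_smul_left, inner_cyl_sub,
      ← hL]
    rw [hk]; ring
  · filter_upwards [D.isOpen_inner.mem_nhds hp] with q hq
    simp only [gradient_auxPsi _ _ _ _ _ (hne q hq), ringInv_eq, real_inner_smul_left, inner_cyl_sub,
      ← hL]
    rw [hk]; ring

/-! ### Lipschitz estimate at the node -/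

namespace MeridianArc

lemma exists_norm_tubeDeriv_le (γ : MeridianArc) (w : ℝ × ℝ) :
    ∃ M, 0 ≤ M ∧ ∀ q : ℝ × ℝ, q.1 ∈ Icc (0 : ℝ) 1 → ‖γ.tubeDeriv w q‖ ≤ M := by
  obtain ⟨A, hA⟩ := (isCompact_Icc (a := (0 : ℝ)) (b := 1)).exists_bound_of_continuousOn
    γ.continuous_deriv_r.continuousOn
  obtain ⟨B, hB⟩ := (isCompact_Icc (a := (0 : ℝ)) (b := 1)).exists_bound_of_continuousOn
    γ.continuous_deriv_z.continuousOn
  have hA0 : 0 ≤ A := (norm_nonneg _).trans (hA 0 ⟨le_rfl, zero_le_one⟩)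
  have hB0 : 0 ≤ B := (norm_nonneg _).trans (hB 0 ⟨le_rfl, zero_le_one⟩)
  have hM : 0 ≤ A + B + ‖w.1‖ + ‖w.2‖ := by positivity
  refine ⟨A + B + ‖w.1‖ + ‖w.2‖, hM, fun q hq => ContinuousLinearMap.opNorm_le_bound _ hM fun v => ?_⟩
  have h1 := norm_fst_le v
  have h2 := norm_snd_le v
  have hv := norm_nonneg v
  rw [tubeDeriv_apply, Prod.norm_def]
  have hw1 := mul_nonneg (norm_nonneg w.1) hv
  have hw2 := mul_nonneg (norm_nonneg w.2) hv
  have hAv := mul_nonneg hA0 hv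
  have hBv := mul_nonneg hB0 hv
  refine max_le ((norm_sub_le _ _).trans ?_) ((norm_sub_le _ _).trans ?_)
  · rw [norm_mul, norm_mul]
    have e1 := mul_le_mul (hA _ hq) h1 (norm_nonneg _) hA0
    have e2 := mul_le_mul_of_nonneg_left h2 (norm_nonneg w.1)
    linarith
  · rw [norm_mul, norm_mul]
    have e1 := mul_le_mul (hB _ hq) h1 (norm_nonneg _) hB0
    have e2 := mul_le_mul_of_nonneg_left h2 (norm_nonneg w.2)
    linarith

end MeridianArc

namespace AxisymDomain

variable {D : AxisymDomain}

lemma isCompact_closure (D : AxisymDomain) : IsCompact (closure D.Ω) :=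
  Metric.isCompact_of_isClosed_isBounded isClosed_closure D.bounded.closure

lemma pt_ne_of_mem_inner {p : ℝ × ℝ} (hp : p ∈ D.inner) {j : Fin D.N} {t : ℝ}
    (ht : t ∈ Icc (0 : ℝ) 1) : (D.arc j).pt t ≠ p := fun h =>
  D.notMem_of_frontier ((D.cyl_mem_frontier_iff hp.1.le).2 ⟨j, t, ht, h⟩) hp.2

end AxisymDomain

namespace IsAxisymC1

variable {D : AxisymDomain} {u : E3 → ℝ} {g : E3 → E3}

lemma continuousOn_section (h : IsAxisymC1 D u g) :
    ContinuousOn (fun p : ℝ × ℝ => u (cyl p.1 0 p.2)) D.section' :=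
  h.cont.comp AxisymDomain.continuous_cyl_zero.continuousOn fun _ hp => hp.2

/-- On a side of a tubular neighbourhood that lies in the domain, `u` is Lipschitz in the tubular
coordinates. -/
lemma exists_lipschitz_tube (h : IsAxisymC1 D u g) (γ : MeridianArc) (w : ℝ × ℝ) :
    ∃ K, 0 ≤ K ∧ ∀ S : Set (ℝ × ℝ), Convex ℝ S → (∀ q ∈ S, q.1 ∈ Icc (0 : ℝ) 1) →
      (∀ q ∈ S, cyl (γ.tube w q).1 0 (γ.tube w q).2 ∈ D.Ω) → ∀ q ∈ S, ∀ q' ∈ S,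
        |u (cyl (γ.tube w q).1 0 (γ.tube w q).2) - u (cyl (γ.tube w q').1 0 (γ.tube w q').2)|
          ≤ K * dist q q' := by
  obtain ⟨M, hM0, hM⟩ := γ.exists_norm_tubeDeriv_le w
  obtain ⟨B, hB⟩ := D.isCompact_closure.exists_bound_of_continuousOn h.grad_cont
  refine ⟨|B| * (‖cylMap 0‖ * M), by positivity, fun S hS h01 hΩ q hq q' hq' => ?_⟩
  have hd : ∀ q ∈ S, HasFDerivWithinAt (fun q => u (cyl (γ.tube w q).1 0 (γ.tube w q).2))
      ((InnerProductSpace.toDual ℝ E3 (g (cyl (γ.tube w q).1 0 (γ.tube w q).2))).comp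
        ((cylMap 0).comp (γ.tubeDeriv w q))) S q := fun q hq => by
    have h1 : HasFDerivAt (fun q => cyl (γ.tube w q).1 0 (γ.tube w q).2)
        ((cylMap 0).comp (γ.tubeDeriv w q)) q :=
      HasFDerivAt.comp (f := γ.tube w) q (hasFDerivAt_cyl 0 (γ.tube w q)) (γ.hasFDerivAt_tube w q)
    exact (HasFDerivAt.comp (f := fun q => cyl (γ.tube w q).1 0 (γ.tube w q).2) q
      (h.grad _ (hΩ q hq)).hasFDerivAt h1).hasFDerivWithinAt
  rw [dist_eq_norm]
  refine hS.norm_image_sub_le_of_norm_hasFDerivWithin_le hd (fun q hq => ?_) hq' hq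
  refine (ContinuousLinearMap.opNorm_comp_le _ _).trans (mul_le_mul ?_
    ((ContinuousLinearMap.opNorm_comp_le _ _).trans
      (mul_le_mul_of_nonneg_left (hM q (h01 q hq)) (norm_nonneg _))) (norm_nonneg _) (abs_nonneg _))
  rw [LinearIsometryEquiv.norm_map]
  exact (hB _ (subset_closure (hΩ q hq))).trans (le_abs_self B)

/-- The straight segment from `p` to the node may leave Ω, but the part of the tube on the side of
`p` is a convex box in tubular coordinates and lies in Ω. The Lipschitz bound there is applied
between `p` and points tending to the node, with tubular coordinates of `p` at most a multiple of
its distance. -/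
lemma exists_le_mul_dist_near (h : IsAxisymC1 D u g) {i : Fin D.N} {t₀ : ℝ} (hn : D.IsNode i t₀)
    (h0 : u (cyl ((D.arc i).r t₀) 0 ((D.arc i).z t₀)) = 0) :
    ∃ ρ > 0, ∃ K, 0 ≤ K ∧ ∀ p ∈ D.inner, dist p ((D.arc i).pt t₀) < ρ →
      |u (cyl p.1 0 p.2)| ≤ K * dist p ((D.arc i).pt t₀) := by
  set γ := D.arc i with hγ
  set w := γ.conormal t₀
  obtain ⟨δ, hδ, b, hb, ρ, hρ, C, hC, -, -, -, hside, hcov⟩ := hn.exists_tube one_pos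
  obtain ⟨K, hK0, hK⟩ := h.exists_lipschitz_tube γ w
  refine ⟨ρ, hρ, K * C, by positivity, fun p hp hd => ?_⟩
  obtain ⟨t, ⟨htδ, ht⟩, s, hs, hpt, h1, h2⟩ := hcov p hp.1.le hd
  have hs0 : s ≠ 0 := by
    rintro rfl
    rw [γ.tube_zero] at hpt
    exact D.pt_ne_of_mem_inner hp ht hpt
  -- `outward` speaks of interior points of arcs only, so at an end point on the axis the side of Ω
  -- is not prescribed. The sign σ selects the side on which `p` lies.
  have hsign : ∃ σ : ℝ, 0 < σ * s ∧ |σ| = 1 := by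
    rcases lt_or_gt_of_ne hs0 with hs | hs
    · exact ⟨-1, by linarith, by simp⟩
    · exact ⟨1, by linarith, by simp⟩
  obtain ⟨σ, hσ, hσ1⟩ := hsign
  set S : Set (ℝ × ℝ) := (Icc (t₀ - δ) (t₀ + δ) ∩ Icc 0 1) ×ˢ {x | 0 < σ * x ∧ |x| ≤ b} with hSdef
  have hconv : Convex ℝ {x : ℝ | 0 < σ * x ∧ |x| ≤ b} := by
    have e : {x : ℝ | 0 < σ * x ∧ |x| ≤ b} = {x | 0 < σ * x} ∩ Icc (-b) b := by
      ext x; simp [abs_le]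
    rw [e]
    refine Convex.inter ?_ (convex_Icc _ _)
    exact convex_halfSpace_gt (f := fun x => σ * x)
      ⟨fun x y => mul_add _ _ _, fun c x => by simp [mul_left_comm]⟩ 0
  have hS : Convex ℝ S := ((convex_Icc _ _).inter (convex_Icc _ _)).prod hconv
  have hqS : (t, s) ∈ S := ⟨⟨Ioo_subset_Icc_self htδ, ht⟩, hσ, hs.le⟩
  have hΩ : ∀ q ∈ S, cyl (γ.tube w q).1 0 (γ.tube w q).2 ∈ D.Ω := fun q hq => by
    refine D.mem_of_isPreconnected (s := γ.tube w '' S) ?_ ?_ ?_ ⟨(t, s), hqS, hpt⟩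
      (subset_closure hp.2) _ ⟨q, hq, rfl⟩
    · exact hS.isPreconnected.image _ (γ.continuous_tube w).continuousOn
    · rintro _ ⟨q, hq, rfl⟩
      exact (hside q.1 hq.1 q.2 hq.2.2).1
    · rintro _ ⟨q, hq, rfl⟩ j t' ht'
      refine (hside q.1 hq.1 q.2 hq.2.2).2.2.2 ?_ j t' ht'
      intro h
      have := hq.2.1
      rw [h, mul_zero] at this
      exact lt_irrefl _ this
  have ht₀ := hn.mem_Icc
  have hq' : ∀ᶠ x in 𝓝[>] (0 : ℝ), (t₀, σ * x) ∈ S := by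
    filter_upwards [Ioc_mem_nhdsGT hb] with x hx
    have hσσ : σ * σ = 1 := by rw [← abs_mul_abs_self, hσ1, mul_one]
    refine ⟨⟨⟨by linarith, by linarith⟩, ht₀⟩, ?_, ?_⟩
    · rw [← mul_assoc, hσσ, one_mul]; exact hx.1
    · rw [abs_mul, hσ1, one_mul, abs_of_pos hx.1]; exact hx.2
  have hle : ∀ᶠ x in 𝓝[>] (0 : ℝ),
      |u (cyl p.1 0 p.2) - u (cyl (γ.tube w (t₀, σ * x)).1 0 (γ.tube w (t₀, σ * x)).2)|
        ≤ K * dist (t, s) (t₀, σ * x) := by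
    filter_upwards [hq'] with x hx
    have := hK S hS (fun q hq => hq.1.2) hΩ _ hqS _ hx
    rwa [hpt] at this
  have hline : Tendsto (fun x : ℝ => γ.tube w (t₀, σ * x)) (𝓝[>] 0)
      (𝓝[D.section'] (γ.pt t₀)) := by
    refine tendsto_nhdsWithin_iff.2 ⟨?_, ?_⟩
    · have hc : Continuous fun x : ℝ => γ.tube w (t₀, σ * x) :=
        (γ.continuous_tube w).comp (by fun_prop)
      have := hc.tendsto 0
      rw [mul_zero, γ.tube_zero] at this
      exact this.mono_left nhdsWithin_le_nhds
    · filter_upwards [hq'] with x hx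
      exact ⟨(hside _ hx.1 _ hx.2.2).1, subset_closure (hΩ _ hx)⟩
  have hlim1 := (h.continuousOn_section _ (D.pt_mem_section (i := i) ht₀)).tendsto.comp hline
  have hlim2 : Tendsto (fun x : ℝ => K * dist (t, s) (t₀, σ * x)) (𝓝[>] 0)
      (𝓝 (K * dist (t, s) (t₀, (0 : ℝ)))) := by
    have hc : Continuous fun x : ℝ => K * dist (t, s) (t₀, σ * x) := by fun_prop
    have := hc.tendsto 0
    rw [mul_zero] at this
    exact this.mono_left nhdsWithin_le_nhds
  have h3 := le_of_tendsto_of_tendsto ((tendsto_const_nhds.sub hlim1).abs) hlim2 hle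
  have h4 : u (cyl (γ.pt t₀).1 0 (γ.pt t₀).2) = 0 := h0
  rw [h4, sub_zero] at h3
  refine h3.trans ?_
  rw [mul_assoc]
  refine mul_le_mul_of_nonneg_left ?_ hK0
  rw [Prod.dist_eq, Real.dist_eq, Real.dist_eq, sub_zero]
  exact max_le h1 h2

/-- A function vanishing at the node is bounded by a multiple of the distance to the node. -/
lemma exists_le_mul_dist (h : IsAxisymC1 D u g) {i : Fin D.N} {t₀ : ℝ} (hn : D.IsNode i t₀)
    (h0 : u (cyl ((D.arc i).r t₀) 0 ((D.arc i).z t₀)) = 0) :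
    ∃ K, 0 ≤ K ∧ ∀ p ∈ D.section',
      |u (cyl p.1 0 p.2)| ≤ K * dist p ((D.arc i).pt t₀) := by
  obtain ⟨ρ, hρ, K, hK0, hK⟩ := h.exists_le_mul_dist_near hn h0
  obtain ⟨M, hM⟩ := D.isCompact_section.exists_bound_of_continuousOn h.continuousOn_section
  refine ⟨K + |M| / ρ, by positivity, fun p hp => ?_⟩
  have hin : ∀ q ∈ D.inner,
      |u (cyl q.1 0 q.2)| ≤ (K + |M| / ρ) * dist q ((D.arc i).pt t₀) := fun q hq => by
    rw [add_mul]
    rcases lt_or_ge (dist q ((D.arc i).pt t₀)) ρ with hd | hd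
    · have : 0 ≤ |M| / ρ * dist q ((D.arc i).pt t₀) := by positivity
      linarith [hK q hq hd]
    · have h1 : |M| ≤ |M| / ρ * dist q ((D.arc i).pt t₀) := by
        rw [div_mul_eq_mul_div, le_div_iff₀ hρ]
        exact mul_le_mul_of_nonneg_left hd (abs_nonneg M)
      have h2 : 0 ≤ K * dist q ((D.arc i).pt t₀) := by positivity
      have h3 := (hM q (D.inner_subset_section hq)).trans (le_abs_self M)
      rw [Real.norm_eq_abs] at h3
      linarith
  have hne : (𝓝[D.inner] p).NeBot :=
    mem_closure_iff_nhdsWithin_neBot.1 (D.section_subset_closure_inner hp)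
  have t1 := ((h.continuousOn_section p hp).mono_left (nhdsWithin_mono p D.inner_subset_section)).abs
  have t2 : Tendsto (fun q => (K + |M| / ρ) * dist q ((D.arc i).pt t₀)) (𝓝[D.inner] p)
      (𝓝 ((K + |M| / ρ) * dist p ((D.arc i).pt t₀))) :=
    ((by fun_prop : Continuous fun q => (K + |M| / ρ) * dist q ((D.arc i).pt t₀)).tendsto
      p).mono_left nhdsWithin_le_nhds
  refine le_of_tendsto_of_tendsto t1 t2 ?_
  filter_upwards [self_mem_nhdsWithin] with q hq
  exact hin q hq

end IsAxisymC1

/-! ### Estimates along the meridian curve -/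

/-- The expansion is centred at `t`, where the normal is taken later, so that its linear term is
orthogonal to the normal. -/
lemma exists_taylor_le {f : ℝ → ℝ} (hf : ContDiff ℝ 2 f) :
    ∃ C, 0 ≤ C ∧ ∀ s ∈ Icc (0 : ℝ) 1, ∀ t ∈ Icc (0 : ℝ) 1,
      |deriv f t - deriv f s| ≤ C * |t - s| ∧
      |f t - f s - deriv f t * (t - s)| ≤ C * (t - s) ^ 2 := by
  have hf1 : ContDiff ℝ 1 (deriv f) := ((contDiff_succ_iff_deriv (n := 1)).1 hf).2.2
  have hd : ∀ x, HasDerivAt f (deriv f x) x := fun x =>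
    (hf.differentiable two_ne_zero x).hasDerivAt
  have hd1 : ∀ x, HasDerivAt (deriv f) (deriv (deriv f) x) x := fun x =>
    (hf1.differentiable one_ne_zero x).hasDerivAt
  obtain ⟨C, hC⟩ := (isCompact_Icc (a := (0 : ℝ)) (b := 1)).exists_bound_of_continuousOn
    (hf1.continuous_deriv le_rfl).continuousOn
  have hC0 : 0 ≤ C := (norm_nonneg _).trans (hC 0 ⟨le_rfl, zero_le_one⟩)
  have hlip : ∀ s ∈ Icc (0 : ℝ) 1, ∀ t ∈ Icc (0 : ℝ) 1, |deriv f t - deriv f s| ≤ C * |t - s| :=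
    fun s hs t ht => (convex_Icc (0 : ℝ) 1).norm_image_sub_le_of_norm_hasDerivWithin_le
      (fun x _ => (hd1 x).hasDerivWithinAt) hC hs ht
  refine ⟨C, hC0, fun s hs t ht => ⟨hlip s hs t ht, ?_⟩⟩
  have hsub : uIcc s t ⊆ Icc (0 : ℝ) 1 := uIcc_subset_Icc hs ht
  have := (convex_uIcc s t).norm_image_sub_le_of_norm_hasDerivWithin_le
    (f := fun x => f x - deriv f t * x) (f' := fun x => deriv f x - deriv f t)
    (C := C * |t - s|) (fun x _ => (((hd x).sub ((hasDerivAt_id x).const_mul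
      (deriv f t))).congr_deriv (by simp)).hasDerivWithinAt) (fun x hx => ?_)
    left_mem_uIcc right_mem_uIcc
  · rw [Real.norm_eq_abs, Real.norm_eq_abs, mul_assoc, abs_mul_abs_self] at this
    convert this using 2 <;> ring
  · refine (hlip t ht x (hsub hx)).trans (mul_le_mul_of_nonneg_left ?_ hC0)
    rw [abs_sub_comm t s]
    rcases le_total s t with h | h
    · rw [uIcc_of_le h] at hx
      rw [abs_of_nonpos (by linarith [hx.2]), abs_of_nonpos (by linarith)]
      linarith [hx.1]
    · rw [uIcc_of_ge h] at hx
      rw [abs_of_nonneg (by linarith [hx.1]), abs_of_nonneg (by linarith)]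
      linarith [hx.2]

lemma dist_le_meridianDist (a c : ℝ) (p : ℝ × ℝ) : dist p (a, c) ≤ meridianDist a c p.1 p.2 := by
  rw [Prod.dist_eq, Real.dist_eq, Real.dist_eq, meridianDist]
  refine max_le ?_ ?_
  · exact Real.abs_le_sqrt (by linarith [sq_nonneg (p.2 - c)])
  · exact Real.abs_le_sqrt (by linarith [sq_nonneg (p.1 - a)])

namespace MeridianArc

variable (γ : MeridianArc)

lemma exists_le_speed : ∃ m, 0 < m ∧ ∀ t ∈ Icc (0 : ℝ) 1, m ≤ γ.speed t := by
  obtain ⟨t, ht, hmin⟩ := (isCompact_Icc (a := (0 : ℝ)) (b := 1)).exists_isMinOn ⟨0, by simp⟩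
    γ.continuous_speed.continuousOn
  exact ⟨_, γ.speed_pos ht, fun s hs => hmin hs⟩

/-- The chord from a point of the arc is orthogonal to the normal up to second order. -/
lemma exists_abs_inner_normal_le : ∃ C, 0 ≤ C ∧ ∀ s ∈ Icc (0 : ℝ) 1, ∀ t ∈ Icc (0 : ℝ) 1,
    |(γ.r t - γ.r s) * γ.nr t + (γ.z t - γ.z s) * γ.nz t| ≤ C * (t - s) ^ 2 := by
  obtain ⟨A, hA0, hA⟩ := exists_taylor_le γ.contDiff_r
  obtain ⟨B, hB0, hB⟩ := exists_taylor_le γ.contDiff_z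
  refine ⟨A + B, by positivity, fun s hs t ht => ?_⟩
  have h1 := (hA s hs t ht).2
  have h2 := (hB s hs t ht).2
  have e : (γ.r t - γ.r s) * γ.nr t + (γ.z t - γ.z s) * γ.nz t
      = (γ.r t - γ.r s - deriv γ.r t * (t - s)) * γ.nr t
        + (γ.z t - γ.z s - deriv γ.z t * (t - s)) * γ.nz t := by
    have := (γ.speed_pos ht).ne'
    rw [nr, nz]
    field_simp
    ring
  rw [e, add_mul]
  refine (abs_add_le _ _).trans (add_le_add ?_ ?_)
  · rw [abs_mul]
    exact (mul_le_of_le_one_right (abs_nonneg _) (γ.abs_nr_le_one t)).trans h1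
  · rw [abs_mul]
    exact (mul_le_of_le_one_right (abs_nonneg _) (γ.abs_nz_le_one t)).trans h2

/-- For a node on the axis: orthogonality makes n_r vanish there, and n_r is Lipschitz on a C² arc.
This offsets 1/R̄, which is unbounded when r₀ = 0. -/
lemma exists_abs_nr_le {s : ℝ} (hs : s ∈ Icc (0 : ℝ) 1) (h0 : deriv γ.z s = 0) :
    ∃ C, 0 ≤ C ∧ ∀ t ∈ Icc (0 : ℝ) 1, |γ.nr t| ≤ C * |t - s| := by
  obtain ⟨B, hB0, hB⟩ := exists_taylor_le γ.contDiff_z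
  obtain ⟨m, hm, hm'⟩ := γ.exists_le_speed
  refine ⟨B / m, by positivity, fun t ht => ?_⟩
  have h1 := (hB s hs t ht).1
  rw [h0, sub_zero] at h1
  rw [nr, abs_div, abs_of_pos (γ.speed_pos ht), div_mul_eq_mul_div]
  exact div_le_div₀ (by positivity) h1 hm (hm' t ht)

lemma isBigO_sub_pt {t₀ : ℝ} (ht₀ : t₀ ∈ Icc (0 : ℝ) 1) :
    (fun t => t - t₀) =O[𝓝 t₀] fun t => γ.pt t - γ.pt t₀ := by
  have hd : HasDerivAt γ.pt (deriv γ.r t₀, deriv γ.z t₀) t₀ :=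
    (γ.hasDerivAt_r t₀).prodMk (γ.hasDerivAt_z t₀)
  have hne : (deriv γ.r t₀, deriv γ.z t₀) ≠ 0 := fun h => ?_
  · exact (HasDerivAtFilter.isTheta_sub hd hne).2.comp_tendsto
      (tendsto_id.prodMk (tendsto_pure.2 (Eventually.of_forall fun _ => rfl)) :
        Tendsto (fun t => (t, t₀)) (𝓝 t₀) (𝓝 t₀ ×ˢ pure t₀))
  have := γ.regular t₀ ht₀
  rw [Prod.mk_eq_zero] at h
  rw [h.1, h.2] at this
  simp at this

end MeridianArc

namespace AxisymDomain

variable {D : AxisymDomain} {i : Fin D.N} {t₀ : ℝ}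

lemma IsNode.r_nonneg (hn : D.IsNode i t₀) : 0 ≤ (D.arc i).r t₀ :=
  (D.arc i).r_nonneg t₀ hn.mem_Icc

lemma IsNode.deriv_z_eq_zero (hn : D.IsNode i t₀) (h : (D.arc i).r t₀ = 0) :
    deriv (D.arc i).z t₀ = 0 := by
  rcases hn with h' | h'
  · exact absurd h ((D.arc i).r_pos t₀ h').ne'
  · exact h'.2.2.1

lemma IsNode.pt_ne (hn : D.IsNode i t₀) {t : ℝ} (ht : t ∈ Icc (0 : ℝ) 1) (hne : t ≠ t₀) :
    (D.arc i).pt t ≠ (D.arc i).pt t₀ := fun h => hne (hn.unique ht h).2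

/-- Near `t₀` the nonzero derivative of the arc gives the bound. Away from `t₀` the distance has a
positive minimum `m`, because the arc does not return to the node, and |t - t₀| ≤ 1. -/
lemma IsNode.exists_abs_sub_le (hn : D.IsNode i t₀) :
    ∃ C, 0 < C ∧ ∀ t ∈ Icc (0 : ℝ) 1,
      |t - t₀| ≤ C * meridianDist ((D.arc i).r t₀) ((D.arc i).z t₀) ((D.arc i).r t)
        ((D.arc i).z t) := by
  set γ := D.arc i
  obtain ⟨A, hA, hO⟩ := (γ.isBigO_sub_pt hn.mem_Icc).exists_pos
  obtain ⟨ε, hε, hball⟩ := Metric.eventually_nhds_iff_ball.1 hO.bound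
  have hcomp : IsCompact (Icc (0 : ℝ) 1 \ Metric.ball t₀ ε) := isCompact_Icc.diff Metric.isOpen_ball
  have hcont : ContinuousOn (fun t => dist (γ.pt t) (γ.pt t₀)) (Icc (0 : ℝ) 1 \ Metric.ball t₀ ε) :=
    (γ.continuous_pt.dist continuous_const).continuousOn
  obtain ⟨m, hm, hm'⟩ : ∃ m, 0 < m ∧ ∀ t ∈ Icc (0 : ℝ) 1 \ Metric.ball t₀ ε,
      m ≤ dist (γ.pt t) (γ.pt t₀) := by
    rcases (Icc (0 : ℝ) 1 \ Metric.ball t₀ ε).eq_empty_or_nonempty with h | h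
    · exact ⟨1, one_pos, by simp [h]⟩
    · obtain ⟨t, ht, hmin⟩ := hcomp.exists_isMinOn h hcont
      refine ⟨_, dist_pos.2 (hn.pt_ne ht.1 fun h => ?_), fun s hs => hmin hs⟩
      rw [h] at ht
      exact ht.2 (Metric.mem_ball_self hε)
  have hle : ∀ t, dist (γ.pt t) (γ.pt t₀)
      ≤ meridianDist (γ.r t₀) (γ.z t₀) (γ.r t) (γ.z t) := fun t => dist_le_meridianDist _ _ (γ.pt t)
  refine ⟨A + 1 / m, by positivity, fun t ht => ?_⟩
  have hd := meridianDist_nonneg (γ.r t₀) (γ.z t₀) (γ.r t) (γ.z t)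
  rw [add_mul]
  by_cases h : t ∈ Metric.ball t₀ ε
  · have h1 := hball t h
    rw [Real.norm_eq_abs, ← dist_eq_norm] at h1
    have h2 := mul_le_mul_of_nonneg_left (hle t) hA.le
    have : 0 ≤ 1 / m * meridianDist (γ.r t₀) (γ.z t₀) (γ.r t) (γ.z t) := by positivity
    linarith
  · have h1 := (hm' t ⟨ht, h⟩).trans (hle t)
    have h2 : |t - t₀| ≤ 1 := by
      rw [abs_le]; constructor <;> linarith [ht.1, ht.2, hn.mem_Icc.1, hn.mem_Icc.2]
    have h3 : 1 ≤ 1 / m * meridianDist (γ.r t₀) (γ.z t₀) (γ.r t) (γ.z t) := by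
      rw [div_mul_eq_mul_div, one_mul, le_div_iff₀ hm, one_mul]; exact h1
    have : 0 ≤ A * meridianDist (γ.r t₀) (γ.z t₀) (γ.r t) (γ.z t) := by positivity
    linarith

lemma exists_Rbar_le (D : AxisymDomain) (a c : ℝ) :
    ∃ M, 0 < M ∧ ∀ p ∈ D.section', Rbar a c p.1 p.2 ≤ M := by
  have hc : Continuous fun p : ℝ × ℝ => Rbar a c p.1 p.2 :=
    continuous_Rbar.comp (by fun_prop : Continuous fun p : ℝ × ℝ => (a, c, p.1, p.2))
  obtain ⟨M, hM⟩ := D.isCompact_section.exists_bound_of_continuousOn hc.continuousOn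
  exact ⟨|M| + 1, by positivity, fun p hp =>
    (le_abs_self _).trans ((hM p hp).trans ((le_abs_self M).trans (by linarith)))⟩

/-- On the bounded meridian section the singularity of `K(m)` is weaker than `d^(-1/2)`. -/
lemma exists_ellipticK_mul_sqrt_le (D : AxisymDomain) {a : ℝ} (ha : 0 ≤ a) (c : ℝ) :
    ∃ C, 0 < C ∧ ∀ p ∈ D.section', p ≠ (a, c) →
      ellipticK (param a c p.1 p.2) * Real.sqrt (meridianDist a c p.1 p.2) ≤ C := by
  obtain ⟨A, hA, hK⟩ := exists_ellipticK_param_le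
  obtain ⟨M, hM, hR⟩ := D.exists_Rbar_le a c
  refine ⟨A * Real.sqrt M, by positivity, fun p hp hne => (hK a c p.1 p.2 ha hp.1 hne).trans ?_⟩
  exact mul_le_mul_of_nonneg_left (Real.sqrt_le_sqrt (hR p hp)) hA.le

/-- If r₀ > 0 then R̄ ≥ r₀. If r₀ = 0 then R̄ is at least the distance to the node, and n_r vanishes
to first order in it. -/
lemma IsNode.exists_abs_nr_div_Rbar_le (hn : D.IsNode i t₀) :
    ∃ C, 0 ≤ C ∧ ∀ t ∈ Icc (0 : ℝ) 1, t ≠ t₀ → |(D.arc i).nr t| /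
      Rbar ((D.arc i).r t₀) ((D.arc i).z t₀) ((D.arc i).r t) ((D.arc i).z t) ≤ C := by
  set γ := D.arc i
  have hpos : ∀ t ∈ Icc (0 : ℝ) 1, t ≠ t₀ → 0 < Rbar (γ.r t₀) (γ.z t₀) (γ.r t) (γ.z t) :=
    fun t ht hne => Rbar_pos hn.r_nonneg (γ.r_nonneg t ht) (hn.pt_ne ht hne)
  rcases hn.r_nonneg.lt_or_eq with h | h
  · refine ⟨1 / γ.r t₀, by positivity, fun t ht hne => ?_⟩
    refine div_le_div₀ zero_le_one (γ.abs_nr_le_one t) h ?_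
    refine Real.le_sqrt_of_sq_le ?_
    have := mul_nonneg (γ.r_nonneg t ht) h.le
    linarith [sq_nonneg (γ.r t), sq_nonneg (γ.z t - γ.z t₀), add_sq (γ.r t) (γ.r t₀)]
  · obtain ⟨A, hA0, hA⟩ := γ.exists_abs_nr_le hn.mem_Icc (hn.deriv_z_eq_zero h.symm)
    obtain ⟨B, hB0, hB⟩ := hn.exists_abs_sub_le
    refine ⟨A * B, by positivity, fun t ht hne => ?_⟩
    rw [div_le_iff₀ (hpos t ht hne), mul_assoc]
    refine (hA t ht).trans (mul_le_mul_of_nonneg_left ((hB t ht).trans ?_) hA0)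
    exact mul_le_mul_of_nonneg_left
      (meridianDist_le_Rbar hn.r_nonneg (γ.r_nonneg t ht)) hB0.le

/-- The kernel `kernelE` is bounded along the arc of the node. -/
lemma IsNode.exists_abs_kernelE_le (hn : D.IsNode i t₀) :
    ∃ C, 0 ≤ C ∧ ∀ t ∈ Icc (0 : ℝ) 1, t ≠ t₀ →
      |kernelE ((D.arc i).r t₀) ((D.arc i).z t₀) ((D.arc i).r t) ((D.arc i).z t)
        ((D.arc i).nr t) ((D.arc i).nz t)| ≤ C := by
  obtain ⟨A, hA0, hA⟩ := (D.arc i).exists_abs_inner_normal_le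
  obtain ⟨B, hB0, hB⟩ := hn.exists_abs_sub_le
  obtain ⟨C, hC0, hC⟩ := hn.exists_abs_nr_div_Rbar_le
  set γ := D.arc i
  refine ⟨2 * (A * B ^ 2) + C, by positivity, fun t ht hne => ?_⟩
  refine (abs_kernelE_le hn.r_nonneg (γ.r_nonneg t ht) (hn.pt_ne ht hne) _ _).trans
    (add_le_add ?_ (hC t ht hne))
  have hd := meridianDist_pos (a := γ.r t₀) (c := γ.z t₀) (hn.pt_ne ht hne)
  change 0 < meridianDist (γ.r t₀) (γ.z t₀) (γ.r t) (γ.z t) at hd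
  rw [div_le_iff₀ (by positivity), mul_assoc 2, mul_assoc A, ← mul_pow]
  refine mul_le_mul_of_nonneg_left ((hA t₀ hn.mem_Icc t ht).trans ?_) zero_le_two
  refine mul_le_mul_of_nonneg_left ?_ hA0
  rw [← sq_abs]
  exact pow_le_pow_left₀ (abs_nonneg _) (hB t ht) 2

end AxisymDomain

/-! ### Cancellation of the singularity along the meridian curve -/

namespace AxisymDomain

variable {D : AxisymDomain} {i : Fin D.N} {t₀ : ℝ}

/-- The points of the `j`-th arc other than `p`, as a set of parameters. -/
def punctured (D : AxisymDomain) (j : Fin D.N) (p : ℝ × ℝ) : Set ℝ :=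
  {t | t ∈ Icc (0 : ℝ) 1 ∧ (D.arc j).pt t ≠ p}

lemma IsNode.mem_punctured (hn : D.IsNode i t₀) {t : ℝ} (ht : t ∈ Icc (0 : ℝ) 1 \ {t₀}) :
    t ∈ D.punctured i ((D.arc i).pt t₀) := ⟨ht.1, hn.pt_ne ht.1 ht.2⟩

/-- The curve passes through the node at a single parameter of a single arc, so only one limit has
to be checked. -/
lemma regularAlong_of_tendsto (hn : D.IsNode i t₀) {f : ℝ → ℝ → ℝ → ℝ → ℝ}
    (hcont : ∀ j, ContinuousOn (D.onArc f j) (D.punctured j ((D.arc i).pt t₀)))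
    (h0 : Tendsto (D.onArc f i) (𝓝[Icc 0 1 \ {t₀}] t₀) (𝓝 0)) :
    D.RegularAlong ((D.arc i).r t₀) ((D.arc i).z t₀) f := by
  intro j t ht
  by_cases h : (D.arc j).pt t = (D.arc i).pt t₀
  · obtain ⟨rfl, rfl⟩ := hn.unique ht h
    rw [← continuousWithinAt_sdiff_self, ContinuousWithinAt, if_pos ⟨rfl, rfl⟩]
    refine h0.congr' ?_
    filter_upwards [self_mem_nhdsWithin] with s hs
    exact (if_neg fun he => (hn.mem_punctured hs).2 (Prod.ext he.1 he.2)).symm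
  · have hev : ∀ᶠ s in 𝓝[Icc (0 : ℝ) 1] t, s ∈ D.punctured j ((D.arc i).pt t₀) := by
      filter_upwards [self_mem_nhdsWithin, nhdsWithin_le_nhds
        ((D.arc j).continuous_pt.continuousAt.eventually_ne h)] with s hs hs'
      exact ⟨hs, hs'⟩
    have hif : ∀ s ∈ D.punctured j ((D.arc i).pt t₀),
        ¬ ((D.arc j).r s = (D.arc i).r t₀ ∧ (D.arc j).z s = (D.arc i).z t₀) := fun s hs he =>
      hs.2 (Prod.ext he.1 he.2)
    refine ((hcont j t ⟨ht, h⟩).mono_of_mem_nhdsWithin hev).congr_of_eventuallyEq ?_ ?_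
    · filter_upwards [hev] with s hs
      exact if_neg (hif s hs)
    · exact if_neg (hif t ⟨ht, h⟩)

/-- The continuous function differs from `f` at no more than one parameter, which is a null set. -/
lemma RegularAlong.lineIntegrable (hn : D.IsNode i t₀) {f : ℝ → ℝ → ℝ → ℝ → ℝ}
    (hf : D.RegularAlong ((D.arc i).r t₀) ((D.arc i).z t₀) f) : D.LineIntegrable f := by
  intro j
  have h1 := ((hf j).mul (D.arc j).continuous_speed.continuousOn).intervalIntegrable_of_Icc
    (μ := volume) zero_le_one
  refine h1.congr_ae ?_
  have hnull : ∀ᵐ t : ℝ, t ≠ t₀ := by simp [ae_iff]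
  refine (ae_restrict_iff' measurableSet_uIoc).2 ?_
  filter_upwards [hnull] with t ht htI
  rw [uIoc_of_le zero_le_one] at htI
  have : ¬ ((D.arc j).r t = (D.arc i).r t₀ ∧ (D.arc j).z t = (D.arc i).z t₀) := fun he =>
    ht (hn.unique (Ioc_subset_Icc_self htI) (Prod.ext he.1 he.2)).2
  exact (congrArg (· * (D.arc j).speed t) (if_neg this))

section kernels

variable {a : ℝ}

lemma continuousOn_kernelE_arc (ha : 0 ≤ a) (c : ℝ) (j : Fin D.N) :
    ContinuousOn (fun t => kernelE a c ((D.arc j).r t) ((D.arc j).z t)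
    ((D.arc j).nr t) ((D.arc j).nz t)) (D.punctured j (a, c)) := by
  have hm : ContinuousOn (fun t => (a, c, (D.arc j).r t, (D.arc j).z t, (D.arc j).nr t,
      (D.arc j).nz t)) (D.punctured j (a, c)) := by
    refine continuousOn_const.prodMk (continuousOn_const.prodMk
      ((D.arc j).continuous_r.continuousOn.prodMk ((D.arc j).continuous_z.continuousOn.prodMk
      (((D.arc j).continuousOn_nr.mono fun t ht => ht.1).prodMk
        ((D.arc j).continuousOn_nz.mono fun t ht => ht.1)))))
  exact continuousOn_kernelE.comp hm fun t ht => ⟨ha, (D.arc j).r_nonneg t ht.1, ht.2⟩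

lemma continuousOn_kernelK_arc (ha : 0 ≤ a) (c : ℝ) (j : Fin D.N) :
    ContinuousOn (fun t => kernelK a c ((D.arc j).r t) ((D.arc j).z t)
    ((D.arc j).nr t)) (D.punctured j (a, c)) := by
  have hm : ContinuousOn (fun t => (a, c, (D.arc j).r t, (D.arc j).z t, (D.arc j).nr t))
      (D.punctured j (a, c)) :=
    continuousOn_const.prodMk (continuousOn_const.prodMk
      ((D.arc j).continuous_r.continuousOn.prodMk ((D.arc j).continuous_z.continuousOn.prodMk
      ((D.arc j).continuousOn_nr.mono fun t ht => ht.1))))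
  exact continuousOn_kernelK.comp hm fun t ht => ⟨ha, (D.arc j).r_nonneg t ht.1, ht.2⟩

lemma continuousOn_kernelS_arc (ha : 0 ≤ a) (c : ℝ) (j : Fin D.N) :
    ContinuousOn (fun t => kernelS a c ((D.arc j).r t) ((D.arc j).z t))
    (D.punctured j (a, c)) := by
  have hm : Continuous (fun t => (a, c, (D.arc j).r t, (D.arc j).z t)) :=
    continuous_const.prodMk (continuous_const.prodMk
      ((D.arc j).continuous_r.prodMk (D.arc j).continuous_z))
  exact continuousOn_kernelS.comp hm.continuousOn
    fun t ht => ⟨ha, (D.arc j).r_nonneg t ht.1, ht.2⟩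

end kernels

/-- Distance from the node along its arc. -/
noncomputable def nodeDist (D : AxisymDomain) (i : Fin D.N) (t₀ t : ℝ) : ℝ :=
  meridianDist ((D.arc i).r t₀) ((D.arc i).z t₀) ((D.arc i).r t) ((D.arc i).z t)

lemma continuous_nodeDist : Continuous (D.nodeDist i t₀) := by
  have h1 := (D.arc i).continuous_r
  have h2 := (D.arc i).continuous_z
  unfold nodeDist meridianDist
  fun_prop

lemma nodeDist_nonneg (t : ℝ) : 0 ≤ D.nodeDist i t₀ t := meridianDist_nonneg _ _ _ _

lemma tendsto_nodeDist {s : Set ℝ} : Tendsto (D.nodeDist i t₀) (𝓝[s] t₀) (𝓝 0) := by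
  have := (continuous_nodeDist (D := D) (i := i) (t₀ := t₀)).tendsto t₀
  have e : D.nodeDist i t₀ t₀ = 0 := by simp [nodeDist, meridianDist]
  rw [e] at this
  exact this.mono_left nhdsWithin_le_nhds

/-- √(1 - m) is the distance divided by R̄, and R̄ is bounded on the bounded section. -/
lemma IsNode.isBigO_sqrt_one_sub_param (hn : D.IsNode i t₀) {f : ℝ → ℝ}
    (hf : f =O[𝓝[Icc 0 1 \ {t₀}] t₀] D.nodeDist i t₀) :
    f =O[𝓝[Icc 0 1 \ {t₀}] t₀] fun t => Real.sqrt (1 - param ((D.arc i).r t₀) ((D.arc i).z t₀)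
      ((D.arc i).r t) ((D.arc i).z t)) := by
  obtain ⟨M, hM, hR⟩ := D.exists_Rbar_le ((D.arc i).r t₀) ((D.arc i).z t₀)
  refine hf.trans (Asymptotics.IsBigO.of_bound M ?_)
  filter_upwards [self_mem_nhdsWithin] with t ht
  have hne := hn.pt_ne ht.1 ht.2
  have hr := (D.arc i).r_nonneg t ht.1
  rw [sqrt_one_sub_param hn.r_nonneg hr hne, norm_div, ← nodeDist, Real.norm_eq_abs,
    Real.norm_eq_abs (Rbar _ _ _ _), abs_of_pos (Rbar_pos hn.r_nonneg hr hne), mul_div_assoc',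
    le_div_iff₀ (Rbar_pos hn.r_nonneg hr hne), mul_comm M]
  exact mul_le_mul_of_nonneg_left (hR _ (D.pt_mem_section ht.1)) (abs_nonneg _)

/-- `K` is at most a multiple of d^(-1/2), so its product with O(d) is O(d^(1/2)). -/
lemma IsNode.tendsto_ellipticK_mul (hn : D.IsNode i t₀) {f : ℝ → ℝ}
    (hf : f =O[𝓝[Icc 0 1 \ {t₀}] t₀] D.nodeDist i t₀) :
    Tendsto (fun t => ellipticK (param ((D.arc i).r t₀) ((D.arc i).z t₀)
      ((D.arc i).r t) ((D.arc i).z t)) * f t) (𝓝[Icc 0 1 \ {t₀}] t₀) (𝓝 0) := by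
  obtain ⟨C, hC, hK⟩ := D.exists_ellipticK_mul_sqrt_le hn.r_nonneg ((D.arc i).z t₀)
  have h1 : (fun t => ellipticK (param ((D.arc i).r t₀) ((D.arc i).z t₀)
      ((D.arc i).r t) ((D.arc i).z t)) * D.nodeDist i t₀ t) =O[𝓝[Icc 0 1 \ {t₀}] t₀]
      fun t => Real.sqrt (D.nodeDist i t₀ t) := by
    refine Asymptotics.IsBigO.of_bound C ?_
    filter_upwards [self_mem_nhdsWithin] with t ht
    have h2 := hK _ (D.pt_mem_section ht.1) (hn.pt_ne ht.1 ht.2)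
    have h3 := Real.sqrt_nonneg (D.nodeDist i t₀ t)
    rw [Real.norm_eq_abs, Real.norm_eq_abs, abs_of_nonneg h3, abs_of_nonneg
      (mul_nonneg (ellipticK_nonneg _) (nodeDist_nonneg t))]
    calc _ = (ellipticK (param ((D.arc i).r t₀) ((D.arc i).z t₀) ((D.arc i).r t) ((D.arc i).z t))
          * Real.sqrt (D.nodeDist i t₀ t)) * Real.sqrt (D.nodeDist i t₀ t) := by
          rw [mul_assoc, Real.mul_self_sqrt (nodeDist_nonneg t)]
      _ ≤ _ := mul_le_mul_of_nonneg_right h2 h3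
  refine (((Asymptotics.isBigO_refl _ _).mul hf).trans h1).trans_tendsto ?_
  have := (Real.continuous_sqrt.tendsto 0).comp
    (tendsto_nodeDist (D := D) (i := i) (t₀ := t₀) (s := Icc 0 1 \ {t₀}))
  rwa [Real.sqrt_zero] at this

end AxisymDomain

namespace IsAxisymC1

open AxisymDomain

variable {D : AxisymDomain} {u : E3 → ℝ} {g : E3 → E3} {i : Fin D.N} {t₀ : ℝ}

lemma continuousOn_arc (h : IsAxisymC1 D u g) (j : Fin D.N) :
    ContinuousOn (fun t => u (cyl ((D.arc j).r t) 0 ((D.arc j).z t))) (Icc 0 1) :=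
  h.continuousOn_section.comp (D.arc j).continuous_pt.continuousOn fun _ ht => D.pt_mem_section ht

lemma continuousOn_normal_deriv_arc (h : IsAxisymC1 D u g) (j : Fin D.N) :
    ContinuousOn (fun t => ⟪g (cyl ((D.arc j).r t) 0 ((D.arc j).z t)),
      cyl ((D.arc j).nr t) 0 ((D.arc j).nz t)⟫) (Icc 0 1) := by
  refine ContinuousOn.inner (𝕜 := ℝ) ?_ ?_
  · exact (h.grad_cont.comp AxisymDomain.continuous_cyl_zero.continuousOn fun _ hp => hp.2).comp
      (D.arc j).continuous_pt.continuousOn fun _ ht => D.pt_mem_section ht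
  · exact continuous_cyl.comp_continuousOn ((D.arc j).continuousOn_nr.prodMk
      (continuousOn_const.prodMk (D.arc j).continuousOn_nz))

lemma isBigO_nodeDist (h : IsAxisymC1 D u g) (hn : D.IsNode i t₀)
    (h0 : u (cyl ((D.arc i).r t₀) 0 ((D.arc i).z t₀)) = 0) :
    (fun t => u (cyl ((D.arc i).r t) 0 ((D.arc i).z t))) =O[𝓝[Icc 0 1 \ {t₀}] t₀]
      D.nodeDist i t₀ := by
  obtain ⟨K, hK0, hK⟩ := h.exists_le_mul_dist hn h0
  refine Asymptotics.IsBigO.of_bound K ?_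
  filter_upwards [self_mem_nhdsWithin] with t ht
  rw [Real.norm_eq_abs, Real.norm_eq_abs, abs_of_nonneg (nodeDist_nonneg t)]
  exact (hK _ (D.pt_mem_section ht.1)).trans (mul_le_mul_of_nonneg_left
    (dist_le_meridianDist _ _ ((D.arc i).pt t)) hK0)

lemma regularAlong_kernelE (h : IsAxisymC1 D u g) (hn : D.IsNode i t₀)
    (h0 : u (cyl ((D.arc i).r t₀) 0 ((D.arc i).z t₀)) = 0) :
    D.RegularAlong ((D.arc i).r t₀) ((D.arc i).z t₀) fun r z nr nz =>
      u (cyl r 0 z) * kernelE ((D.arc i).r t₀) ((D.arc i).z t₀) r z nr nz := by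
  refine regularAlong_of_tendsto hn (fun j => ?_) ?_
  · exact ((h.continuousOn_arc j).mono fun t ht => ht.1).mul
      (continuousOn_kernelE_arc hn.r_nonneg _ j)
  · obtain ⟨C, hC0, hC⟩ := hn.exists_abs_kernelE_le
    have hO : (fun t => kernelE ((D.arc i).r t₀) ((D.arc i).z t₀) ((D.arc i).r t) ((D.arc i).z t)
        ((D.arc i).nr t) ((D.arc i).nz t)) =O[𝓝[Icc 0 1 \ {t₀}] t₀] fun _ => (1 : ℝ) := by
      refine Asymptotics.IsBigO.of_bound C ?_
      filter_upwards [self_mem_nhdsWithin] with t ht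
      rw [norm_one, mul_one]
      exact hC t ht.1 ht.2
    refine ((h.isBigO_nodeDist hn h0).mul hO).trans_tendsto ?_
    simp only [mul_one]
    exact tendsto_nodeDist

/-- The kernel is half of n_r/R̄, bounded along the arc also for nodes on the axis, times `K`; and
`K u` tends to 0. -/
lemma regularAlong_kernelK (h : IsAxisymC1 D u g) (hn : D.IsNode i t₀)
    (h0 : u (cyl ((D.arc i).r t₀) 0 ((D.arc i).z t₀)) = 0) :
    D.RegularAlong ((D.arc i).r t₀) ((D.arc i).z t₀) fun r z nr _ =>
      u (cyl r 0 z) * kernelK ((D.arc i).r t₀) ((D.arc i).z t₀) r z nr := by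
  refine regularAlong_of_tendsto hn (fun j => ?_) ?_
  · exact ((h.continuousOn_arc j).mono fun t ht => ht.1).mul
      (continuousOn_kernelK_arc hn.r_nonneg _ j)
  · obtain ⟨C, hC0, hC⟩ := hn.exists_abs_nr_div_Rbar_le
    refine Asymptotics.IsBigO.trans_tendsto (Asymptotics.IsBigO.of_bound (C / 2) ?_)
      (hn.tendsto_ellipticK_mul (h.isBigO_nodeDist hn h0))
    filter_upwards [self_mem_nhdsWithin] with t ht
    have hR := Rbar_nonneg ((D.arc i).r t₀) ((D.arc i).z t₀) ((D.arc i).r t) ((D.arc i).z t)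
    have h1 := hC t ht.1 ht.2
    have e : D.onArc (fun r z nr _ =>
        u (cyl r 0 z) * kernelK ((D.arc i).r t₀) ((D.arc i).z t₀) r z nr) i t
        = ((D.arc i).nr t / Rbar ((D.arc i).r t₀) ((D.arc i).z t₀) ((D.arc i).r t) ((D.arc i).z t)
          / 2) * (ellipticK (param ((D.arc i).r t₀) ((D.arc i).z t₀) ((D.arc i).r t)
            ((D.arc i).z t)) * u (cyl ((D.arc i).r t) 0 ((D.arc i).z t))) := by
      rw [onArc, kernelK_eq]; ring
    rw [e, norm_mul]
    refine mul_le_mul_of_nonneg_right ?_ (norm_nonneg _)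
    rw [Real.norm_eq_abs, abs_div, abs_div, abs_of_nonneg hR, abs_two]
    linarith

lemma regularAlong_kernelS (h : IsAxisymC1 D u g) (hn : D.IsNode i t₀)
    (hO : (fun t => ⟪g (cyl ((D.arc i).r t) 0 ((D.arc i).z t)),
      cyl ((D.arc i).nr t) 0 ((D.arc i).nz t)⟫) =O[𝓝[Icc 0 1 \ {t₀}] t₀] D.nodeDist i t₀) :
    D.RegularAlong ((D.arc i).r t₀) ((D.arc i).z t₀) fun r z nr nz =>
      ⟪g (cyl r 0 z), cyl nr 0 nz⟫ * kernelS ((D.arc i).r t₀) ((D.arc i).z t₀) r z := by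
  refine regularAlong_of_tendsto hn (fun j => ?_) ?_
  · exact ((h.continuousOn_normal_deriv_arc j).mono fun t ht => ht.1).mul
      (continuousOn_kernelS_arc hn.r_nonneg _ j)
  · refine Asymptotics.IsBigO.trans_tendsto (Asymptotics.IsBigO.of_bound 1 ?_)
      (hn.tendsto_ellipticK_mul hO)
    filter_upwards [self_mem_nhdsWithin] with t ht
    have hr := (D.arc i).r_nonneg t ht.1
    rw [onArc, norm_mul, norm_mul, one_mul, mul_comm]
    refine mul_le_mul_of_nonneg_right ?_ (norm_nonneg _)
    rw [Real.norm_eq_abs, Real.norm_eq_abs, abs_of_nonneg (kernelS_nonneg hr _ _ _),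
      abs_of_nonneg (ellipticK_nonneg _)]
    exact kernelS_le hn.r_nonneg hr

end IsAxisymC1

/-! ### The normal derivative near the node -/

namespace MeridianArc

variable (γ : MeridianArc)

lemma differentiableAt_speed {t : ℝ} (ht : t ∈ Icc (0 : ℝ) 1) : DifferentiableAt ℝ γ.speed t := by
  have h1 := γ.contDiff_deriv_r.differentiable one_ne_zero t
  have h2 := γ.contDiff_deriv_z.differentiable one_ne_zero t
  exact ((h1.pow 2).add (h2.pow 2)).sqrt (γ.regular t ht).ne'

lemma differentiableAt_nr {t : ℝ} (ht : t ∈ Icc (0 : ℝ) 1) : DifferentiableAt ℝ γ.nr t :=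
  (γ.contDiff_deriv_z.differentiable one_ne_zero t).div (γ.differentiableAt_speed ht)
    (γ.speed_pos ht).ne'

lemma differentiableAt_nz {t : ℝ} (ht : t ∈ Icc (0 : ℝ) 1) : DifferentiableAt ℝ γ.nz t :=
  (γ.contDiff_deriv_r.differentiable one_ne_zero t).neg.div (γ.differentiableAt_speed ht)
    (γ.speed_pos ht).ne'

lemma norm_normal_le (t θ : ℝ) : ‖cyl (γ.nr t) θ (γ.nz t)‖ ≤ 2 := by
  rw [norm_cyl]
  have h1 := (sq_le_one_iff_abs_le_one _).2 (γ.abs_nr_le_one t)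
  have h2 := (sq_le_one_iff_abs_le_one _).2 (γ.abs_nz_le_one t)
  exact Real.sqrt_le_iff.2 ⟨zero_le_two, by linarith⟩

end MeridianArc

lemma inner_cyl_right (v : E3) (a θ b : ℝ) :
    ⟪v, cyl a θ b⟫ = a * ⟪v, cyl 1 θ 0⟫ + b * ⟪v, cyl 0 θ 1⟫ := by
  rw [← real_inner_smul_right, ← real_inner_smul_right, ← inner_add_right, smul_cyl, smul_cyl,
    cyl_add]
  simp

namespace AxisymDomain

variable {D : AxisymDomain} {i : Fin D.N} {t₀ : ℝ}

lemma IsNode.isBigO_of_differentiableAt (hn : D.IsNode i t₀) {F : ℝ → ℝ}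
    (hF : DifferentiableAt ℝ F t₀) (h0 : F t₀ = 0) (s : Set ℝ) :
    F =O[𝓝[s] t₀] D.nodeDist i t₀ := by
  have h1 : F =O[𝓝 t₀] fun t => t - t₀ := by
    have := hF.isBigO_sub
    simpa [h0] using this
  have h2 : (fun t => (D.arc i).pt t - (D.arc i).pt t₀) =O[𝓝 t₀] D.nodeDist i t₀ := by
    refine Asymptotics.IsBigO.of_bound 1 (Eventually.of_forall fun t => ?_)
    rw [one_mul, Real.norm_eq_abs, abs_of_nonneg (nodeDist_nonneg t), ← dist_eq_norm]
    exact dist_le_meridianDist _ _ ((D.arc i).pt t)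
  exact ((h1.trans ((D.arc i).isBigO_sub_pt hn.mem_Icc)).trans h2).mono nhdsWithin_le_nhds

lemma isBigO_inner_sub {G : E3 → E3} {x₀ : E3}
    (hx₀ : x₀ = cyl ((D.arc i).r t₀) 0 ((D.arc i).z t₀))
    (hG : (fun x => G x - G x₀) =O[𝓝[closure D.Ω] x₀] fun x => x - x₀) :
    (fun t => ⟪G (cyl ((D.arc i).r t) 0 ((D.arc i).z t)) - G x₀,
      cyl ((D.arc i).nr t) 0 ((D.arc i).nz t)⟫) =O[𝓝[Icc 0 1 \ {t₀}] t₀] D.nodeDist i t₀ := by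
  have hline : Tendsto (fun t => cyl ((D.arc i).r t) 0 ((D.arc i).z t)) (𝓝[Icc 0 1 \ {t₀}] t₀)
      (𝓝[closure D.Ω] x₀) := by
    refine tendsto_nhdsWithin_iff.2 ⟨?_, ?_⟩
    · rw [hx₀]
      exact ((continuous_cyl_zero.comp (D.arc i).continuous_pt).tendsto t₀).mono_left
        nhdsWithin_le_nhds
    · filter_upwards [self_mem_nhdsWithin] with t ht
      exact (D.pt_mem_section ht.1).2
  refine Asymptotics.IsBigO.trans (g := fun t =>
    G (cyl ((D.arc i).r t) 0 ((D.arc i).z t)) - G x₀) ?_ ((hG.comp_tendsto hline).trans ?_)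
  · refine Asymptotics.IsBigO.of_bound 2 (Eventually.of_forall fun t => ?_)
    rw [mul_comm]
    exact (norm_inner_le_norm _ _).trans (mul_le_mul_of_nonneg_left
      ((D.arc i).norm_normal_le t 0) (norm_nonneg _))
  · refine Asymptotics.IsBigO.of_bound 1 (Eventually.of_forall fun t => ?_)
    rw [Function.comp_apply, hx₀, norm_cyl_sub_cyl, one_mul]
    exact le_abs_self _

/-- The normal derivative of `φ - ψ` vanishes to first order at the node. -/
lemma IsNode.isBigO_normal_deriv (hn : D.IsNode i t₀) {G : E3 → E3} {x₀ n₀ : E3} {φ₀ q₀ zD : ℝ}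
    (hx₀ : x₀ = cyl ((D.arc i).r t₀) 0 ((D.arc i).z t₀))
    (hn₀ : n₀ = cyl ((D.arc i).nr t₀) 0 ((D.arc i).nz t₀))
    (hout : cyl 0 0 zD ∉ closure D.Ω) (hne : ⟪n₀, x₀ - cyl 0 0 zD⟫ ≠ 0) (hq₀ : q₀ = ⟪G x₀, n₀⟫)
    (hG : (fun x => G x - G x₀) =O[𝓝[closure D.Ω] x₀] fun x => x - x₀) :
    (fun t => ⟪G (cyl ((D.arc i).r t) 0 ((D.arc i).z t))
        - ∇ (auxPsi φ₀ q₀ x₀ n₀ (cyl 0 0 zD)) (cyl ((D.arc i).r t) 0 ((D.arc i).z t)),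
      cyl ((D.arc i).nr t) 0 ((D.arc i).nz t)⟫) =O[𝓝[Icc 0 1 \ {t₀}] t₀] D.nodeDist i t₀ := by
  have h1 := isBigO_inner_sub (t₀ := t₀) hx₀ hG
  set γ := D.arc i with hγ
  have ht₀ := hn.mem_Icc
  have hc : ∀ t ∈ Icc (0 : ℝ) 1, cyl (γ.r t) 0 (γ.z t) ≠ cyl 0 0 zD := fun t ht h =>
    hout (h ▸ (D.pt_mem_section (i := i) ht).2)
  have hs₀ : sVal zD (γ.r t₀) (γ.z t₀) (γ.nr t₀) (γ.nz t₀) ≠ 0 := by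
    rwa [hx₀, hn₀, real_inner_comm, inner_cyl_sub_axis] at hne
  have hρ₀ := rho_pos_of_ne (hc t₀ ht₀)
  -- The normal derivative is split as (G(x) - G(x₀)) · n, which is O(d) by hypothesis, plus `F`,
  -- where `G` is frozen at x₀. Only the geometry of the arc enters `F`, so it is differentiable in
  -- `t`; it vanishes at `t₀` by the choice of `q₀`.
  set F : ℝ → ℝ := fun t => γ.nr t * ⟪G x₀, cyl 1 0 0⟫ + γ.nz t * ⟪G x₀, cyl 0 0 1⟫
    - q₀ * (rho zD (γ.r t₀) (γ.z t₀) / rho zD (γ.r t) (γ.z t)) ^ 3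
      * (sVal zD (γ.r t) (γ.z t) (γ.nr t) (γ.nz t)
        / sVal zD (γ.r t₀) (γ.z t₀) (γ.nr t₀) (γ.nz t₀)) with hF
  have hF0 : F t₀ = 0 := by
    rw [hF]
    simp only
    rw [div_self hρ₀.ne', div_self hs₀, ← inner_cyl_right, hq₀, hn₀]
    ring
  have hFd : DifferentiableAt ℝ F t₀ := by
    have d1 := γ.differentiableAt_nr ht₀
    have d2 := γ.differentiableAt_nz ht₀
    have d3 := (γ.hasDerivAt_r t₀).differentiableAt
    have d4 := (γ.hasDerivAt_z t₀).differentiableAt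
    have d5 : DifferentiableAt ℝ (fun t => rho zD (γ.r t) (γ.z t)) t₀ :=
      ((d3.pow 2).add ((d4.sub_const zD).pow 2)).sqrt (Real.sqrt_pos.1 hρ₀).ne'
    have d6 : DifferentiableAt ℝ (fun t => sVal zD (γ.r t) (γ.z t) (γ.nr t) (γ.nz t)) t₀ :=
      (d3.mul d1).add ((d4.sub_const zD).mul d2)
    exact ((d1.mul_const _).add (d2.mul_const _)).sub
      (((((differentiableAt_const _).div d5 hρ₀.ne').pow 3).const_mul q₀).mul (d6.div_const _))
  refine (h1.add (hn.isBigO_of_differentiableAt hFd hF0 _)).congr' ?_ EventuallyEq.rfl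
  filter_upwards [self_mem_nhdsWithin] with t ht
  rw [hF]
  simp only
  rw [← inner_cyl_right, inner_sub_left, inner_sub_left, hx₀, hn₀,
    inner_gradient_auxPsi _ _ _ _ _ _ _ (hc t ht.1)]
  ring

end AxisymDomain

/-! ### Integrability of the single layer kernel -/

lemma intervalIntegrable_inv_sqrt_abs_sub (s a b : ℝ) :
    IntervalIntegrable (fun t => 1 / Real.sqrt |t - s|) volume a b := by
  have h : ∀ a b : ℝ, IntervalIntegrable (fun x : ℝ => x ^ (-(1 / 2) : ℝ)) volume a b :=
    fun a b => intervalIntegral.intervalIntegrable_rpow' (by norm_num)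
  have h1 : IntervalIntegrable (fun t : ℝ => (t - s) ^ (-(1 / 2) : ℝ)) volume a b := by
    have := (h (a - s) (b - s)).comp_sub_right s
    simpa using this
  have h2 : IntervalIntegrable (fun t : ℝ => (s - t) ^ (-(1 / 2) : ℝ)) volume a b := by
    have := (h (s - a) (s - b)).comp_sub_left s
    simpa using this
  refine (h1.norm.add h2.norm).mono_fun' ?_ (Eventually.of_forall fun t => ?_)
  · exact (by fun_prop : Measurable fun t : ℝ => 1 / Real.sqrt |t - s|).aestronglyMeasurable
  · have e : ∀ x : ℝ, 1 / Real.sqrt |x| = |x| ^ (-(1 / 2) : ℝ) := fun x => by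
      rw [Real.rpow_neg (abs_nonneg x), Real.sqrt_eq_rpow, one_div (|x| ^ _)]
    simp only
    rw [Real.norm_of_nonneg (by positivity), e]
    rcases le_total s t with hs | hs
    · rw [abs_of_nonneg (sub_nonneg.2 hs)]
      exact (le_abs_self _).trans (le_add_of_nonneg_right (norm_nonneg _))
    · rw [abs_sub_comm, abs_of_nonneg (sub_nonneg.2 hs)]
      exact (le_abs_self _).trans (le_add_of_nonneg_left (norm_nonneg _))

namespace AxisymDomain

variable {D : AxisymDomain} {i : Fin D.N} {t₀ : ℝ}

lemma exists_ellipticK_le_div_sqrt (D : AxisymDomain) {a : ℝ} (ha : 0 ≤ a) (c : ℝ) :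
    ∃ C, 0 < C ∧ ∀ p ∈ D.section', p ≠ (a, c) →
      ellipticK (param a c p.1 p.2) ≤ C / Real.sqrt (dist p (a, c)) := by
  obtain ⟨C, hC, h⟩ := D.exists_ellipticK_mul_sqrt_le ha c
  refine ⟨C, hC, fun p hp hne => ?_⟩
  rw [le_div_iff₀ (Real.sqrt_pos.2 (dist_pos.2 hne))]
  exact (mul_le_mul_of_nonneg_left (Real.sqrt_le_sqrt (dist_le_meridianDist a c p))
    (ellipticK_nonneg _)).trans (h p hp hne)

/-- Supplies an integrable majorant: the single layer term is not assumed to vanish at the node, and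
only |t - t₀|^(-1/2) is available. -/
lemma IsNode.exists_kernelS_le (hn : D.IsNode i t₀) :
    ∃ C, 0 < C ∧ ∀ t ∈ Icc (0 : ℝ) 1, t ≠ t₀ →
      |kernelS ((D.arc i).r t₀) ((D.arc i).z t₀) ((D.arc i).r t) ((D.arc i).z t)|
        ≤ C * (1 / Real.sqrt |t - t₀|) := by
  obtain ⟨C, hC, h⟩ := D.exists_ellipticK_mul_sqrt_le hn.r_nonneg ((D.arc i).z t₀)
  obtain ⟨B, hB, hB'⟩ := hn.exists_abs_sub_le
  refine ⟨C * Real.sqrt B, by positivity, fun t ht hne => ?_⟩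
  have hr := (D.arc i).r_nonneg t ht
  have h1 := h _ (D.pt_mem_section (i := i) ht) (hn.pt_ne ht hne)
  have h2 := Real.sqrt_le_sqrt (hB' t ht)
  rw [Real.sqrt_mul hB.le] at h2
  have h3 : 0 < Real.sqrt |t - t₀| := Real.sqrt_pos.2 (abs_pos.2 (sub_ne_zero.2 hne))
  rw [abs_of_nonneg (kernelS_nonneg hr _ _ _), mul_one_div, le_div_iff₀ h3]
  have hK := ellipticK_nonneg (param ((D.arc i).r t₀) ((D.arc i).z t₀) ((D.arc i).r t)
    ((D.arc i).z t))
  calc _ ≤ ellipticK (param ((D.arc i).r t₀) ((D.arc i).z t₀) ((D.arc i).r t) ((D.arc i).z t))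
        * (Real.sqrt B * Real.sqrt (meridianDist ((D.arc i).r t₀) ((D.arc i).z t₀)
          ((D.arc i).r t) ((D.arc i).z t))) :=
        mul_le_mul (kernelS_le hn.r_nonneg hr) h2 h3.le hK
    _ ≤ _ := by
        rw [mul_left_comm, mul_comm C]
        exact mul_le_mul_of_nonneg_left h1 (Real.sqrt_nonneg B)

lemma IsNode.intervalIntegrable_kernelS (hn : D.IsNode i t₀) (j : Fin D.N) :
    IntervalIntegrable (fun t => kernelS ((D.arc i).r t₀) ((D.arc i).z t₀) ((D.arc j).r t)
      ((D.arc j).z t)) volume 0 1 := by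
  have hcont := continuousOn_kernelS_arc hn.r_nonneg ((D.arc i).z t₀) j
  by_cases hij : j = i
  · subst hij
    obtain ⟨C, hC, h⟩ := hn.exists_kernelS_le
    have hae : (Ioc (0 : ℝ) 1 \ {t₀} : Set ℝ) =ᵐ[volume] Ioc 0 1 :=
      sdiff_null_ae_eq_self (by simp)
    refine ((intervalIntegrable_inv_sqrt_abs_sub t₀ 0 1).const_mul C).mono_fun' ?_ ?_
    · rw [uIoc_of_le zero_le_one, ← Measure.restrict_congr_set hae]
      refine (hcont.mono fun t ht => ?_).aestronglyMeasurable
        (measurableSet_Ioc.diff (measurableSet_singleton t₀))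
      exact hn.mem_punctured ⟨Ioc_subset_Icc_self ht.1, ht.2⟩
    · rw [uIoc_of_le zero_le_one, ← Measure.restrict_congr_set hae]
      refine (ae_restrict_iff' (measurableSet_Ioc.diff (measurableSet_singleton t₀))).2 ?_
      exact Eventually.of_forall fun t ht => h t (Ioc_subset_Icc_self ht.1) ht.2
  · refine (hcont.mono fun t ht => ⟨ht, fun h => hij ?_⟩).intervalIntegrable_of_Icc zero_le_one
    exact (hn.unique ht h).1

end AxisymDomain

namespace IsAxisymC1

open AxisymDomain

variable {D : AxisymDomain} {u : E3 → ℝ} {g : E3 → E3} {i : Fin D.N} {t₀ : ℝ}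

lemma lineIntegrable_kernelS (h : IsAxisymC1 D u g) (hn : D.IsNode i t₀) :
    D.LineIntegrable fun r z nr nz =>
      ⟪g (cyl r 0 z), cyl nr 0 nz⟫ * kernelS ((D.arc i).r t₀) ((D.arc i).z t₀) r z := by
  intro j
  have hc := (h.continuousOn_normal_deriv_arc j).mul (D.arc j).continuous_speed.continuousOn
  rw [← uIcc_of_le (zero_le_one' ℝ)] at hc
  refine ((hn.intervalIntegrable_kernelS j).continuousOn_mul hc).congr_ae
    (Eventually.of_forall fun t => ?_)
  simp only [onArc, Pi.mul_apply]
  ring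

end IsAxisymC1

/-! ### The solenoidal field of the boundary integral equation -/

/-- Linearity in the normal lets the kernels be read as normal components of a plane field defined
throughout the section, not only on the curve. -/
lemma kernelE_linear (a c r z nr nz : ℝ) :
    kernelE a c r z nr nz = nr * kernelE a c r z 1 0 + nz * kernelE a c r z 0 1 := by
  simp only [kernelE]
  split_ifs <;> ring

lemma kernelK_linear (a c r z nr : ℝ) : kernelK a c r z nr = nr * kernelK a c r z 1 := by
  rw [kernelK_eq, kernelK_eq]; ring

/-- The two limiting terms ±(π/4)/R̄ cancel: the field has no flux through the axis. -/
lemma kernelE_add_kernelK_axis (a c z nz : ℝ) :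
    kernelE a c 0 z 1 nz + kernelK a c 0 z 1 = 0 := by
  have hm : param a c 0 z = 0 := by simp [param]
  simp only [kernelE, kernelK, if_pos hm]
  ring

lemma kernelS_axis (a c z : ℝ) : kernelS a c 0 z = 0 := by simp [kernelS]

section ring

variable {a c : ℝ} {p : ℝ × ℝ}

lemma kernelS_eq_ring (ha : 0 ≤ a) (hp : 0 ≤ p.1) (hne : p ≠ (a, c)) :
    kernelS a c p.1 p.2 = p.1 / 4 * ∫ θ in (0 : ℝ)..(2 * Real.pi), ringInv a c θ p := by
  have h := integral_green ha hp hne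
  simp only [ringInv_eq]
  simp only [green] at h
  linarith

lemma kernelE_add_kernelK_eq_ring (ha : 0 ≤ a) (hp : 0 ≤ p.1) (hne : p ≠ (a, c)) (nr nz : ℝ) :
    kernelE a c p.1 p.2 nr nz + kernelK a c p.1 p.2 nr = -(p.1 / 4) *
      ∫ θ in (0 : ℝ)..(2 * Real.pi), (-(p.1 - a * Real.cos θ) * ringInv a c θ p ^ 3 * nr
        + -(p.2 - c) * ringInv a c θ p ^ 3 * nz) := by
  have h := integral_normal_deriv_green ha hp hne nr nz
  have e : ∀ θ, ⟪∇ (green (cyl a 0 c)) (cyl p.1 θ p.2), cyl nr θ nz⟫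
      = -(p.1 - a * Real.cos θ) * ringInv a c θ p ^ 3 * nr
        + -(p.2 - c) * ringInv a c θ p ^ 3 * nz := fun θ => by
    rw [gradient_green _ (sub_ne_zero.1 (norm_pos_iff.1 (norm_cyl_sub_pos ha hp hne θ))),
      real_inner_smul_left, inner_cyl_sub, ringInv_eq]
    ring
  simp only [e] at h
  linarith

end ring

/-- Component in the direction `(nr, nz)` of the field whose flux through the meridian curve is the
sum of the three line integrals. -/
noncomputable def bieField (u : E3 → ℝ) (g : E3 → E3) (a c nr nz : ℝ) (p : ℝ × ℝ) : ℝ :=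
  u (cyl p.1 0 p.2) * (kernelE a c p.1 p.2 nr nz + kernelK a c p.1 p.2 nr)
    + ⟪g (cyl p.1 0 p.2), cyl nr 0 nz⟫ * kernelS a c p.1 p.2

lemma bieField_linear (u : E3 → ℝ) (g : E3 → E3) (a c nr nz : ℝ) (p : ℝ × ℝ) :
    bieField u g a c nr nz p
      = nr * bieField u g a c 1 0 p + nz * bieField u g a c 0 1 p := by
  simp only [bieField]
  rw [kernelE_linear, kernelK_linear, kernelK_linear a c p.1 p.2 0, inner_cyl_right]
  ring

namespace IsAxisymC1

open AxisymDomain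

variable {D : AxisymDomain} {u : E3 → ℝ} {g : E3 → E3} {i : Fin D.N} {t₀ : ℝ}

lemma continuousOn_bieField (h : IsAxisymC1 D u g) {a : ℝ} (ha : 0 ≤ a) (c nr nz : ℝ) :
    ContinuousOn (bieField u g a c nr nz) (D.section' \ {(a, c)}) := by
  have h1 : ContinuousOn (fun p : ℝ × ℝ => kernelE a c p.1 p.2 nr nz) (D.section' \ {(a, c)}) :=
    continuousOn_kernelE.comp
      (by fun_prop : Continuous fun p : ℝ × ℝ => (a, c, p.1, p.2, nr, nz)).continuousOn
      fun p hp => ⟨ha, hp.1.1, hp.2⟩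
  have h2 : ContinuousOn (fun p : ℝ × ℝ => kernelK a c p.1 p.2 nr) (D.section' \ {(a, c)}) :=
    continuousOn_kernelK.comp
      (by fun_prop : Continuous fun p : ℝ × ℝ => (a, c, p.1, p.2, nr)).continuousOn
      fun p hp => ⟨ha, hp.1.1, hp.2⟩
  have h3 : ContinuousOn (fun p : ℝ × ℝ => kernelS a c p.1 p.2) (D.section' \ {(a, c)}) :=
    continuousOn_kernelS.comp
      (by fun_prop : Continuous fun p : ℝ × ℝ => (a, c, p.1, p.2)).continuousOn
      fun p hp => ⟨ha, hp.1.1, hp.2⟩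
  have h4 : ContinuousOn (fun p : ℝ × ℝ => ⟪g (cyl p.1 0 p.2), cyl nr 0 nz⟫) D.section' :=
    ContinuousOn.inner (𝕜 := ℝ)
      (h.grad_cont.comp AxisymDomain.continuous_cyl_zero.continuousOn fun _ hp => hp.2)
      continuousOn_const
  exact ((h.continuousOn_section.mono sdiff_subset).mul (h1.add h2)).add
    ((h4.mono sdiff_subset).mul h3)

/-- With u = O(d), the `E` term is bounded by d|E| ≤ 5, the `K` term by d|K| ≤ K(m), and the `S`
term by a constant times K(m), the gradient being bounded. All of this is O(d^(-1/2)) on the bounded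
section. -/
lemma exists_bieField_le (h : IsAxisymC1 D u g) (hn : D.IsNode i t₀)
    (h0 : u (cyl ((D.arc i).r t₀) 0 ((D.arc i).z t₀)) = 0) :
    ∃ C, ∀ nr nz : ℝ, |nr| ≤ 1 → |nz| ≤ 1 → ∀ p ∈ D.section', p ≠ (D.arc i).pt t₀ →
      |bieField u g ((D.arc i).r t₀) ((D.arc i).z t₀) nr nz p|
        ≤ C / Real.sqrt (dist p ((D.arc i).pt t₀)) := by
  set a := (D.arc i).r t₀
  set c := (D.arc i).z t₀
  change ∃ C, ∀ nr nz : ℝ, |nr| ≤ 1 → |nz| ≤ 1 → ∀ p ∈ D.section', p ≠ (a, c) → _ ≤ C /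
    Real.sqrt (dist p (a, c))
  have ha : 0 ≤ a := hn.r_nonneg
  obtain ⟨L, hL0, hL⟩ := h.exists_le_mul_dist hn h0
  obtain ⟨B, hB⟩ := D.isCompact_closure.exists_bound_of_continuousOn h.grad_cont
  obtain ⟨K, hK0, hK⟩ := D.exists_ellipticK_le_div_sqrt ha c
  obtain ⟨R, hR0, hR⟩ := D.exists_Rbar_le a c
  refine ⟨5 * L * Real.sqrt R + L * K + |B| * 2 * K, fun nr nz hnr hnz p hp hne => ?_⟩
  have hd : 0 < dist p (a, c) := dist_pos.2 hne
  have hdm := dist_le_meridianDist a c p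
  have hmR := (meridianDist_le_Rbar (a := a) (c := c) (z := p.2) ha hp.1).trans (hR p hp)
  have hs : 0 < Real.sqrt (dist p (a, c)) := Real.sqrt_pos.2 hd
  have hu := (hL p hp).trans (mul_le_mul_of_nonneg_left hdm hL0)
  have hEb := meridianDist_mul_abs_kernelE_le ha hp.1 hne hnr hnz
  have hKb := meridianDist_mul_abs_kernelK_le (c := c) (z := p.2) ha hp.1 hnr
  have hKK := hK p hp hne
  have hS : |kernelS a c p.1 p.2| ≤ K / Real.sqrt (dist p (a, c)) := by
    rw [abs_of_nonneg (kernelS_nonneg hp.1 _ _ _)]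
    exact (kernelS_le ha hp.1).trans hKK
  -- The bounded term is weakened to the common form C/√d, using d ≤ R.
  have h1 : (5 : ℝ) ≤ 5 * Real.sqrt R / Real.sqrt (dist p (a, c)) := by
    rw [le_div_iff₀ hs]
    exact mul_le_mul_of_nonneg_left (Real.sqrt_le_sqrt (hdm.trans hmR)) (by norm_num)
  have hg : |⟪g (cyl p.1 0 p.2), cyl nr 0 nz⟫| ≤ |B| * 2 := by
    refine (abs_real_inner_le_norm _ _).trans (mul_le_mul ((hB _ hp.2).trans (le_abs_self B)) ?_
      (norm_nonneg _) (abs_nonneg _))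
    rw [norm_cyl]
    have e1 := (sq_le_one_iff_abs_le_one _).2 hnr
    have e2 := (sq_le_one_iff_abs_le_one _).2 hnz
    exact Real.sqrt_le_iff.2 ⟨zero_le_two, by linarith⟩
  have t1 : |u (cyl p.1 0 p.2)| * |kernelE a c p.1 p.2 nr nz|
      ≤ L * (5 * Real.sqrt R / Real.sqrt (dist p (a, c))) := by
    refine (mul_le_mul_of_nonneg_right hu (abs_nonneg _)).trans ?_
    rw [mul_assoc]
    exact mul_le_mul_of_nonneg_left (hEb.trans h1) hL0
  have t2 : |u (cyl p.1 0 p.2)| * |kernelK a c p.1 p.2 nr|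
      ≤ L * (K / Real.sqrt (dist p (a, c))) := by
    refine (mul_le_mul_of_nonneg_right hu (abs_nonneg _)).trans ?_
    rw [mul_assoc]
    exact mul_le_mul_of_nonneg_left (hKb.trans hKK) hL0
  have t3 := mul_le_mul hg hS (abs_nonneg _) (by positivity)
  have t4 : |bieField u g a c nr nz p| ≤ |u (cyl p.1 0 p.2)| * |kernelE a c p.1 p.2 nr nz|
      + |u (cyl p.1 0 p.2)| * |kernelK a c p.1 p.2 nr|
      + |⟪g (cyl p.1 0 p.2), cyl nr 0 nz⟫| * |kernelS a c p.1 p.2| := by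
    rw [bieField, mul_add, ← abs_mul, ← abs_mul, ← abs_mul]
    exact abs_add_three _ _ _
  refine (t4.trans (add_le_add (add_le_add t1 t2) t3)).trans (le_of_eq ?_)
  ring

/-- Away from the node the field is -1/4 times the Green field of `u` and the ring potential, whose
divergence vanishes by `IsAxisymHarmonicAt.green_field`. -/
lemma exists_div_bieField
    (harm : ∀ p ∈ D.inner, IsAxisymHarmonicAt (fun q => u (cyl q.1 0 q.2))
      (fun q => ⟪g (cyl q.1 0 q.2), cyl 1 0 0⟫) (fun q => ⟪g (cyl q.1 0 q.2), cyl 0 0 1⟫) p)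
    {a c : ℝ} (ha : 0 ≤ a) {p : ℝ × ℝ} (hp : p ∈ D.inner) (hne : p ≠ (a, c)) :
    ∃ A B : ℝ × ℝ →L[ℝ] ℝ, HasFDerivAt (bieField u g a c 1 0) A p ∧
      HasFDerivAt (bieField u g a c 0 1) B p ∧ A (1, 0) + B (0, 1) = 0 := by
  obtain ⟨A, B, hA, hB, hAB⟩ := (harm p hp).green_field (isAxisymHarmonicAt_ring ha hp.1 hne)
  have hev : ∀ᶠ q in 𝓝 p, q ∈ D.inner ∧ q ≠ (a, c) :=
    Filter.inter_mem (D.isOpen_inner.mem_nhds hp) (isOpen_compl_singleton.mem_nhds hne)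
  refine ⟨_, _, (hA.const_mul (-(1 / 4))).congr_of_eventuallyEq ?_,
    (hB.const_mul (-(1 / 4))).congr_of_eventuallyEq ?_, ?_⟩
  · filter_upwards [hev] with q hq
    simp only [bieField]
    rw [kernelE_add_kernelK_eq_ring ha hq.1.1.le hq.2, kernelS_eq_ring ha hq.1.1.le hq.2]
    simp only [mul_one, mul_zero, add_zero]
    ring
  · filter_upwards [hev] with q hq
    simp only [bieField]
    rw [kernelE_add_kernelK_eq_ring ha hq.1.1.le hq.2, kernelS_eq_ring ha hq.1.1.le hq.2]
    simp only [mul_one, mul_zero, zero_add]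
    ring
  · simp only [FunLike.coe_smul, Pi.smul_apply, smul_eq_mul]
    linear_combination (-(1 / 4)) * hAB

/-- On the arc dz = n_r dΓ and dr = -n_z dΓ, so the flux density is the normal component of the
field times the speed. -/
lemma flux_bieField (a c : ℝ) (j : Fin D.N) {t : ℝ} (ht : t ∈ Icc (0 : ℝ) 1) :
    (D.arc j).flux (bieField u g a c 1 0) (bieField u g a c 0 1) t
      = D.onArc (fun r z nr nz => u (cyl r 0 z) * kernelE a c r z nr nz) j t * (D.arc j).speed t
        + D.onArc (fun r z nr _ => u (cyl r 0 z) * kernelK a c r z nr) j t * (D.arc j).speed t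
        + D.onArc (fun r z nr nz => ⟪g (cyl r 0 z), cyl nr 0 nz⟫ * kernelS a c r z) j t
          * (D.arc j).speed t := by
  have hs := ((D.arc j).speed_pos ht).ne'
  have e := bieField_linear u g a c ((D.arc j).nr t) ((D.arc j).nz t) ((D.arc j).pt t)
  have e1 : deriv (D.arc j).z t = (D.arc j).nr t * (D.arc j).speed t := by
    rw [MeridianArc.nr, div_mul_cancel₀ _ hs]
  have e2 : deriv (D.arc j).r t = -((D.arc j).nz t * (D.arc j).speed t) := by
    rw [MeridianArc.nz, div_mul_cancel₀ _ hs, neg_neg]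
  rw [MeridianArc.flux, e1, e2]
  simp only [onArc]
  calc _ = (D.arc j).speed t * ((D.arc j).nr t * bieField u g a c 1 0 ((D.arc j).pt t)
        + (D.arc j).nz t * bieField u g a c 0 1 ((D.arc j).pt t)) := by ring
    _ = _ := by rw [← e]; simp only [bieField, MeridianArc.pt]; ring

/-- The boundary integral equation as a line integral. -/
theorem lineIntegral_add_eq_zero (h : IsAxisymC1 D u g)
    (harm : ∀ p ∈ D.inner, IsAxisymHarmonicAt (fun q => u (cyl q.1 0 q.2))
      (fun q => ⟪g (cyl q.1 0 q.2), cyl 1 0 0⟫) (fun q => ⟪g (cyl q.1 0 q.2), cyl 0 0 1⟫) p)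
    (hn : D.IsNode i t₀) (h0 : u (cyl ((D.arc i).r t₀) 0 ((D.arc i).z t₀)) = 0) :
    D.lineIntegral (fun r z nr nz =>
        u (cyl r 0 z) * kernelE ((D.arc i).r t₀) ((D.arc i).z t₀) r z nr nz)
      + D.lineIntegral (fun r z nr _ =>
        u (cyl r 0 z) * kernelK ((D.arc i).r t₀) ((D.arc i).z t₀) r z nr)
      + D.lineIntegral (fun r z nr nz =>
        ⟪g (cyl r 0 z), cyl nr 0 nz⟫ * kernelS ((D.arc i).r t₀) ((D.arc i).z t₀) r z) = 0 := by
  have iE := (h.regularAlong_kernelE hn h0).lineIntegrable hn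
  have iK := (h.regularAlong_kernelK hn h0).lineIntegrable hn
  have iS := h.lineIntegrable_kernelS hn
  have hV : D.IsSolenoidal (bieField u g ((D.arc i).r t₀) ((D.arc i).z t₀) 1 0)
      (bieField u g ((D.arc i).r t₀) ((D.arc i).z t₀) 0 1) ((D.arc i).pt t₀) :=
    { node := ⟨i, t₀, hn.mem_Icc, rfl⟩
      cont₁ := h.continuousOn_bieField hn.r_nonneg _ _ _
      cont₂ := h.continuousOn_bieField hn.r_nonneg _ _ _
      div_free := fun p hp => exists_div_bieField harm hn.r_nonneg hp
        (D.pt_ne_of_mem_inner hp hn.mem_Icc).symm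
      axis := fun p _ hp0 _ => by
        rw [bieField, hp0, kernelE_add_kernelK_axis, kernelS_axis, mul_zero, mul_zero, add_zero]
      integrable := fun j => by
        refine (((iE j).add (iK j)).add (iS j)).congr_ae ?_
        refine (ae_restrict_iff' measurableSet_uIoc).2 (Eventually.of_forall fun t ht => ?_)
        rw [uIoc_of_le zero_le_one] at ht
        exact (flux_bieField _ _ j (Ioc_subset_Icc_self ht)).symm }
  obtain ⟨C, hC⟩ := h.exists_bieField_le hn h0
  refine Eq.trans ?_
    (hV.sum_flux_eq_zero (hC 1 0 (by simp) (by simp)) (hC 0 1 (by simp) (by simp)))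
  simp only [lineIntegral]
  rw [← Finset.sum_add_distrib, ← Finset.sum_add_distrib]
  refine Finset.sum_congr rfl fun j _ => ?_
  rw [← intervalIntegral.integral_add (iE j) (iK j),
    ← intervalIntegral.integral_add ((iE j).add (iK j)) (iS j)]
  refine intervalIntegral.integral_congr fun t ht => ?_
  rw [uIcc_of_le zero_le_one] at ht
  exact (flux_bieField _ _ j ht).symm

end IsAxisymC1

/-! ### Surface integrals -/

lemma areaElement_surf (γ : MeridianArc) {t : ℝ} (ht : t ∈ Icc (0 : ℝ) 1) (θ : ℝ) :
    areaElement γ.surf (t, θ) = γ.r t * γ.speed t := by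
  have h1 : HasDerivAt (fun t => γ.surf (t, θ)) (cyl (deriv γ.r t) θ (deriv γ.z t)) t := by
    have := HasFDerivAt.comp_hasDerivAt (f := γ.pt) t (hasFDerivAt_cyl θ (γ.pt t))
      ((γ.hasDerivAt_r t).prodMk (γ.hasDerivAt_z t))
    rw [cylMap_apply] at this
    exact this
  have h2 : HasDerivAt (fun θ => γ.surf (t, θ)) (cyl (γ.r t) (θ + Real.pi / 2) 0) θ :=
    hasDerivAt_cyl_angle (γ.r t) (γ.z t) θ
  simp only [areaElement]
  rw [h1.deriv, h2.deriv, norm_cyl_sq, norm_cyl_sq, inner_cyl, sub_add_cancel_left, Real.cos_neg,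
    Real.cos_pi_div_two, ← γ.speed_sq]
  have e : γ.speed t ^ 2 * (γ.r t ^ 2 + 0 ^ 2)
      - (deriv γ.r t * γ.r t * 0 + deriv γ.z t * 0) ^ 2 = (γ.r t * γ.speed t) ^ 2 := by ring
  rw [e, Real.sqrt_sq (mul_nonneg (γ.r_nonneg t ht) (γ.speed_pos ht).le)]

lemma MeridianArc.continuous_surf (γ : MeridianArc) : Continuous γ.surf :=
  continuous_cyl.comp ((γ.continuous_r.comp continuous_fst).prodMk
    (continuous_snd.prodMk (γ.continuous_z.comp continuous_fst)))

lemma MeridianArc.continuousOn_normal (γ : MeridianArc) (s : Set ℝ) :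
    ContinuousOn γ.normal (Icc 0 1 ×ˢ s) :=
  continuous_cyl.comp_continuousOn ((γ.continuousOn_nr.comp continuousOn_fst fun _ hp => hp.1).prodMk
    (continuousOn_snd.prodMk (γ.continuousOn_nz.comp continuousOn_fst fun _ hp => hp.1)))

namespace AxisymDomain

variable {D : AxisymDomain} {i : Fin D.N} {t₀ : ℝ}

lemma IsNode.punctured_ae_eq (hn : D.IsNode i t₀) (j : Fin D.N) :
    (D.punctured j ((D.arc i).pt t₀) : Set ℝ) =ᵐ[volume] Icc 0 1 := by
  have hnull : ∀ᵐ t : ℝ, t ≠ t₀ := by simp [ae_iff]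
  filter_upwards [hnull] with t ht
  refine propext ⟨fun h => h.1, fun h => ⟨h, fun he => ht (hn.unique h he).2⟩⟩

lemma measurableSet_punctured (D : AxisymDomain) (j : Fin D.N) (p : ℝ × ℝ) :
    MeasurableSet (D.punctured j p) :=
  measurableSet_Icc.inter
    ((isOpen_compl_singleton.preimage (D.arc j).continuous_pt).measurableSet)

/-- The source point of the Green function. -/
noncomputable def source (D : AxisymDomain) (i : Fin D.N) (t₀ : ℝ) : E3 :=
  cyl ((D.arc i).r t₀) 0 ((D.arc i).z t₀)

lemma IsNode.norm_surf_sub_pos (hn : D.IsNode i t₀) {j : Fin D.N} {t : ℝ}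
    (ht : t ∈ D.punctured j ((D.arc i).pt t₀)) (θ : ℝ) :
    0 < ‖(D.arc j).surf (t, θ) - D.source i t₀‖ :=
  norm_cyl_sub_pos hn.r_nonneg ((D.arc j).r_nonneg t ht.1) ht.2 θ

lemma IsNode.continuousOn_green (hn : D.IsNode i t₀) (j : Fin D.N) (s : Set ℝ) :
    ContinuousOn (fun p => green (D.source i t₀) ((D.arc j).surf p))
      (D.punctured j ((D.arc i).pt t₀) ×ˢ s) :=
  continuousOn_const.div ((D.arc j).continuous_surf.sub continuous_const).norm.continuousOn
    fun p hp => (hn.norm_surf_sub_pos hp.1 p.2).ne'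

/-- `G` is positive, so by Tonelli it suffices that its azimuthal integral is integrable along the
arc; with the factor `r` of the area element that integral is four times `kernelS`. -/
lemma IsNode.integrableOn_green (hn : D.IsNode i t₀) (j : Fin D.N) :
    IntegrableOn (fun p => green (D.source i t₀) ((D.arc j).surf p)
        * ((D.arc j).r p.1 * (D.arc j).speed p.1))
      (D.punctured j ((D.arc i).pt t₀) ×ˢ Icc 0 (2 * Real.pi)) := by
  set P := D.punctured j ((D.arc i).pt t₀) with hP
  have hPm : MeasurableSet P := D.measurableSet_punctured j _
  have hrs : Continuous fun p : ℝ × ℝ => (D.arc j).r p.1 * (D.arc j).speed p.1 :=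
    ((D.arc j).continuous_r.comp continuous_fst).mul ((D.arc j).continuous_speed.comp continuous_fst)
  have hcont : ContinuousOn (fun p => green (D.source i t₀) ((D.arc j).surf p)
      * ((D.arc j).r p.1 * (D.arc j).speed p.1)) (P ×ˢ Icc 0 (2 * Real.pi)) :=
    (hn.continuousOn_green j _).mul hrs.continuousOn
  have hmeas := hcont.aestronglyMeasurable (μ := volume) (hPm.prod measurableSet_Icc)
  rw [Measure.volume_eq_prod, ← Measure.prod_restrict] at hmeas
  rw [IntegrableOn, Measure.volume_eq_prod, ← Measure.prod_restrict, integrable_prod_iff hmeas]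
  have hslice : ∀ t ∈ P, ContinuousOn (fun θ => green (D.source i t₀) ((D.arc j).surf (t, θ))
      * ((D.arc j).r t * (D.arc j).speed t)) (Icc 0 (2 * Real.pi)) := fun t ht =>
    hcont.comp (by fun_prop : Continuous fun θ : ℝ => (t, θ)).continuousOn fun θ hθ => ⟨ht, hθ⟩
  refine ⟨(ae_restrict_iff' hPm).2 (Eventually.of_forall fun t ht =>
    (hslice t ht).integrableOn_compact isCompact_Icc), ?_⟩
  have hS : IntegrableOn (fun t => 4 * (kernelS ((D.arc i).r t₀) ((D.arc i).z t₀) ((D.arc j).r t)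
      ((D.arc j).z t) * (D.arc j).speed t)) P := by
    rw [integrableOn_congr_set_ae (hn.punctured_ae_eq j), integrableOn_Icc_iff_integrableOn_Ioc,
      ← intervalIntegrable_iff_integrableOn_Ioc_of_le zero_le_one]
    exact ((hn.intervalIntegrable_kernelS j).mul_continuousOn
      (D.arc j).continuous_speed.continuousOn).const_mul 4
  refine hS.congr_fun (fun t ht => ?_) hPm
  have hr := (D.arc j).r_nonneg t ht.1
  have hs := ((D.arc j).speed_pos ht.1).le
  have hG := integral_green hn.r_nonneg hr ht.2
  have e : ∀ θ, ‖green (D.source i t₀) ((D.arc j).surf (t, θ))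
      * ((D.arc j).r t * (D.arc j).speed t)‖
      = green (D.source i t₀) (cyl ((D.arc j).r t) θ ((D.arc j).z t))
        * ((D.arc j).r t * (D.arc j).speed t) := fun θ =>
    Real.norm_of_nonneg (mul_nonneg (by unfold green; positivity) (mul_nonneg hr hs))
  simp only [e]
  rw [integral_mul_const, integral_Icc_eq_integral_Ioc,
    ← intervalIntegral.integral_of_le (by positivity), ← mul_assoc, ← hG, source]
  ring

/-- A surface integrand dominated by the Green function is integrable, and its integral reduces to
an integral along the meridian arc. -/
lemma IsNode.integrableOn_surface (hn : D.IsNode i t₀) (j : Fin D.N) {k : ℝ × ℝ → ℝ} {C : ℝ}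
    (hk : ContinuousOn k (D.punctured j ((D.arc i).pt t₀) ×ˢ Icc 0 (2 * Real.pi)))
    (hC : ∀ t ∈ D.punctured j ((D.arc i).pt t₀), ∀ θ,
      |k (t, θ)| ≤ C * green (D.source i t₀) ((D.arc j).surf (t, θ))) :
    IntegrableOn (fun p => k p * areaElement (D.arc j).surf p)
      (Icc (0 : ℝ) 1 ×ˢ Icc (0 : ℝ) (2 * Real.pi)) ∧
    ∫ p in Icc (0 : ℝ) 1 ×ˢ Icc (0 : ℝ) (2 * Real.pi), k p * areaElement (D.arc j).surf p
      = ∫ t in D.punctured j ((D.arc i).pt t₀),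
        ((D.arc j).r t * ∫ θ in (0 : ℝ)..(2 * Real.pi), k (t, θ)) * (D.arc j).speed t := by
  set P := D.punctured j ((D.arc i).pt t₀) with hP
  have hPm : MeasurableSet P := D.measurableSet_punctured j _
  have hae : (P ×ˢ Icc (0 : ℝ) (2 * Real.pi) : Set (ℝ × ℝ)) =ᵐ[volume]
      Icc (0 : ℝ) 1 ×ˢ Icc (0 : ℝ) (2 * Real.pi) :=
    Measure.set_prod_ae_eq (hn.punctured_ae_eq j) EventuallyEq.rfl
  have hQm : MeasurableSet (P ×ˢ Icc (0 : ℝ) (2 * Real.pi)) := hPm.prod measurableSet_Icc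
  have hrs : Continuous fun p : ℝ × ℝ => (D.arc j).r p.1 * (D.arc j).speed p.1 :=
    ((D.arc j).continuous_r.comp continuous_fst).mul ((D.arc j).continuous_speed.comp continuous_fst)
  have harea : ∀ p ∈ P ×ˢ Icc (0 : ℝ) (2 * Real.pi), k p * areaElement (D.arc j).surf p
      = k p * ((D.arc j).r p.1 * (D.arc j).speed p.1) := fun p hp => by
    rw [← areaElement_surf (D.arc j) hp.1.1 p.2]
  have hint : IntegrableOn (fun p => k p * ((D.arc j).r p.1 * (D.arc j).speed p.1))
      (P ×ˢ Icc 0 (2 * Real.pi)) := by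
    refine ((hn.integrableOn_green j).const_mul C).mono'
      ((hk.mul hrs.continuousOn).aestronglyMeasurable hQm) ?_
    refine (ae_restrict_iff' hQm).2 (Eventually.of_forall fun p hp => ?_)
    have hnn := mul_nonneg ((D.arc j).r_nonneg p.1 hp.1.1) ((D.arc j).speed_pos hp.1.1).le
    rw [norm_mul, Real.norm_of_nonneg hnn, ← mul_assoc C]
    exact mul_le_mul_of_nonneg_right (hC p.1 hp.1 p.2) hnn
  refine ⟨?_, ?_⟩
  · rw [← integrableOn_congr_set_ae hae]
    exact hint.congr_fun (fun p hp => (harea p hp).symm) hQm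
  · rw [← setIntegral_congr_set hae, setIntegral_congr_fun hQm harea, Measure.volume_eq_prod,
      setIntegral_prod _ hint]
    refine setIntegral_congr_fun hPm fun t _ => ?_
    simp only
    rw [integral_mul_const, integral_Icc_eq_integral_Ioc,
      ← intervalIntegral.integral_of_le (by positivity)]
    ring

lemma IsNode.setIntegral_punctured (hn : D.IsNode i t₀) (j : Fin D.N) (f : ℝ → ℝ) :
    ∫ t in D.punctured j ((D.arc i).pt t₀), f t = ∫ t in (0 : ℝ)..1, f t := by
  rw [setIntegral_congr_set (hn.punctured_ae_eq j), integral_Icc_eq_integral_Ioc,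
    ← intervalIntegral.integral_of_le zero_le_one]

end AxisymDomain

namespace IsAxisymC1

open AxisymDomain

variable {D : AxisymDomain} {u : E3 → ℝ} {g : E3 → E3} {i : Fin D.N} {t₀ : ℝ}

lemma surf_mem_closure {j : Fin D.N} {t : ℝ} (ht : t ∈ Icc (0 : ℝ) 1) (θ : ℝ) :
    (D.arc j).surf (t, θ) ∈ closure D.Ω := D.cyl_mem_closure (D.pt_mem_section ht) θ

lemma u_surf (h : IsAxisymC1 D u g) {j : Fin D.N} {t : ℝ} (ht : t ∈ Icc (0 : ℝ) 1) (θ : ℝ) :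
    u ((D.arc j).surf (t, θ)) = u (cyl ((D.arc j).r t) 0 ((D.arc j).z t)) :=
  h.axi _ _ _ (D.pt_mem_section ht).2

lemma inner_surf (h : IsAxisymC1 D u g) {j : Fin D.N} {t : ℝ} (ht : t ∈ Icc (0 : ℝ) 1) (θ : ℝ) :
    ⟪g ((D.arc j).surf (t, θ)), (D.arc j).normal (t, θ)⟫
      = ⟪g (cyl ((D.arc j).r t) 0 ((D.arc j).z t)), cyl ((D.arc j).nr t) 0 ((D.arc j).nz t)⟫ :=
  h.inner_cyl_eq (D.pt_mem_section (i := j) ht) θ _ _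

/-- Since |u| ≤ L|x - x₀| and |∂G/∂n| ≤ 2/|x - x₀|², the integrand is at most 2L G, which is
integrable. The vanishing of `u` at the source thus replaces a principal value by an absolutely
convergent integral. -/
lemma surface_double_layer (h : IsAxisymC1 D u g) (hn : D.IsNode i t₀) (h0 : u (D.source i t₀) = 0)
    (j : Fin D.N) :
    IntegrableOn (fun p => u ((D.arc j).surf p) * ⟪∇ (green (D.source i t₀)) ((D.arc j).surf p),
        (D.arc j).normal p⟫ * areaElement (D.arc j).surf p)
      (Icc (0 : ℝ) 1 ×ˢ Icc (0 : ℝ) (2 * Real.pi)) ∧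
    ∫ p in Icc (0 : ℝ) 1 ×ˢ Icc (0 : ℝ) (2 * Real.pi), u ((D.arc j).surf p)
        * ⟪∇ (green (D.source i t₀)) ((D.arc j).surf p), (D.arc j).normal p⟫
        * areaElement (D.arc j).surf p
      = ∫ t in (0 : ℝ)..1, -4 * ((D.onArc (fun r z nr nz => u (cyl r 0 z)
          * kernelE ((D.arc i).r t₀) ((D.arc i).z t₀) r z nr nz) j t * (D.arc j).speed t)
        + (D.onArc (fun r z nr _ => u (cyl r 0 z)
          * kernelK ((D.arc i).r t₀) ((D.arc i).z t₀) r z nr) j t * (D.arc j).speed t)) := by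
  obtain ⟨L, hL0, hL⟩ := h.exists_le_mul_dist hn h0
  have hgrad : ∀ t ∈ D.punctured j ((D.arc i).pt t₀), ∀ θ,
      ∇ (green (D.source i t₀)) ((D.arc j).surf (t, θ))
        = -(1 / ‖(D.arc j).surf (t, θ) - D.source i t₀‖ ^ 3)
          • ((D.arc j).surf (t, θ) - D.source i t₀) := fun t ht θ =>
    gradient_green _ (sub_ne_zero.1 (norm_pos_iff.1 (hn.norm_surf_sub_pos ht θ)))
  have hsub : (D.punctured j ((D.arc i).pt t₀) ×ˢ Icc 0 (2 * Real.pi) : Set (ℝ × ℝ))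
      ⊆ Icc 0 1 ×ˢ Icc 0 (2 * Real.pi) := prod_mono (fun t ht => ht.1) subset_rfl
  have hsurf := (D.arc j).continuous_surf
  have hcont : ContinuousOn (fun p => u ((D.arc j).surf p)
      * ⟪∇ (green (D.source i t₀)) ((D.arc j).surf p), (D.arc j).normal p⟫)
      (D.punctured j ((D.arc i).pt t₀) ×ˢ Icc 0 (2 * Real.pi)) := by
    refine (h.cont.comp hsurf.continuousOn fun p hp => surf_mem_closure hp.1.1 p.2).mul
      (ContinuousOn.inner (𝕜 := ℝ) ?_ (((D.arc j).continuousOn_normal _).mono hsub))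
    refine ContinuousOn.congr (f := fun p => -(1 / ‖(D.arc j).surf p - D.source i t₀‖ ^ 3)
      • ((D.arc j).surf p - D.source i t₀)) ?_ fun p hp => hgrad p.1 hp.1 p.2
    have hd : Continuous fun p => (D.arc j).surf p - D.source i t₀ := hsurf.sub continuous_const
    have hinv : ContinuousOn (fun p => 1 / ‖(D.arc j).surf p - D.source i t₀‖ ^ 3)
        (D.punctured j ((D.arc i).pt t₀) ×ˢ Icc 0 (2 * Real.pi)) :=
      continuousOn_const.div (hd.norm.pow 3).continuousOn
        fun p hp => (pow_pos (hn.norm_surf_sub_pos hp.1 p.2) 3).ne'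
    exact hinv.neg.smul hd.continuousOn
  have key := hn.integrableOn_surface j (C := 2 * L) hcont fun t ht θ => by
    have hN := hn.norm_surf_sub_pos ht θ
    have hu : |u ((D.arc j).surf (t, θ))| ≤ L * ‖(D.arc j).surf (t, θ) - D.source i t₀‖ := by
      rw [h.u_surf ht.1]
      refine (hL _ (D.pt_mem_section ht.1)).trans (mul_le_mul_of_nonneg_left ?_ hL0)
      exact (dist_le_meridianDist _ _ ((D.arc j).pt t)).trans
        (meridianDist_le_norm hn.r_nonneg ((D.arc j).r_nonneg t ht.1) θ)
    have hi : |⟪∇ (green (D.source i t₀)) ((D.arc j).surf (t, θ)), (D.arc j).normal (t, θ)⟫|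
        ≤ 1 / ‖(D.arc j).surf (t, θ) - D.source i t₀‖ ^ 2 * 2 := by
      refine (abs_real_inner_le_norm _ _).trans (mul_le_mul (le_of_eq ?_)
        ((D.arc j).norm_normal_le t θ) (norm_nonneg _) (by positivity))
      rw [hgrad t ht, norm_smul, norm_neg, Real.norm_of_nonneg (by positivity)]
      field_simp
    rw [abs_mul]
    refine (mul_le_mul hu hi (abs_nonneg _) (by positivity)).trans (le_of_eq ?_)
    rw [green]
    field_simp
  refine ⟨key.1, key.2.trans ?_⟩
  rw [← hn.setIntegral_punctured j]
  refine setIntegral_congr_fun (D.measurableSet_punctured j _) fun t ht => ?_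
  have hG := integral_normal_deriv_green hn.r_nonneg ((D.arc j).r_nonneg t ht.1) ht.2
    ((D.arc j).nr t) ((D.arc j).nz t)
  simp only [h.u_surf ht.1]
  rw [intervalIntegral.integral_const_mul, mul_left_comm]
  have e : (D.arc j).r t * ∫ θ in (0 : ℝ)..(2 * Real.pi),
      ⟪∇ (green (D.source i t₀)) ((D.arc j).surf (t, θ)), (D.arc j).normal (t, θ)⟫ = _ := hG
  rw [e]
  simp only [onArc]
  ring

lemma surface_single_layer (h : IsAxisymC1 D u g) (hn : D.IsNode i t₀) (j : Fin D.N) :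
    IntegrableOn (fun p => ⟪g ((D.arc j).surf p), (D.arc j).normal p⟫
        * green (D.source i t₀) ((D.arc j).surf p) * areaElement (D.arc j).surf p)
      (Icc (0 : ℝ) 1 ×ˢ Icc (0 : ℝ) (2 * Real.pi)) ∧
    ∫ p in Icc (0 : ℝ) 1 ×ˢ Icc (0 : ℝ) (2 * Real.pi), ⟪g ((D.arc j).surf p), (D.arc j).normal p⟫
        * green (D.source i t₀) ((D.arc j).surf p) * areaElement (D.arc j).surf p
      = ∫ t in (0 : ℝ)..1, 4 * (D.onArc (fun r z nr nz => ⟪g (cyl r 0 z), cyl nr 0 nz⟫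
          * kernelS ((D.arc i).r t₀) ((D.arc i).z t₀) r z) j t * (D.arc j).speed t) := by
  obtain ⟨B, hB⟩ := D.isCompact_closure.exists_bound_of_continuousOn h.grad_cont
  have hsub : (D.punctured j ((D.arc i).pt t₀) ×ˢ Icc 0 (2 * Real.pi) : Set (ℝ × ℝ))
      ⊆ Icc 0 1 ×ˢ Icc 0 (2 * Real.pi) := prod_mono (fun t ht => ht.1) subset_rfl
  have hcont : ContinuousOn (fun p => ⟪g ((D.arc j).surf p), (D.arc j).normal p⟫
      * green (D.source i t₀) ((D.arc j).surf p))
      (D.punctured j ((D.arc i).pt t₀) ×ˢ Icc 0 (2 * Real.pi)) :=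
    (ContinuousOn.inner (𝕜 := ℝ) (h.grad_cont.comp (D.arc j).continuous_surf.continuousOn
      fun p hp => surf_mem_closure hp.1.1 p.2) (((D.arc j).continuousOn_normal _).mono hsub)).mul
      (hn.continuousOn_green j _)
  have key := hn.integrableOn_surface j (C := |B| * 2) hcont fun t ht θ => by
    have hg : 0 ≤ green (D.source i t₀) ((D.arc j).surf (t, θ)) := by unfold green; positivity
    rw [abs_mul, abs_of_nonneg hg]
    refine mul_le_mul_of_nonneg_right ((abs_real_inner_le_norm _ _).trans ?_) hg
    exact mul_le_mul ((hB _ (surf_mem_closure ht.1 θ)).trans (le_abs_self B))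
      ((D.arc j).norm_normal_le t θ) (norm_nonneg _) (abs_nonneg _)
  refine ⟨key.1, key.2.trans ?_⟩
  rw [← hn.setIntegral_punctured j]
  refine setIntegral_congr_fun (D.measurableSet_punctured j _) fun t ht => ?_
  have hG := integral_green hn.r_nonneg ((D.arc j).r_nonneg t ht.1) ht.2
  simp only [h.inner_surf ht.1]
  rw [intervalIntegral.integral_const_mul, mul_left_comm]
  have e : (D.arc j).r t * ∫ θ in (0 : ℝ)..(2 * Real.pi),
      green (D.source i t₀) ((D.arc j).surf (t, θ)) = _ := hG
  rw [e]
  simp only [onArc]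
  ring

lemma surfaceIntegral_double_layer (h : IsAxisymC1 D u g) (hn : D.IsNode i t₀)
    (h0 : u (D.source i t₀) = 0) :
    D.surfaceIntegral (fun x n => u x * ⟪∇ (green (D.source i t₀)) x, n⟫)
      = -4 * (D.lineIntegral (fun r z nr nz =>
          u (cyl r 0 z) * kernelE ((D.arc i).r t₀) ((D.arc i).z t₀) r z nr nz)
        + D.lineIntegral (fun r z nr _ =>
          u (cyl r 0 z) * kernelK ((D.arc i).r t₀) ((D.arc i).z t₀) r z nr)) := by
  have iE := (h.regularAlong_kernelE hn h0).lineIntegrable hn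
  have iK := (h.regularAlong_kernelK hn h0).lineIntegrable hn
  simp only [surfaceIntegral, lineIntegral]
  rw [← Finset.sum_add_distrib, Finset.mul_sum]
  refine Finset.sum_congr rfl fun j _ => (h.surface_double_layer hn h0 j).2.trans ?_
  rw [intervalIntegral.integral_const_mul, intervalIntegral.integral_add (iE j) (iK j)]

lemma surfaceIntegral_single_layer (h : IsAxisymC1 D u g) (hn : D.IsNode i t₀) :
    D.surfaceIntegral (fun x n => ⟪g x, n⟫ * green (D.source i t₀) x)
      = 4 * D.lineIntegral (fun r z nr nz =>
          ⟪g (cyl r 0 z), cyl nr 0 nz⟫ * kernelS ((D.arc i).r t₀) ((D.arc i).z t₀) r z) := by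
  simp only [surfaceIntegral, lineIntegral]
  rw [Finset.mul_sum]
  refine Finset.sum_congr rfl fun j _ => (h.surface_single_layer hn j).2.trans ?_
  rw [intervalIntegral.integral_const_mul]

end IsAxisymC1

end NSBIM

/-! ### Assembly of the claims -/

theorem mainTheorem3
    (D : AxisymDomain)
    -- an axisymmetric potential, harmonic in the domain and `C¹` up to the boundary
    (φ : E3 → ℝ) (gradφ : E3 → E3)
    (hφ_harm : InnerProductSpace.HarmonicOnNhd φ D.Ω)
    (hφ_cont : ContinuousOn φ (closure D.Ω))
    (hφ_grad : ∀ x ∈ D.Ω, HasGradientAt φ (gradφ x) x)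
    (hgrad_cont : ContinuousOn gradφ (closure D.Ω))
    (hφ_axi : ∀ r θ z, cyl r 0 z ∈ closure D.Ω → φ (cyl r θ z) = φ (cyl r 0 z))
    -- the node `x₀`, its outward normal `n₀`, and the point `x_D` on the axis
    (i₀ : Fin D.N) (t₀ : ℝ) (hnode : D.IsNode i₀ t₀)
    (r₀ z₀ nr₀ nz₀ : ℝ)
    (hr₀ : r₀ = (D.arc i₀).r t₀) (hz₀ : z₀ = (D.arc i₀).z t₀)
    (hnr₀ : nr₀ = (D.arc i₀).nr t₀) (hnz₀ : nz₀ = (D.arc i₀).nz t₀)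
    (x₀ n₀ xD : E3) (zD : ℝ)
    (hx₀ : x₀ = cyl r₀ 0 z₀) (hn₀ : n₀ = cyl nr₀ 0 nz₀) (hxD : xD = cyl 0 0 zD)
    (hxD_out : xD ∉ closure D.Ω) (hxD_ne : ⟪n₀, x₀ - xD⟫ ≠ 0)
    -- `(∂φ/∂n)₀`, the functions `ψ` and `χ = φ - ψ`, and the normal derivative of `χ`
    (q₀ : ℝ) (hq₀ : q₀ = ⟪gradφ x₀, n₀⟫)
    (ψ : E3 → ℝ) (hψ : ψ = auxPsi (φ x₀) q₀ x₀ n₀ xD)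
    (χ : E3 → ℝ) (hχ : ∀ x, χ x = φ x - ψ x)
    (dχ : E3 → E3 → ℝ) (hdχ : ∀ x n, dχ x n = ⟪gradφ x, n⟫ - ⟪∇ ψ x, n⟫)
    -- the integrands of the three line integrals, as functions of `(r, z, n_r, n_z)`
    (fE fK fS : ℝ → ℝ → ℝ → ℝ → ℝ)
    (hfE : ∀ r z nr nz, fE r z nr nz = χ (cyl r 0 z) * kernelE r₀ z₀ r z nr nz)
    (hfK : ∀ r z nr nz, fK r z nr nz = χ (cyl r 0 z) * kernelK r₀ z₀ r z nr)
    (hfS : ∀ r z nr nz, fS r z nr nz = dχ (cyl r 0 z) (cyl nr 0 nz) * kernelS r₀ z₀ r z) :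
    -- explicit forms of `ψ` and of its normal derivative
    (∀ r θ z nr nz, cyl r θ z ≠ xD →
      ψ (cyl r θ z) = φ x₀ + q₀ * ((rho zD r z - rho zD r₀ z₀) / rho zD r z)
        * (rho zD r₀ z₀ ^ 2 / sVal zD r₀ z₀ nr₀ nz₀) ∧
      DifferentiableAt ℝ ψ (cyl r θ z) ∧
      ⟪∇ ψ (cyl r θ z), cyl nr θ nz⟫ =
        q₀ * (rho zD r₀ z₀ / rho zD r z) ^ 3
          * (sVal zD r z nr nz / sVal zD r₀ z₀ nr₀ nz₀)) ∧
    -- closed form of the azimuthal integrals of `G` and `∂G/∂n`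
    (∀ a c r z nr nz : ℝ, 0 ≤ a → 0 ≤ r → (r, z) ≠ (a, c) →
      0 ≤ param a c r z ∧ param a c r z < 1 ∧
      r * (∫ θ in (0 : ℝ)..(2 * Real.pi), green (cyl a 0 c) (cyl r θ z))
        = 4 * kernelS a c r z ∧
      r * (∫ θ in (0 : ℝ)..(2 * Real.pi),
          ⟪∇ (green (cyl a 0 c)) (cyl r θ z), cyl nr θ nz⟫)
        = -4 * (kernelE a c r z nr nz + kernelK a c r z nr)) ∧
    -- the surface integrals converge and reduce to convergent line integrals
    (D.SurfaceIntegrable (fun x n => χ x * ⟪∇ (green x₀) x, n⟫) ∧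
      D.SurfaceIntegrable (fun x n => dχ x n * green x₀ x) ∧
      D.LineIntegrable fE ∧ D.LineIntegrable fK ∧ D.LineIntegrable fS ∧
      D.surfaceIntegral (fun x n => χ x * ⟪∇ (green x₀) x, n⟫)
        = -4 * (D.lineIntegral fE + D.lineIntegral fK) ∧
      D.surfaceIntegral (fun x n => dχ x n * green x₀ x) = 4 * D.lineIntegral fS) ∧
    -- the non-singular boundary integral equation, over the surface and as a line integral
    (D.surfaceIntegral (fun x n => χ x * ⟪∇ (green x₀) x, n⟫)
        = D.surfaceIntegral (fun x n => dχ x n * green x₀ x) ∧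
      D.lineIntegral fE = -D.lineIntegral fK - D.lineIntegral fS) ∧
    -- `K` has a logarithmic singularity at `m = 1`
    Tendsto (fun m => ellipticK m / Real.log (1 / (1 - m))) (𝓝[<] 1) (𝓝 (1 / 2)) ∧
    -- which is cancelled: the integrands are continuous, with value `0` at the node
    (D.RegularAlong r₀ z₀ fE ∧ D.RegularAlong r₀ z₀ fK ∧
      (0 < r₀ →
        (fun t => χ ((D.arc i₀).surf (t, 0)))
          =O[𝓝[Icc 0 1 \ {t₀}] t₀]
            (fun t => Real.sqrt (1 - param r₀ z₀ ((D.arc i₀).r t) ((D.arc i₀).z t))) ∧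
        Tendsto (fun t => ellipticK (param r₀ z₀ ((D.arc i₀).r t) ((D.arc i₀).z t))
            * χ ((D.arc i₀).surf (t, 0)))
          (𝓝[Icc 0 1 \ {t₀}] t₀) (𝓝 0))) ∧
    ((fun x => gradφ x - gradφ x₀) =O[𝓝[closure D.Ω] x₀] (fun x => x - x₀) →
      D.RegularAlong r₀ z₀ fS ∧
      (0 < r₀ →
        (fun t => dχ ((D.arc i₀).surf (t, 0)) ((D.arc i₀).normal (t, 0)))
          =O[𝓝[Icc 0 1 \ {t₀}] t₀]
            (fun t => Real.sqrt (1 - param r₀ z₀ ((D.arc i₀).r t) ((D.arc i₀).z t))) ∧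
        Tendsto (fun t => ellipticK (param r₀ z₀ ((D.arc i₀).r t) ((D.arc i₀).z t))
            * dχ ((D.arc i₀).surf (t, 0)) ((D.arc i₀).normal (t, 0)))
          (𝓝[Icc 0 1 \ {t₀}] t₀) (𝓝 0))) ∧
    -- the axis is not exceptional: the kernels are jointly continuous in the node `(a, c)`, the
    -- integration point `(r, z)` and the normal, for `a ≥ 0` and `r ≥ 0`, both `0` included
    (ContinuousOn (fun p : ℝ × ℝ × ℝ × ℝ × ℝ × ℝ =>
        kernelE p.1 p.2.1 p.2.2.1 p.2.2.2.1 p.2.2.2.2.1 p.2.2.2.2.2)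
        {p | 0 ≤ p.1 ∧ 0 ≤ p.2.2.1 ∧ (p.2.2.1, p.2.2.2.1) ≠ (p.1, p.2.1)} ∧
      ContinuousOn (fun p : ℝ × ℝ × ℝ × ℝ × ℝ =>
        kernelK p.1 p.2.1 p.2.2.1 p.2.2.2.1 p.2.2.2.2)
        {p | 0 ≤ p.1 ∧ 0 ≤ p.2.2.1 ∧ (p.2.2.1, p.2.2.2.1) ≠ (p.1, p.2.1)} ∧
      ContinuousOn (fun p : ℝ × ℝ × ℝ × ℝ => kernelS p.1 p.2.1 p.2.2.1 p.2.2.2)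
        {p | 0 ≤ p.1 ∧ 0 ≤ p.2.2.1 ∧ (p.2.2.1, p.2.2.2) ≠ (p.1, p.2.1)}) := by
  subst hr₀ hz₀ hnr₀ hnz₀ hx₀ hn₀ hxD
  set x₀ := cyl ((D.arc i₀).r t₀) 0 ((D.arc i₀).z t₀) with hx₀
  set n₀ := cyl ((D.arc i₀).nr t₀) 0 ((D.arc i₀).nz t₀) with hn₀
  subst hψ
  set ψ := auxPsi (φ x₀) q₀ x₀ n₀ (cyl 0 0 zD) with hψ
  obtain rfl : χ = fun x => φ x - ψ x := funext hχ
  obtain rfl : dχ = fun x n => ⟪gradφ x - ∇ ψ x, n⟫ := by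
    funext x n
    rw [hdχ, inner_sub_left]
  obtain rfl : fE = fun r z nr nz => (φ (cyl r 0 z) - ψ (cyl r 0 z))
      * kernelE ((D.arc i₀).r t₀) ((D.arc i₀).z t₀) r z nr nz := by
    funext r z nr nz
    exact hfE r z nr nz
  obtain rfl : fK = fun r z nr _ => (φ (cyl r 0 z) - ψ (cyl r 0 z))
      * kernelK ((D.arc i₀).r t₀) ((D.arc i₀).z t₀) r z nr := by
    funext r z nr nz
    exact hfK r z nr nz
  obtain rfl : fS = fun r z nr nz => ⟪gradφ (cyl r 0 z) - ∇ ψ (cyl r 0 z), cyl nr 0 nz⟫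
      * kernelS ((D.arc i₀).r t₀) ((D.arc i₀).z t₀) r z := by
    funext r z nr nz
    exact hfS r z nr nz
  have hpot : IsAxisymC1 D φ gradφ := ⟨hφ_cont, hφ_grad, hgrad_cont, hφ_axi⟩
  have hC1 : IsAxisymC1 D (fun x => φ x - ψ x) (fun x => gradφ x - ∇ ψ x) :=
    hpot.sub (isAxisymC1_auxPsi hxD_out _ _ _ _)
  have harm : ∀ p ∈ D.inner, IsAxisymHarmonicAt (fun q => φ (cyl q.1 0 q.2) - ψ (cyl q.1 0 q.2))
      (fun q => ⟪gradφ (cyl q.1 0 q.2) - ∇ ψ (cyl q.1 0 q.2), cyl 1 0 0⟫)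
      (fun q => ⟪gradφ (cyl q.1 0 q.2) - ∇ ψ (cyl q.1 0 q.2), cyl 0 0 1⟫) p := fun p hp => by
    simp only [inner_sub_left]
    exact (hpot.isAxisymHarmonicAt hφ_harm hp).sub (isAxisymHarmonicAt_auxPsi hxD_out _ _ _ _ hp)
  have hmem : x₀ ∈ closure D.Ω := (D.pt_mem_section (i := i₀) hnode.mem_Icc).2
  -- The one property of ψ at x₀ on which the integral equation depends; the matching normal
  -- derivative enters only in the regularity of the single layer term.
  have h0 : φ x₀ - ψ x₀ = 0 := by
    have : ‖x₀ - cyl 0 0 zD‖ ≠ 0 :=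
      norm_ne_zero_iff.2 (sub_ne_zero.2 fun h => hxD_out (h ▸ hmem))
    rw [hψ, auxPsi, div_self this]
    ring
  have hE := hC1.regularAlong_kernelE hnode h0
  have hK := hC1.regularAlong_kernelK hnode h0
  have hχO := hC1.isBigO_nodeDist hnode h0
  have hline := hC1.lineIntegral_add_eq_zero harm hnode h0
  have hdouble := hC1.surfaceIntegral_double_layer hnode h0
  have hsingle := hC1.surfaceIntegral_single_layer hnode
  refine ⟨fun r θ z nr nz hne => ⟨auxPsi_cyl _ _ _ _ _ _ _ hne,
      (hasGradientAt_auxPsi _ _ _ _ _ hne).differentiableAt,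
      inner_gradient_auxPsi _ _ _ _ _ _ _ hne nr nz⟩,
    fun a c r z nr nz ha hr hne => ⟨param_nonneg ha hr, param_lt_one ha hr hne,
      integral_green ha hr hne, integral_normal_deriv_green ha hr hne nr nz⟩,
    ⟨fun j => (hC1.surface_double_layer hnode h0 j).1,
      fun j => (hC1.surface_single_layer hnode j).1, hE.lineIntegrable hnode,
      hK.lineIntegrable hnode, hC1.lineIntegrable_kernelS hnode, hdouble, hsingle⟩,
    ⟨hdouble.trans (Eq.trans ?_ hsingle.symm), by linarith⟩, tendsto_ellipticK_div_log,
    ⟨hE, hK, fun _ => ⟨hnode.isBigO_sqrt_one_sub_param hχO, hnode.tendsto_ellipticK_mul hχO⟩⟩,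
    fun hG => ?_, continuousOn_kernelE, continuousOn_kernelK, continuousOn_kernelS⟩
  · linarith
  -- Here n₀ · (x₀ - x_D) ≠ 0 is needed: it makes ∂ψ/∂n at x₀ equal to `q₀`.
  · have hO := hnode.isBigO_normal_deriv (φ₀ := φ x₀) hx₀ hn₀ hxD_out hxD_ne hq₀ hG
    exact ⟨hC1.regularAlong_kernelS hnode hO, fun _ =>
      ⟨hnode.isBigO_sqrt_one_sub_param hO, hnode.tendsto_ellipticK_mul hO⟩⟩
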